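/- **Setting.** Let $F=f+\psi$ on $\mathbb R^p$, $f=\frac1n\sum_{i=1}^n f_i$, where each $f_i$ is convex and $L_i$-smooth with $L_i\ge\mu$, $f$ is $\mu$-strongly convex ($\mu>0$), and $\psi:\mathbb R^p\to(-\infty,+\infty]$ is convex and lower semicontinuous. Let $F^\star=\inf F$ and let $x_0$ satisfy $\psi(x_0)<\infty$. Let $Q=(q_1,\dots,q_n)$ be a probability distribution with all $q_i>0$, and put $$L_Q=\max_i\frac{L_i}{q_in},\quad \rho_Q=\frac1{n\min_iq_i},\quad \eta=\min\Big(\frac1{3L_Q},\frac1{15\mu n}\Big),\quad B=3\rho_Q\tilde\sigma^2\sqrt{\frac{\eta}{\mu n}} .$$ A perturbed gradient $\tilde\nabla f_i(x)$ is $\nabla f_i(x)$ plus a random perturbation which, given the past, has mean zero and variance at most $\tilde\sigma^2$; the $n$ perturbations used in one evaluation of $\tilde\nabla f(x)=\frac1n\sum_i\tilde\nabla f_i(x)$ are uncorrelated given the past. **Accelerated random-SVRG** with step sizes $(\eta_k)_{k\ge1}$ and $\gamma_0=\mu$: start from $\tilde x_0=v_0=x_0$, $\bar z_0=\tilde\nabla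 f(x_0)$. For $k=1,2,\dots$: * take $\gamma_k=(1-\delta_k)\gamma_{k-1}+\delta_k\mu$, $\delta_k=\sqrt{5\eta_k\gamma_k/(3n)}$, $\theta_k=\frac{3n\delta_k-5\mu\eta_k}{3-5\mu\eta_k}$, $y_{k-1}=\theta_kv_{k-1}+(1-\theta_k)\tilde x_{k-1}$; * draw $i_k\sim Q$ independently of the past, and set $g_k=\frac1{q_{i_k}n}\big(\tilde\nabla f_{i_k}(y_{k-1})-\tilde\nabla f_{i_k}(\tilde x_{k-1})\big)+\bar z_{k-1}$ (with newly drawn perturbations of the two gradients), $x_k=\mathrm{Prox}_{\eta_k\psi}[y_{k-1}-\eta_kg_k]$, where $\mathrm{Prox}_{\eta\psi}[u]=\arg\min_z\{\eta\psi(z)+\frac12\|z-u\|^2\}$; * set $v_k=\big(1-\frac{\mu\delta_k}{\gamma_k}\big)v_{k-1}+\frac{\mu\delta_k}{\gamma_k}y_{k-1}+\frac{\delta_k}{\gamma_k\eta_k}(x_k-y_{k-1})$; * with probability $1/n$, independently of everything drawn before, set $\tilde x_k=x_k$ and $\bar z_k=\tilde\nabla f(\tilde x_k)$ (with newly drawn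 perturbations); otherwise $\tilde x_k=\tilde x_{k-1}$, $\bar z_k=\bar z_{k-1}$. The output after $k$ iterations is either the iterate $o_k=x_k$ or the anchor point $o_k=\tilde x_k$. One evaluation of a single $\tilde\nabla f_i$ is one gradient evaluation ($n$ at the start, two per iteration, $n$ more at each anchor update). **Claim.** There are universal constants $c\ge1$ and $C>0$ such that the following holds for all data as above, for either choice of output and every $0<\varepsilon\le cB$. Run the algorithm from $x_0$ with constant step $\eta_k=\eta$. Then there is a first $K_1$ with $\mathbb E[F(o_{K_1})-F^\star]\le cB$. Restart the algorithm from the point $o_{K_1}$ with steps $\eta_k=\min\big(\eta,\frac{12n}{5\mu(k+2)^2}\big)$, and let $o'_k$ be its outputs. Then there is $K_2$ with $\mathbb E[F(o'_{K_2})-F^\star]\le\varepsilon$ such that the expected total number of gradient evaluations of the two stages ($K_1$ and $K_2$ iterations) is at most $$C\left[\left(n+\sqrt{\frac{nL_Q}{\mu}}\right)\log^+\frac{F(x_0)-F^\star}{\varepsilon}+\frac{\rho_Q\tilde\sigma^2}{\mu\varepsilon}\right],\qquad \log^+t=\max(0,\log t).$$ -/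

import Mathlib

open MeasureTheory ProbabilityTheory
open scoped BigOperators ENNReal

noncomputable section

namespace AccSVRG

/-- The Euclidean space `ℝ^p`. -/
abbrev Vec (p : ℕ) : Type := EuclideanSpace ℝ (Fin p)

/-- The data of the composite finite-sum problem `min_x (1/n) ∑ i, f i x + ψ x`, together with the
smoothness constants `L i`, the strong convexity constant `μ`, the sampling distribution `q` on the
indices, and the level `σ` of the gradient perturbations (their variance is at most `σ ^ 2`). -/
structure Problem (n p : ℕ) where
  f : Fin n → Vec p → ℝ
  ψ : Vec p → EReal
  L : Fin n → ℝ
  μ : ℝ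
  q : Fin n → ℝ
  σ : ℝ

namespace Problem

variable {n p : ℕ} (D : Problem n p)

/-- The smooth part `f = (1/n) ∑ i, f i`. -/
def avg (x : Vec p) : ℝ := (1 / (n : ℝ)) * ∑ i, D.f i x

/-- The objective `F = f + ψ`, with values in the extended reals. -/
def F (x : Vec p) : EReal := (D.avg x : EReal) + D.ψ x

/-- The optimal value `F⋆ = inf F`. -/
def Fstar : EReal := ⨅ x, D.F x

/-- The optimality gap `F x - F⋆ ∈ [0, ∞]`. -/
def gap (x : Vec p) : ℝ≥0∞ := (D.F x - D.Fstar).toENNReal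

/-- `L_Q = max_i L_i / (q_i n)`. -/
def LQ : ℝ := ⨆ i, D.L i / (D.q i * n)

/-- `ρ_Q = 1 / (n min_i q_i)`. -/
def rhoQ : ℝ := 1 / ((n : ℝ) * ⨅ i, D.q i)

/-- The constant step size `η = min (1 / (3 L_Q)) (1 / (15 μ n))`. -/
def eta : ℝ := min (1 / (3 * D.LQ)) (1 / (15 * D.μ * n))

/-- The decreasing step sizes `η_k = min η (12 n / (5 μ (k + 2)^2))`. -/
def etaDecr (k : ℕ) : ℝ := min D.eta (12 * n / (5 * D.μ * ((k : ℝ) + 2) ^ 2))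

/-- The noise level `B = 3 ρ_Q σ² √(η / (μ n))` of the constant-step method. -/
def B : ℝ := 3 * D.rhoQ * D.σ ^ 2 * Real.sqrt (D.eta / (D.μ * n))

/-- The standing assumptions: every `f i` is convex and `L i`-smooth with `L i ≥ μ`, the average is
`μ`-strongly convex with `μ > 0`, `ψ` is convex and lower semicontinuous with values in
`(-∞, ∞]`, and `q` is a probability distribution charging every index. -/
structure Admissible : Prop where
  mu_pos : 0 < D.μ
  mu_le : ∀ i, D.μ ≤ D.L i
  convex : ∀ i, ConvexOn ℝ Set.univ (D.f i)
  differentiable : ∀ i, Differentiable ℝ (D.f i)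
  smooth : ∀ i x y, ‖gradient (D.f i) x - gradient (D.f i) y‖ ≤ D.L i * ‖x - y‖
  strongConvex : StrongConvexOn Set.univ D.μ D.avg
  psi_ne_bot : ∀ x, D.ψ x ≠ ⊥
  psi_lsc : LowerSemicontinuous D.ψ
  psi_convex : Convex ℝ {z : Vec p × ℝ | D.ψ z.1 ≤ (z.2 : EReal)}
  q_pos : ∀ i, 0 < D.q i
  q_sum : ∑ i, D.q i = 1

end Problem

/-- `x = Prox_{ηψ}[u]`: the point `x` minimizes `z ↦ η ψ(z) + ‖z - u‖² / 2`. -/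
def IsProx {p : ℕ} (η : ℝ) (ψ : Vec p → EReal) (u x : Vec p) : Prop :=
  ∀ z, (η : EReal) * ψ x + ((‖x - u‖ ^ 2 / 2 : ℝ) : EReal)
    ≤ (η : EReal) * ψ z + ((‖z - u‖ ^ 2 / 2 : ℝ) : EReal)

/-- A run of accelerated random-SVRG with perturbed gradients, with step sizes `η k` (`k ≥ 1`),
parameter `γ₀` and (possibly random) initial point `x₀`, on the probability space `(Ω, P)`.

Iteration `k + 1` draws, in this order: the index `idx (k + 1)`; the perturbations `ζ (k + 1)` and
`ζ' (k + 1)` of the gradients of `f_{idx (k + 1)}` at `y k` and at the anchor; the coin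
`refresh (k + 1)` that decides on the update of the anchor; and the perturbations `ξ (k + 1) i`
of the gradients of `f i` at the new anchor (used only if the anchor is updated). The
σ-algebras `mIdx`, `mNoise`, `mCoin`, `mAll` represent the information available after
each of these four draws; at time `0` only the initial point (in `mCoin 0`) and the
perturbations `ξ 0 i` at the initial anchor are drawn. -/
structure Run {n p : ℕ} (D : Problem n p) {Ω : Type*} [mΩ : MeasurableSpace Ω] (P : Measure Ω)
    (η : ℕ → ℝ) (γ₀ : ℝ) (x₀ : Ω → Vec p) where
  -- the deterministic parameter sequences
  γ : ℕ → ℝ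
  δ : ℕ → ℝ
  γ_zero : γ 0 = γ₀
  γ_succ : ∀ k, γ (k + 1) = (1 - δ (k + 1)) * γ k + δ (k + 1) * D.μ
  δ_eq : ∀ k, δ (k + 1) = Real.sqrt (5 * η (k + 1) * γ (k + 1) / (3 * n))
  -- the random draws
  idx : ℕ → Ω → Fin n
  ζ : ℕ → Ω → Vec p
  ζ' : ℕ → Ω → Vec p
  refresh : ℕ → Ω → Bool
  ξ : ℕ → Fin n → Ω → Vec p
  -- the iterates
  x : ℕ → Ω → Vec p
  y : ℕ → Ω → Vec p
  v : ℕ → Ω → Vec p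
  anchor : ℕ → Ω → Vec p
  zbar : ℕ → Ω → Vec p
  g : ℕ → Ω → Vec p
  -- initialization
  x_zero : ∀ ω, x 0 ω = x₀ ω
  v_zero : ∀ ω, v 0 ω = x₀ ω
  anchor_zero : ∀ ω, anchor 0 ω = x₀ ω
  zbar_zero : ∀ ω, zbar 0 ω = (1 / (n : ℝ)) • ∑ i, (gradient (D.f i) (anchor 0 ω) + ξ 0 i ω)
  -- iteration `k + 1`
  y_eq : ∀ k ω,
    y k ω = ((3 * n * δ (k + 1) - 5 * D.μ * η (k + 1)) / (3 - 5 * D.μ * η (k + 1))) • v k ω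
      + (1 - (3 * n * δ (k + 1) - 5 * D.μ * η (k + 1)) / (3 - 5 * D.μ * η (k + 1))) • anchor k ω
  g_eq : ∀ k ω,
    g (k + 1) ω = (1 / (D.q (idx (k + 1) ω) * n)) •
        ((gradient (D.f (idx (k + 1) ω)) (y k ω) + ζ (k + 1) ω)
          - (gradient (D.f (idx (k + 1) ω)) (anchor k ω) + ζ' (k + 1) ω))
      + zbar k ω
  x_succ : ∀ k ω, IsProx (η (k + 1)) D.ψ (y k ω - η (k + 1) • g (k + 1) ω) (x (k + 1) ω)
  v_succ : ∀ k ω,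
    v (k + 1) ω = (1 - D.μ * δ (k + 1) / γ (k + 1)) • v k ω
      + (D.μ * δ (k + 1) / γ (k + 1)) • y k ω
      + (δ (k + 1) / (γ (k + 1) * η (k + 1))) • (x (k + 1) ω - y k ω)
  anchor_succ : ∀ k ω, anchor (k + 1) ω = if refresh (k + 1) ω then x (k + 1) ω else anchor k ω
  zbar_succ : ∀ k ω,
    zbar (k + 1) ω = if refresh (k + 1) ω then
        (1 / (n : ℝ)) • ∑ i, (gradient (D.f i) (anchor (k + 1) ω) + ξ (k + 1) i ω)
      else zbar k ω
  -- the information structure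
  mIdx : ℕ → MeasurableSpace Ω
  mNoise : ℕ → MeasurableSpace Ω
  mCoin : ℕ → MeasurableSpace Ω
  mAll : ℕ → MeasurableSpace Ω
  mAll_le_mIdx : ∀ k, mAll k ≤ mIdx (k + 1)
  mIdx_le_mNoise : ∀ k, mIdx (k + 1) ≤ mNoise (k + 1)
  mNoise_le_mCoin : ∀ k, mNoise (k + 1) ≤ mCoin (k + 1)
  mCoin_le_mAll : ∀ k, mCoin k ≤ mAll k
  mAll_le : ∀ k, mAll k ≤ mΩ
  -- the initial point is known at the start
  x₀_meas : Measurable[mCoin 0] x₀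
  -- the index has law `q` given the past
  idx_meas : ∀ k, Measurable[mIdx (k + 1)] (idx (k + 1))
  idx_indep : ∀ k, Indep (MeasurableSpace.comap (idx (k + 1)) ⊤) (mAll k) P
  idx_law : ∀ k i, P {ω | idx (k + 1) ω = i} = ENNReal.ofReal (D.q i)
  -- perturbations of the two gradients of `f_{idx (k + 1)}`: centered, variance at most `σ ^ 2`
  ζ_meas : ∀ k, Measurable[mNoise (k + 1)] (ζ (k + 1))
  ζ_memLp : ∀ k, MemLp (ζ (k + 1)) 2 P
  ζ_mean : ∀ k, P[ζ (k + 1) | mIdx (k + 1)] =ᵐ[P] 0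
  ζ_var : ∀ k, P[fun ω => ‖ζ (k + 1) ω‖ ^ 2 | mIdx (k + 1)] ≤ᵐ[P] fun _ => D.σ ^ 2
  ζ'_meas : ∀ k, Measurable[mNoise (k + 1)] (ζ' (k + 1))
  ζ'_memLp : ∀ k, MemLp (ζ' (k + 1)) 2 P
  ζ'_mean : ∀ k, P[ζ' (k + 1) | mIdx (k + 1)] =ᵐ[P] 0
  ζ'_var : ∀ k, P[fun ω => ‖ζ' (k + 1) ω‖ ^ 2 | mIdx (k + 1)] ≤ᵐ[P] fun _ => D.σ ^ 2
  -- the anchor is updated with probability `1 / n`, independently of the past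
  refresh_meas : ∀ k, Measurable[mCoin (k + 1)] (refresh (k + 1))
  refresh_indep : ∀ k, Indep (MeasurableSpace.comap (refresh (k + 1)) ⊤) (mNoise (k + 1)) P
  refresh_law : ∀ k, P {ω | refresh (k + 1) ω = true} = ENNReal.ofReal (1 / (n : ℝ))
  -- perturbations at the anchor: centered, variance at most `σ ^ 2`, uncorrelated across indices
  ξ_meas : ∀ k i, Measurable[mAll k] (ξ k i)
  ξ_memLp : ∀ k i, MemLp (ξ k i) 2 P
  ξ_mean : ∀ k i, P[ξ k i | mCoin k] =ᵐ[P] 0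
  ξ_var : ∀ k i, P[fun ω => ‖ξ k i ω‖ ^ 2 | mCoin k] ≤ᵐ[P] fun _ => D.σ ^ 2
  ξ_uncorr : ∀ k i j, i ≠ j → P[fun ω => inner ℝ (ξ k i ω) (ξ k j ω) | mCoin k] =ᵐ[P] 0

namespace Run

variable {n p : ℕ} {D : Problem n p} {Ω : Type*} [MeasurableSpace Ω] {P : Measure Ω}
  {η : ℕ → ℝ} {γ₀ : ℝ} {x₀ : Ω → Vec p}

/-- The number of (perturbed) gradients of the functions `f i` evaluated during the
initialization and the first `K` iterations: `n` at the start, two in each iteration, and `n`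
more whenever the anchor is updated. -/
def evals (R : Run D P η γ₀ x₀) (K : ℕ) (ω : Ω) : ℕ :=
  n + ∑ k ∈ Finset.range K, (2 + if R.refresh (k + 1) ω then n else 0)

/-- The two natural outputs of the method after `k` iterations: the last iterate `x_k`, or the
anchor point. -/
def output (R : Run D P η γ₀ x₀) (useAnchor : Bool) (k : ℕ) (ω : Ω) : Vec p :=
  if useAnchor then R.anchor k ω else R.x k ω

/-- The expected optimality gap `E[F(·) - F⋆]` of the output after `k` iterations. -/
def expGap (R : Run D P η γ₀ x₀) (useAnchor : Bool) (k : ℕ) : ℝ≥0∞ :=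
  ∫⁻ ω, D.gap (R.output useAnchor k ω) ∂P

end Run

end AccSVRG

end

/-!
With `γ₀ = μ` the parameter `γ` stays equal to `μ`, and the method contracts the potential
`T_k = E[F(a_k) - F⋆] + (μ / 2) E‖v_k - x⋆‖²`, where `a_k` is the anchor and `x⋆` the minimizer.
The gradient estimator exceeds `∇f(y_k)` by three perturbations: the sampling error, whose variance
is paid for by the Bregman distance between `a_k` and `y_k` (`Good.integral_sq_sampleNoise_le`); the
fresh perturbations of the two sampled gradients; and the perturbation of the stored full gradient
at the anchor. The first two are centered given the past. The third one is not: it was drawn at the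
last update of the anchor, and all iterates since then depend on it.

This dependence is controlled by a coupling. The *shadow* of `v` is reset to `v` at each update of
the anchor, and otherwise performs the same step with the same sampled component, but without
perturbations. It carries no information on the perturbation at the anchor, which is therefore
uncorrelated with every Lipschitz function of the shadow and the anchor
(`Good.integral_inner_anchorNoise`). The run stays close to its shadow: the update of `v` amounts to
an over-relaxation, by a factor at most `5 / 3`, of a proximal gradient step, and by firm
nonexpansiveness of the proximal operator and cocoercivity of the gradients such a step is
nonexpansive up to the perturbation (`relaxed_step_le`); the factor `1 - 1 / n` gained from the
resets absorbs the loss in Young's inequality for the persistent perturbation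
(`Good.shadowErr_le`). Replacing the run by its shadow in the inner product with that perturbation
costs an error of the order of the other variance terms, and the result is the recursion
`T_{k+1} ≤ (1 - δ_{k+1}) T_k + A δ_{k+1}² ρ_Q σ² / μ` (`Good.potential_contracts`).

With constant steps the recursion decays geometrically at rate `δ` down to a multiple of `B`; with
the decreasing steps `δ_k = min δ (2 / (k + 2))`, and `T_k` stays below a multiple of
`δ_k ρ_Q σ² / μ`. This bounds the gap at the anchor. The gap at the last iterate is recovered by
averaging: the mean gap at the anchor moves to the mean gap at `x_k` with weight `1 / n` in each
step, so that among `n` consecutive iterates one is nearly as good as the anchor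
(`exists_le_of_averaging`). An iteration costs three gradient evaluations in the mean
(`hasMean_evals`), and `ε ≤ c B` makes `n` and `1 / δ` at most a multiple of `ρ_Q σ² / (μ ε)`, which
absorbs the additive constants.
-/

noncomputable section

namespace AccSVRG

/-! ### Smooth convex functions -/

section Smooth

variable {E : Type*} [NormedAddCommGroup E] [InnerProductSpace ℝ E] [CompleteSpace E]

theorem hasDerivAt_comp_line {f : E → ℝ} (hd : Differentiable ℝ f) (x d : E) (t : ℝ) :
    HasDerivAt (fun t : ℝ => f (x + t • d)) (inner ℝ (gradient f (x + t • d)) d) t := by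
  have h1 : HasDerivAt (fun t : ℝ => x + t • d) d t := by
    simpa using ((hasDerivAt_id t).smul_const d).const_add x
  have h2 := (hd (x + t • d)).hasFDerivAt.comp_hasDerivAt t h1
  rw [inner_gradient_left]
  exact h2

/-- A differentiable convex function lies above its tangent planes. -/
theorem add_inner_gradient_le {f : E → ℝ} (hf : ConvexOn ℝ Set.univ f) (hd : Differentiable ℝ f)
    (x y : E) : f x + inner ℝ (gradient f x) (y - x) ≤ f y := by
  have hc : ConvexOn ℝ Set.univ (fun t : ℝ => f (x + t • (y - x))) := by
    have := hf.comp_affineMap (AffineMap.lineMap x y : ℝ →ᵃ[ℝ] E)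
    refine ⟨convex_univ, fun a _ b _ s t hs ht hst => ?_⟩
    have h := this.2 (Set.mem_univ a) (Set.mem_univ b) hs ht hst
    simpa [AffineMap.lineMap_apply, add_comm] using h
  have h := hc.le_slope_of_hasDerivAt (Set.mem_univ 0) (Set.mem_univ 1) one_pos
    (hasDerivAt_comp_line hd x (y - x) 0)
  simp only [slope, sub_zero, inv_one, one_smul, zero_smul, add_zero, vsub_eq_sub, smul_eq_mul,
    one_mul, add_sub_cancel] at h
  linarith

/-- The quadratic upper bound for a function with Lipschitz gradient. -/
theorem le_add_inner_gradient_add {f : E → ℝ} (hd : Differentiable ℝ f) {L : ℝ}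
    (hL : ∀ x y, ‖gradient f x - gradient f y‖ ≤ L * ‖x - y‖) (x y : E) :
    f y ≤ f x + inner ℝ (gradient f x) (y - x) + L / 2 * ‖y - x‖ ^ 2 := by
  set d := y - x with hdd
  let g : ℝ → ℝ := fun t => f (x + t • d) - t * inner ℝ (gradient f x) d - L / 2 * t ^ 2 * ‖d‖ ^ 2
  have hg : ∀ t, HasDerivAt g (inner ℝ (gradient f (x + t • d)) d - inner ℝ (gradient f x) d
      - L * t * ‖d‖ ^ 2) t := by
    intro t
    have h2 : HasDerivAt (fun t : ℝ => t * inner ℝ (gradient f x) d)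
        (inner ℝ (gradient f x) d) t := by
      simpa using (hasDerivAt_id t).mul_const (inner ℝ (gradient f x) d)
    have h3 : HasDerivAt (fun t : ℝ => L / 2 * t ^ 2 * ‖d‖ ^ 2) (L * t * ‖d‖ ^ 2) t := by
      have := (((hasDerivAt_id t).pow 2).const_mul (L / 2)).mul_const (‖d‖ ^ 2)
      refine this.congr_deriv ?_
      simp only [id_eq, Nat.cast_ofNat, Nat.add_one_sub_one, pow_one, mul_one]
      ring
    exact ((hasDerivAt_comp_line hd x d t).sub h2).sub h3
  have hanti : AntitoneOn g (Set.Icc 0 1) := by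
    refine antitoneOn_of_deriv_nonpos (convex_Icc 0 1)
      (fun t _ => (hg t).continuousAt.continuousWithinAt)
      (fun t _ => (hg t).differentiableAt.differentiableWithinAt) ?_
    intro t ht
    rw [interior_Icc] at ht
    rw [(hg t).deriv, ← inner_sub_left]
    have h1 := real_inner_le_norm (gradient f (x + t • d) - gradient f x) d
    have h2 := hL (x + t • d) x
    rw [add_sub_cancel_left, norm_smul, Real.norm_eq_abs, abs_of_pos ht.1] at h2
    have h3 := mul_le_mul_of_nonneg_right h2 (norm_nonneg d)
    nlinarith
  have h := hanti (Set.left_mem_Icc.2 zero_le_one) (Set.right_mem_Icc.2 zero_le_one) zero_le_one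
  have hxy : x + d = y := by simp [hdd]
  simp only [g, one_smul, zero_smul, add_zero, hxy] at h
  linarith

/-- The Bregman distance of a convex function with `L`-Lipschitz gradient dominates the squared
distance of the gradients. -/
theorem sq_norm_gradient_sub_le {f : E → ℝ} (hf : ConvexOn ℝ Set.univ f)
    (hd : Differentiable ℝ f) {L : ℝ} (hL0 : 0 < L)
    (hL : ∀ x y, ‖gradient f x - gradient f y‖ ≤ L * ‖x - y‖) (y z : E) :
    ‖gradient f z - gradient f y‖ ^ 2
      ≤ 2 * L * (f z - f y - inner ℝ (gradient f y) (z - y)) := by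
  -- the tangent plane at `y` is compared with the quadratic upper bound at `z`
  -- after a gradient step from `z`
  set q := gradient f z - gradient f y with hq
  have h1 := add_inner_gradient_le hf hd y (z - L⁻¹ • q)
  have h2 := le_add_inner_gradient_add hd hL z (z - L⁻¹ • q)
  have e1 : z - L⁻¹ • q - z = -(L⁻¹ • q) := by abel
  have e2 : z - L⁻¹ • q - y = (z - y) - L⁻¹ • q := by abel
  rw [e1, norm_neg, norm_smul, inner_neg_right, inner_smul_right, Real.norm_eq_abs,
    abs_of_pos (inv_pos.2 hL0), mul_pow] at h2
  rw [e2, inner_sub_right, inner_smul_right] at h1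
  have h3 : inner ℝ (gradient f z) q - inner ℝ (gradient f y) q = ‖q‖ ^ 2 := by
    rw [← inner_sub_left, ← hq, real_inner_self_eq_norm_sq]
  have h4 : L / 2 * (L⁻¹ ^ 2 * ‖q‖ ^ 2) = L⁻¹ * ‖q‖ ^ 2 / 2 := by field_simp
  have h5 : L⁻¹ * inner ℝ (gradient f z) q - L⁻¹ * inner ℝ (gradient f y) q = L⁻¹ * ‖q‖ ^ 2 := by
    rw [← mul_sub, h3]
  have h6 : L⁻¹ * ‖q‖ ^ 2 / 2 ≤ f z - f y - inner ℝ (gradient f y) (z - y) := by linarith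
  calc ‖q‖ ^ 2 = 2 * L * (L⁻¹ * ‖q‖ ^ 2 / 2) := by field_simp
    _ ≤ _ := mul_le_mul_of_nonneg_left h6 (by positivity)

/-- The gradient of a convex function with `L`-Lipschitz gradient is `1 / L`-cocoercive. -/
theorem sq_norm_gradient_sub_le_inner {f : E → ℝ} (hf : ConvexOn ℝ Set.univ f)
    (hd : Differentiable ℝ f) {L : ℝ} (hL0 : 0 < L)
    (hL : ∀ x y, ‖gradient f x - gradient f y‖ ≤ L * ‖x - y‖) (y z : E) :
    ‖gradient f z - gradient f y‖ ^ 2 ≤ L * inner ℝ (z - y) (gradient f z - gradient f y) := by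
  have h1 := sq_norm_gradient_sub_le hf hd hL0 hL y z
  have h2 := sq_norm_gradient_sub_le hf hd hL0 hL z y
  rw [norm_sub_rev, ← neg_sub z y, inner_neg_right] at h2
  rw [inner_sub_right, real_inner_comm, real_inner_comm (gradient f y)]
  nlinarith

/-- A differentiable strongly convex function lies above the quadratics tangent to it. -/
theorem add_inner_gradient_add_le {f : E → ℝ} {m : ℝ} (hf : StrongConvexOn Set.univ m f)
    (hd : Differentiable ℝ f) (x y : E) :
    f x + inner ℝ (gradient f x) (y - x) + m / 2 * ‖y - x‖ ^ 2 ≤ f y := by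
  have hc := strongConvexOn_iff_convex.1 hf
  have hq : ∀ x : E, HasGradientAt (fun x => f x - m / 2 * ‖x‖ ^ 2) (gradient f x - m • x) x := by
    intro x
    have h1 := (hd x).hasGradientAt.hasFDerivAt
    have h2 := ((hasStrictFDerivAt_norm_sq x).hasFDerivAt.const_mul (m / 2))
    rw [hasGradientAt_iff_hasFDerivAt]
    refine (h1.sub h2).congr_fderiv ?_
    ext v
    simp
    ring
  have hgr := (hq x).gradient
  have h := add_inner_gradient_le hc (fun x => (hq x).differentiableAt) x y
  rw [hgr, inner_sub_left, inner_smul_left] at h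
  have e : ‖y - x‖ ^ 2 = ‖y‖ ^ 2 - ‖x‖ ^ 2 - 2 * inner ℝ x (y - x) := by
    rw [norm_sub_sq_real, inner_sub_right, real_inner_self_eq_norm_sq, real_inner_comm]
    ring
  rw [e]
  simp only [conj_trivial] at h
  linarith

end Smooth

/-! ### Proximal points and minimizers -/

/-- The regularizer has an affine minorant and is finite somewhere. This makes proximal points and
minimizers exist. -/
structure Problem.Proper {n p : ℕ} (D : Problem n p) : Prop where
  minorant : ∃ (w : Vec p) (b : ℝ), ∀ z, ((inner ℝ w z + b : ℝ) : EReal) ≤ D.ψ z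
  dom_nonempty : ∃ z, D.ψ z ≠ ⊤

namespace Problem

variable {n p : ℕ} {D : Problem n p}

theorem Admissible.coe_toReal (hD : D.Admissible) {z : Vec p} (hz : D.ψ z ≠ ⊤) :
    (((D.ψ z).toReal : ℝ) : EReal) = D.ψ z :=
  EReal.coe_toReal hz (hD.psi_ne_bot z)

/-- Convexity of the regularizer, in terms of its real values on its domain. -/
theorem Admissible.psi_combo (hD : D.Admissible) {x z : Vec p} (hx : D.ψ x ≠ ⊤) (hz : D.ψ z ≠ ⊤)
    {t : ℝ} (ht0 : 0 ≤ t) (ht1 : t ≤ 1) :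
    D.ψ (x + t • (z - x)) ≠ ⊤ ∧
      (D.ψ (x + t • (z - x))).toReal ≤ (1 - t) * (D.ψ x).toReal + t * (D.ψ z).toReal := by
  have h := hD.psi_convex (x := (x, (D.ψ x).toReal)) (y := (z, (D.ψ z).toReal))
    (by simp [hD.coe_toReal hx]) (by simp [hD.coe_toReal hz])
    (sub_nonneg.2 ht1) ht0 (by ring)
  have e : (1 - t) • x + t • z = x + t • (z - x) := by
    rw [sub_smul, one_smul, smul_sub]; abel
  simp only [Prod.smul_mk, Prod.mk_add_mk, Set.mem_ofPred_eq, e, smul_eq_mul] at h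
  have hne : D.ψ (x + t • (z - x)) ≠ ⊤ := ne_top_of_le_ne_top (EReal.coe_ne_top _) h
  refine ⟨hne, ?_⟩
  rw [← hD.coe_toReal hne] at h
  exact_mod_cast h

/-- The sum of the regularizer and a continuous function of quadratic growth has a minimizer. -/
theorem Admissible.exists_minimizer (hD : D.Admissible) (hP : D.Proper) {φ : Vec p → ℝ}
    (hφ : Continuous φ) {a b : ℝ} (u : Vec p) (ha : 0 < a)
    (hb : ∀ z, a * ‖z - u‖ ^ 2 - b ≤ φ z) :
    ∃ x, D.ψ x ≠ ⊤ ∧ ∀ z, (φ x : EReal) + D.ψ x ≤ (φ z : EReal) + D.ψ z := by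
  obtain ⟨w, b', hw⟩ := hP.minorant
  obtain ⟨z₀, hz₀⟩ := hP.dom_nonempty
  set r : ℝ := φ z₀ + (D.ψ z₀).toReal with hr
  have hr' : ((r : ℝ) : EReal) = (φ z₀ : EReal) + D.ψ z₀ := by
    rw [hr, EReal.coe_add, hD.coe_toReal hz₀]
  have hlsc : LowerSemicontinuous fun z => (φ z : EReal) + D.ψ z := by
    refine LowerSemicontinuous.add' (continuous_coe_real_ereal.comp hφ).lowerSemicontinuous
      hD.psi_lsc fun x => ?_
    exact EReal.continuousAt_add (Or.inl (EReal.coe_ne_top _)) (Or.inl (EReal.coe_ne_bot _))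
  -- outside a large ball the objective exceeds its value at `z₀`
  set c : ℝ := inner ℝ w u + b' - b - ‖w‖ ^ 2 / (2 * a) with hc
  have hgrow : ∀ z, ((a / 2 * ‖z - u‖ ^ 2 + c : ℝ) : EReal) ≤ (φ z : EReal) + D.ψ z := by
    intro z
    refine le_trans ?_ (add_le_add (EReal.coe_le_coe_iff.2 (hb z)) (hw z))
    rw [← EReal.coe_add, EReal.coe_le_coe_iff, hc]
    have h1 : inner ℝ w z = inner ℝ w u + inner ℝ w (z - u) := by rw [inner_sub_right]; ring
    have h2 : -(‖w‖ * ‖z - u‖) ≤ inner ℝ w (z - u) := neg_le_of_abs_le (abs_real_inner_le_norm _ _)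
    have h3 : ‖w‖ * ‖z - u‖ ≤ a / 2 * ‖z - u‖ ^ 2 + ‖w‖ ^ 2 / (2 * a) := by
      have : a / 2 * ‖z - u‖ ^ 2 + ‖w‖ ^ 2 / (2 * a) - ‖w‖ * ‖z - u‖
          = (a * ‖z - u‖ - ‖w‖) ^ 2 / (2 * a) := by field_simp; ring
      have h4 : 0 ≤ (a * ‖z - u‖ - ‖w‖) ^ 2 / (2 * a) := by positivity
      linarith
    rw [h1]; linarith
  set R : ℝ := max ‖z₀ - u‖ (Real.sqrt (|r - c| / (a / 2))) with hR
  have hmem : z₀ ∈ Metric.closedBall u R := by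
    rw [mem_closedBall_iff_norm]; exact le_max_left _ _
  obtain ⟨x, -, hx⟩ := LowerSemicontinuousOn.exists_isMinOn ⟨z₀, hmem⟩
    (isCompact_closedBall u R) (hlsc.lowerSemicontinuousOn _)
  have hx0 := isMinOn_iff.1 hx z₀ hmem
  refine ⟨x, ?_, fun z => ?_⟩
  · intro htop
    rw [htop, EReal.coe_add_top, ← hr', top_le_iff] at hx0
    exact EReal.coe_ne_top _ hx0
  · by_cases hz : z ∈ Metric.closedBall u R
    · exact isMinOn_iff.1 hx z hz
    · rw [mem_closedBall_iff_norm, not_le] at hz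
      refine hx0.trans ((hr'.symm.le.trans (EReal.coe_le_coe_iff.2 ?_)).trans (hgrow z))
      have h1 : Real.sqrt (|r - c| / (a / 2)) ≤ ‖z - u‖ := (le_max_right _ _).trans hz.le
      rw [Real.sqrt_le_left (norm_nonneg _), div_le_iff₀ (by positivity)] at h1
      linarith [le_abs_self (r - c)]

/-- The definition of a proximal point, in terms of the real values of the regularizer on its
domain. -/
theorem Admissible.isProx_iff (hD : D.Admissible) {η : ℝ} (hη : 0 < η) {u x : Vec p}
    (hx : D.ψ x ≠ ⊤) :
    IsProx η D.ψ u x ↔ ∀ z, D.ψ z ≠ ⊤ →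
      η * (D.ψ x).toReal + ‖x - u‖ ^ 2 / 2 ≤ η * (D.ψ z).toReal + ‖z - u‖ ^ 2 / 2 := by
  constructor
  · intro h z hz
    have := h z
    rw [← hD.coe_toReal hx, ← hD.coe_toReal hz] at this
    exact_mod_cast this
  · intro h z
    by_cases hz : D.ψ z = ⊤
    · rw [hz, EReal.coe_mul_top_of_pos hη, EReal.top_add_coe]
      exact le_top
    · have := h z hz
      rw [← hD.coe_toReal hx, ← hD.coe_toReal hz]
      exact_mod_cast this

/-- A proximal point lies in the domain of the regularizer, unless that domain is empty. -/
theorem Admissible.psi_ne_top_of_isProx (hD : D.Admissible) {η : ℝ} (hη : 0 < η) {u x z : Vec p}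
    (h : IsProx η D.ψ u x) (hz : D.ψ z ≠ ⊤) : D.ψ x ≠ ⊤ := by
  intro hx
  have := h z
  rw [hx, EReal.coe_mul_top_of_pos hη, EReal.top_add_coe, ← hD.coe_toReal hz, ← EReal.coe_mul,
    ← EReal.coe_add, top_le_iff] at this
  exact EReal.coe_ne_top _ this

/-- The variational inequality for a proximal point. -/
theorem Admissible.inner_le_of_isProx (hD : D.Admissible) {η : ℝ} (hη : 0 < η) {u x z : Vec p}
    (h : IsProx η D.ψ u x) (hz : D.ψ z ≠ ⊤) :
    inner ℝ (u - x) (z - x) ≤ η * ((D.ψ z).toReal - (D.ψ x).toReal) := by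
  have hx := hD.psi_ne_top_of_isProx hη h hz
  rw [hD.isProx_iff hη hx] at h
  -- the optimality of `x` against the points `x + t (z - x)` with small `t`
  have key : ∀ t : ℝ, 0 < t → t ≤ 1 → inner ℝ (u - x) (z - x)
      ≤ η * ((D.ψ z).toReal - (D.ψ x).toReal) + t * (‖z - x‖ ^ 2 / 2) := by
    intro t ht ht1
    obtain ⟨h1, h2⟩ := hD.psi_combo hx hz ht.le ht1
    have h3 := h _ h1
    have e : x + t • (z - x) - u = (x - u) + t • (z - x) := by abel
    have e2 : inner ℝ (u - x) (z - x) = -inner ℝ (x - u) (z - x) := by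
      rw [← inner_neg_left, neg_sub]
    rw [e, norm_add_sq_real, inner_smul_right, norm_smul, Real.norm_eq_abs, abs_of_pos ht] at h3
    have h4 := mul_le_mul_of_nonneg_left h2 hη.le
    rw [e2]
    have h5 : 0 ≤ t * (η * ((D.ψ z).toReal - (D.ψ x).toReal) + t * (‖z - x‖ ^ 2 / 2)
        + inner ℝ (x - u) (z - x)) := by nlinarith
    have h6 := nonneg_of_mul_nonneg_right h5 ht
    linarith
  have hlim : Filter.Tendsto (fun t : ℝ => η * ((D.ψ z).toReal - (D.ψ x).toReal)
      + t * (‖z - x‖ ^ 2 / 2)) (nhdsWithin 0 (Set.Ioi 0))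
      (nhds (η * ((D.ψ z).toReal - (D.ψ x).toReal))) := by
    have : Continuous fun t : ℝ => η * ((D.ψ z).toReal - (D.ψ x).toReal)
      + t * (‖z - x‖ ^ 2 / 2) := by fun_prop
    have h := (this.tendsto 0).mono_left (nhdsWithin_le_nhds (s := Set.Ioi 0))
    simpa using h
  refine ge_of_tendsto hlim ?_
  filter_upwards [Ioc_mem_nhdsGT (zero_lt_one (α := ℝ))] with t ht
  exact key t ht.1 ht.2

/-- Firm nonexpansiveness of the proximal operator. -/
theorem Admissible.firmly_nonexpansive (hD : D.Admissible) (hP : D.Proper) {η : ℝ} (hη : 0 < η)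
    {u u' x x' : Vec p} (h : IsProx η D.ψ u x) (h' : IsProx η D.ψ u' x') :
    ‖x - x'‖ ^ 2 ≤ inner ℝ (x - x') (u - u') := by
  obtain ⟨z₀, hz₀⟩ := hP.dom_nonempty
  have h1 := hD.inner_le_of_isProx hη h (hD.psi_ne_top_of_isProx hη h' hz₀)
  have h2 := hD.inner_le_of_isProx hη h' (hD.psi_ne_top_of_isProx hη h hz₀)
  have e : ‖x - x'‖ ^ 2 - inner ℝ (x - x') (u - u')
      = inner ℝ (u - x) (x' - x) + inner ℝ (u' - x') (x - x') := by
    rw [← real_inner_self_eq_norm_sq]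
    simp only [inner_sub_left, inner_sub_right]
    rw [real_inner_comm u x, real_inner_comm u' x, real_inner_comm u x', real_inner_comm u' x']
    ring
  linarith

theorem Admissible.norm_sub_le_of_isProx (hD : D.Admissible) (hP : D.Proper) {η : ℝ} (hη : 0 < η)
    {u u' x x' : Vec p} (h : IsProx η D.ψ u x) (h' : IsProx η D.ψ u' x') :
    ‖x - x'‖ ≤ ‖u - u'‖ := by
  have h1 := hD.firmly_nonexpansive hP hη h h'
  have h2 := real_inner_le_norm (x - x') (u - u')
  by_contra hlt
  push Not at hlt
  have h3 : 0 < ‖x - x'‖ := (norm_nonneg _).trans_lt hlt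
  nlinarith

theorem Admissible.exists_isProx (hD : D.Admissible) (hP : D.Proper) {η : ℝ} (hη : 0 < η)
    (u : Vec p) : ∃ x, IsProx η D.ψ u x := by
  obtain ⟨x, hx, hmin⟩ := hD.exists_minimizer hP (φ := fun z => 1 / (2 * η) * ‖z - u‖ ^ 2)
    (by fun_prop) (a := 1 / (2 * η)) (b := 0) u (by positivity) (fun z => by simp)
  refine ⟨x, (hD.isProx_iff hη hx).2 fun z hz => ?_⟩
  have h := hmin z
  rw [← hD.coe_toReal hx, ← hD.coe_toReal hz] at h
  have h' : 1 / (2 * η) * ‖x - u‖ ^ 2 + (D.ψ x).toReal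
      ≤ 1 / (2 * η) * ‖z - u‖ ^ 2 + (D.ψ z).toReal := by exact_mod_cast h
  have h2 := mul_le_mul_of_nonneg_left h' hη.le
  have e : ∀ s : ℝ, η * (1 / (2 * η) * s) = s / 2 := fun s => by field_simp
  rw [mul_add, mul_add, e, e] at h2
  linarith

/-- The proximal operator `Prox_{ηψ}` as a function. Its value is arbitrary where no proximal point
exists, which does not happen for `η > 0` under `Admissible` and `Proper`. -/
def prox (D : Problem n p) (η : ℝ) (u : Vec p) : Vec p := Classical.epsilon (IsProx η D.ψ u)

theorem Admissible.isProx_prox (hD : D.Admissible) (hP : D.Proper) {η : ℝ} (hη : 0 < η)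
    (u : Vec p) : IsProx η D.ψ u (D.prox η u) :=
  Classical.epsilon_spec (hD.exists_isProx hP hη u)

theorem Admissible.eq_prox (hD : D.Admissible) (hP : D.Proper) {η : ℝ} (hη : 0 < η)
    {u x : Vec p} (h : IsProx η D.ψ u x) : x = D.prox η u := by
  have := hD.norm_sub_le_of_isProx hP hη h (hD.isProx_prox hP hη u)
  rw [sub_self, norm_zero] at this
  exact sub_eq_zero.1 (norm_le_zero_iff.1 this)

theorem Admissible.lipschitzWith_prox (hD : D.Admissible) (hP : D.Proper) {η : ℝ} (hη : 0 < η) :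
    LipschitzWith 1 (D.prox η) := by
  refine LipschitzWith.of_dist_le_mul fun u u' => ?_
  rw [dist_eq_norm, dist_eq_norm, NNReal.coe_one, one_mul]
  exact hD.norm_sub_le_of_isProx hP hη (hD.isProx_prox hP hη u) (hD.isProx_prox hP hη u')

/-- A single proximal point yields, through its variational inequality, an affine minorant of the
regularizer. -/
theorem Admissible.proper_of_isProx (hD : D.Admissible) {η : ℝ} (hη : 0 < η) {u x z : Vec p}
    (h : IsProx η D.ψ u x) (hz : D.ψ z ≠ ⊤) : D.Proper := by
  refine ⟨⟨η⁻¹ • (u - x), (D.ψ x).toReal - η⁻¹ * inner ℝ (u - x) x, fun y => ?_⟩, z, hz⟩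
  by_cases hy : D.ψ y = ⊤
  · rw [hy]; exact le_top
  · rw [← hD.coe_toReal hy, EReal.coe_le_coe_iff, inner_smul_left]
    have h1 := mul_le_mul_of_nonneg_left (hD.inner_le_of_isProx hη h hy) (inv_pos.2 hη).le
    rw [inv_mul_cancel_left₀ hη.ne', inner_sub_right] at h1
    simp only [conj_trivial]
    linarith

/-! ### The smooth part and the constants of the problem -/

/-- The gradient of the smooth part. -/
def gradAvg (D : Problem n p) (x : Vec p) : Vec p :=
  (1 / (n : ℝ)) • ∑ i, gradient (D.f i) x

/-- The Bregman distance of the smooth part. -/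
def breg (D : Problem n p) (z y : Vec p) : ℝ :=
  D.avg z - D.avg y - inner ℝ (D.gradAvg y) (z - y)

/-- The importance-weighted gradient of the `i`-th component. -/
def wgrad (D : Problem n p) (i : Fin n) (x : Vec p) : Vec p :=
  (1 / (D.q i * n)) • gradient (D.f i) x

theorem Admissible.n_pos (hD : D.Admissible) : 0 < n := by
  rcases Nat.eq_zero_or_pos n with h | h
  · subst h
    simpa using hD.q_sum
  · exact h

theorem Admissible.cast_pos (hD : D.Admissible) : (0 : ℝ) < n := Nat.cast_pos.2 hD.n_pos

theorem Admissible.one_le_cast (hD : D.Admissible) : (1 : ℝ) ≤ n := Nat.one_le_cast.2 hD.n_pos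

theorem Admissible.L_pos (hD : D.Admissible) (i : Fin n) : 0 < D.L i :=
  hD.mu_pos.trans_le (hD.mu_le i)

theorem div_le_LQ (D : Problem n p) (i : Fin n) : D.L i / (D.q i * n) ≤ D.LQ :=
  le_ciSup (f := fun i => D.L i / (D.q i * n)) (Set.finite_range _).bddAbove i

theorem Admissible.LQ_pos (hD : D.Admissible) : 0 < D.LQ :=
  lt_of_lt_of_le (div_pos (hD.L_pos ⟨0, hD.n_pos⟩) (mul_pos (hD.q_pos _) hD.cast_pos))
    (D.div_le_LQ ⟨0, hD.n_pos⟩)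

theorem Admissible.L_le (hD : D.Admissible) (i : Fin n) : D.L i ≤ D.LQ * (D.q i * n) :=
  (div_le_iff₀ (mul_pos (hD.q_pos i) hD.cast_pos)).1 (D.div_le_LQ i)

theorem Admissible.inv_q_le_rhoQ (hD : D.Admissible) (i : Fin n) :
    1 / (D.q i * n) ≤ D.rhoQ := by
  have : Nonempty (Fin n) := ⟨i⟩
  obtain ⟨j, hj⟩ := exists_eq_ciInf_of_finite (f := D.q)
  have hpos : 0 < ⨅ i, D.q i := hj ▸ hD.q_pos j
  have hle : (⨅ i, D.q i) ≤ D.q i := ciInf_le (Set.finite_range _).bddBelow i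
  have hn := hD.cast_pos
  unfold rhoQ
  rw [mul_comm (D.q i)]
  exact one_div_le_one_div_of_le (mul_pos hn hpos) (mul_le_mul_of_nonneg_left hle hn.le)

theorem Admissible.one_le_rhoQ (hD : D.Admissible) : 1 ≤ D.rhoQ := by
  have hn := hD.cast_pos
  have : ∑ i, (1 / (n : ℝ)) ≤ ∑ i, D.rhoQ * D.q i := Finset.sum_le_sum fun i _ => by
    have h := mul_le_mul_of_nonneg_right (hD.inv_q_le_rhoQ i) (hD.q_pos i).le
    have hq := (hD.q_pos i).ne'
    have e : 1 / (D.q i * n) * D.q i = 1 / (n : ℝ) := by field_simp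
    linarith
  rw [← Finset.mul_sum, hD.q_sum, Finset.sum_const, Finset.card_univ, Fintype.card_fin,
    nsmul_eq_mul, mul_one_div_cancel hn.ne', mul_one] at this
  exact this

theorem Admissible.eta_pos (hD : D.Admissible) : 0 < D.eta := by
  have h1 := hD.LQ_pos
  have h2 := hD.mu_pos
  have h3 := hD.cast_pos
  exact lt_min (by positivity) (by positivity)

theorem Admissible.mul_LQ_le (hD : D.Admissible) {η : ℝ} (h : η ≤ D.eta) :
    η * D.LQ ≤ 1 / 3 := by
  have h1 := hD.LQ_pos
  have := h.trans (min_le_left _ _)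
  rw [le_div_iff₀ (by positivity)] at this
  linarith

theorem Admissible.mul_mu_le (hD : D.Admissible) {η : ℝ} (h : η ≤ D.eta) :
    η * D.μ * n ≤ 1 / 15 := by
  have h1 := hD.mu_pos
  have h2 := hD.cast_pos
  have := h.trans (min_le_right _ _)
  rw [le_div_iff₀ (by positivity)] at this
  linarith

theorem Admissible.hasGradientAt_avg (hD : D.Admissible) (x : Vec p) :
    HasGradientAt D.avg (D.gradAvg x) x := by
  rw [hasGradientAt_iff_hasFDerivAt]
  have h : HasFDerivAt (fun x => (1 / (n : ℝ)) * ∑ i, D.f i x)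
      ((1 / (n : ℝ)) • ∑ i, fderiv ℝ (D.f i) x) x :=
    (HasFDerivAt.fun_sum fun i _ => (hD.differentiable i x).hasFDerivAt).const_mul _
  refine h.congr_fderiv ?_
  simp only [gradAvg, map_smul, map_sum, toDual_gradient]

theorem Admissible.differentiable_avg (hD : D.Admissible) : Differentiable ℝ D.avg :=
  fun x => (hD.hasGradientAt_avg x).differentiableAt

theorem Admissible.gradient_avg (hD : D.Admissible) (x : Vec p) :
    gradient D.avg x = D.gradAvg x := (hD.hasGradientAt_avg x).gradient

theorem Admissible.mu_sq_le_breg (hD : D.Admissible) (y z : Vec p) :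
    D.μ / 2 * ‖z - y‖ ^ 2 ≤ D.breg z y := by
  have := add_inner_gradient_add_le hD.strongConvex hD.differentiable_avg y z
  rw [hD.gradient_avg] at this
  unfold breg
  linarith

theorem Admissible.breg_nonneg (hD : D.Admissible) (y z : Vec p) : 0 ≤ D.breg z y :=
  le_trans (by have := hD.mu_pos; positivity) (hD.mu_sq_le_breg y z)

theorem breg_eq_sum (D : Problem n p) (z y : Vec p) :
    D.breg z y = (1 / (n : ℝ))
      * ∑ i, (D.f i z - D.f i y - inner ℝ (gradient (D.f i) y) (z - y)) := by
  unfold breg avg gradAvg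
  rw [inner_smul_left, sum_inner, Finset.sum_sub_distrib, Finset.sum_sub_distrib]
  simp only [conj_trivial]
  ring

theorem Admissible.breg_le (hD : D.Admissible) (y z : Vec p) :
    D.breg z y ≤ D.LQ / 2 * ‖z - y‖ ^ 2 := by
  have hn := hD.cast_pos
  rw [breg_eq_sum]
  have h : ∑ i, (D.f i z - D.f i y - inner ℝ (gradient (D.f i) y) (z - y))
      ≤ ∑ i, (D.LQ * n / 2 * ‖z - y‖ ^ 2) * D.q i := by
    refine Finset.sum_le_sum fun i _ => ?_
    have h1 := le_add_inner_gradient_add (hD.differentiable i) (hD.smooth i) y z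
    have h2 := mul_le_mul_of_nonneg_right (hD.L_le i) (sq_nonneg ‖z - y‖)
    linarith
  rw [← Finset.mul_sum, hD.q_sum, mul_one] at h
  refine (mul_le_mul_of_nonneg_left h (by positivity)).trans (le_of_eq ?_)
  field_simp

/-- The second moment of the sampled gradient difference is at most `2 L_Q` times the Bregman
distance. -/
theorem Admissible.sum_sq_wgrad_sub_le (hD : D.Admissible) (y z : Vec p) :
    ∑ i, D.q i * ‖D.wgrad i y - D.wgrad i z‖ ^ 2 ≤ 2 * D.LQ * D.breg z y := by
  have hn := hD.cast_pos
  rw [breg_eq_sum, ← mul_assoc, Finset.mul_sum]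
  refine Finset.sum_le_sum fun i _ => ?_
  have hq := hD.q_pos i
  have h1 := sq_norm_gradient_sub_le (hD.convex i) (hD.differentiable i) (hD.L_pos i)
    (hD.smooth i) y z
  set b := D.f i z - D.f i y - inner ℝ (gradient (D.f i) y) (z - y) with hb
  have hb0 : 0 ≤ b := by
    have := add_inner_gradient_le (hD.convex i) (hD.differentiable i) y z
    linarith
  have h2 := mul_le_mul_of_nonneg_right (hD.L_le i) hb0
  unfold wgrad
  rw [← smul_sub, norm_smul, Real.norm_eq_abs, abs_of_pos (by positivity), mul_pow, norm_sub_rev]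
  calc D.q i * ((1 / (D.q i * n)) ^ 2 * ‖gradient (D.f i) z - gradient (D.f i) y‖ ^ 2)
      = 1 / (D.q i * n) * (1 / n) * ‖gradient (D.f i) z - gradient (D.f i) y‖ ^ 2 := by
        field_simp
    _ ≤ 1 / (D.q i * n) * (1 / n) * (2 * (D.LQ * (D.q i * n) * b)) := by
        refine mul_le_mul_of_nonneg_left ?_ (by positivity)
        linarith
    _ = _ := by field_simp

theorem Admissible.sum_wgrad (hD : D.Admissible) (x : Vec p) :
    ∑ i, D.q i • D.wgrad i x = D.gradAvg x := by
  have hn := hD.cast_pos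
  unfold wgrad gradAvg
  rw [Finset.smul_sum]
  refine Finset.sum_congr rfl fun i _ => ?_
  have := hD.q_pos i
  rw [smul_smul]
  congr 1
  field_simp

theorem Admissible.sq_norm_wgrad_sub_le_inner (hD : D.Admissible) (i : Fin n) (y z : Vec p) :
    ‖D.wgrad i z - D.wgrad i y‖ ^ 2 ≤ D.LQ * inner ℝ (z - y) (D.wgrad i z - D.wgrad i y) := by
  have hn := hD.cast_pos
  have hq := hD.q_pos i
  have hL := hD.L_pos i
  have h1 := sq_norm_gradient_sub_le_inner (hD.convex i) (hD.differentiable i) (hD.L_pos i)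
    (hD.smooth i) y z
  have h0 : 0 ≤ inner ℝ (z - y) (gradient (D.f i) z - gradient (D.f i) y) :=
    nonneg_of_mul_nonneg_right ((sq_nonneg _).trans h1) hL
  have h2 := mul_le_mul_of_nonneg_right (hD.L_le i) h0
  unfold wgrad
  rw [← smul_sub, norm_smul, Real.norm_eq_abs, abs_of_pos (by positivity), mul_pow,
    inner_smul_right]
  calc (1 / (D.q i * n)) ^ 2 * ‖gradient (D.f i) z - gradient (D.f i) y‖ ^ 2
      ≤ (1 / (D.q i * n)) ^ 2 * (D.LQ * (D.q i * n) *
          inner ℝ (z - y) (gradient (D.f i) z - gradient (D.f i) y)) := by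
        refine mul_le_mul_of_nonneg_left ?_ (by positivity)
        linarith
    _ = _ := by field_simp

theorem Admissible.lipschitzWith_wgrad (hD : D.Admissible) (i : Fin n) :
    LipschitzWith D.LQ.toNNReal (D.wgrad i) := by
  refine LipschitzWith.of_dist_le_mul fun z y => ?_
  rw [dist_eq_norm, dist_eq_norm, Real.coe_toNNReal _ hD.LQ_pos.le]
  have h1 := hD.sq_norm_wgrad_sub_le_inner i y z
  have h2 := real_inner_le_norm (z - y) (D.wgrad i z - D.wgrad i y)
  have h3 := mul_le_mul_of_nonneg_left h2 hD.LQ_pos.le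
  by_contra hlt
  push Not at hlt
  have : 0 < ‖D.wgrad i z - D.wgrad i y‖ :=
    lt_of_le_of_lt (mul_nonneg hD.LQ_pos.le (norm_nonneg _)) hlt
  nlinarith

theorem Admissible.exists_lipschitzWith_gradAvg (hD : D.Admissible) :
    ∃ K, LipschitzWith K D.gradAvg := by
  refine ⟨D.LQ.toNNReal, LipschitzWith.of_dist_le_mul fun z y => ?_⟩
  rw [← hD.sum_wgrad, ← hD.sum_wgrad, dist_eq_norm, ← Finset.sum_sub_distrib]
  refine (norm_sum_le _ _).trans ?_
  calc ∑ i, ‖D.q i • D.wgrad i z - D.q i • D.wgrad i y‖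
      ≤ ∑ i, D.q i * (D.LQ.toNNReal * dist z y) := Finset.sum_le_sum fun i _ => by
        rw [← smul_sub, norm_smul, Real.norm_eq_abs, abs_of_pos (hD.q_pos i), ← dist_eq_norm]
        exact mul_le_mul_of_nonneg_left ((hD.lipschitzWith_wgrad i).dist_le_mul z y)
          (hD.q_pos i).le
    _ = _ := by rw [← Finset.sum_mul, hD.q_sum, one_mul]

/-! ### The optimality gap -/

theorem Admissible.exists_argmin (hD : D.Admissible) (hP : D.Proper) :
    ∃ x, D.ψ x ≠ ⊤ ∧ ∀ z, D.F x ≤ D.F z := by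
  have hμ := hD.mu_pos
  refine hD.exists_minimizer hP (φ := D.avg) hD.differentiable_avg.continuous
    (a := D.μ / 4) (b := ‖D.gradAvg 0‖ ^ 2 / D.μ - D.avg 0) 0 (by positivity) fun z => ?_
  have h1 := hD.mu_sq_le_breg 0 z
  unfold breg at h1
  rw [sub_zero] at h1 ⊢
  have h2 : -(‖D.gradAvg 0‖ * ‖z‖) ≤ inner ℝ (D.gradAvg 0) z :=
    neg_le_of_abs_le (abs_real_inner_le_norm _ _)
  have h3 : ‖D.gradAvg 0‖ * ‖z‖ ≤ D.μ / 4 * ‖z‖ ^ 2 + ‖D.gradAvg 0‖ ^ 2 / D.μ := by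
    have e : D.μ / 4 * ‖z‖ ^ 2 + ‖D.gradAvg 0‖ ^ 2 / D.μ - ‖D.gradAvg 0‖ * ‖z‖
        = (D.μ * ‖z‖ / 2 - ‖D.gradAvg 0‖) ^ 2 / D.μ := by field_simp; ring
    have : 0 ≤ (D.μ * ‖z‖ / 2 - ‖D.gradAvg 0‖) ^ 2 / D.μ := by positivity
    linarith
  linarith

/-- The objective as a real number; meaningful on the domain of `ψ`. -/
def FR (D : Problem n p) (x : Vec p) : ℝ := D.avg x + (D.ψ x).toReal

/-- The optimality gap as a real number; meaningful where the gap is finite. -/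
def gapR (D : Problem n p) (x : Vec p) : ℝ := (D.gap x).toReal

theorem Admissible.coe_FR (hD : D.Admissible) {x : Vec p} (hx : D.ψ x ≠ ⊤) :
    (D.FR x : EReal) = D.F x := by
  unfold FR F
  rw [EReal.coe_add, hD.coe_toReal hx]

theorem Admissible.FR_le (hD : D.Admissible) {xs : Vec p} (hxs : D.ψ xs ≠ ⊤)
    (hmin : ∀ z, D.F xs ≤ D.F z) {x : Vec p} (hx : D.ψ x ≠ ⊤) : D.FR xs ≤ D.FR x := by
  have := hmin x
  rw [← hD.coe_FR hx, ← hD.coe_FR hxs] at this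
  exact_mod_cast this

theorem Admissible.gap_eq (hD : D.Admissible) {xs : Vec p} (hxs : D.ψ xs ≠ ⊤)
    (hmin : ∀ z, D.F xs ≤ D.F z) {x : Vec p} (hx : D.ψ x ≠ ⊤) :
    D.gap x = ENNReal.ofReal (D.FR x - D.FR xs) := by
  have h : D.Fstar = D.F xs := le_antisymm (iInf_le _ _) (le_iInf hmin)
  unfold gap
  rw [h, ← hD.coe_FR hx, ← hD.coe_FR hxs, ← EReal.coe_sub, EReal.toENNReal_of_ne_top
    (EReal.coe_ne_top _), EReal.toReal_coe]

theorem Admissible.gapR_eq (hD : D.Admissible) {xs : Vec p} (hxs : D.ψ xs ≠ ⊤)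
    (hmin : ∀ z, D.F xs ≤ D.F z) {x : Vec p} (hx : D.ψ x ≠ ⊤) :
    D.gapR x = D.FR x - D.FR xs := by
  unfold gapR
  rw [hD.gap_eq hxs hmin hx, ENNReal.toReal_ofReal (sub_nonneg.2 (hD.FR_le hxs hmin hx))]

theorem gapR_nonneg (D : Problem n p) (x : Vec p) : 0 ≤ D.gapR x := ENNReal.toReal_nonneg

theorem Admissible.ofReal_gapR (hD : D.Admissible) (hP : D.Proper) {x : Vec p}
    (hx : D.ψ x ≠ ⊤) : ENNReal.ofReal (D.gapR x) = D.gap x := by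
  obtain ⟨xs, hxs, hmin⟩ := hD.exists_argmin hP
  rw [hD.gapR_eq hxs hmin hx, hD.gap_eq hxs hmin hx]

theorem Admissible.measurable_gapR (hD : D.Admissible) : Measurable D.gapR := by
  refine Measurable.ennreal_toReal (Measurable.ereal_toENNReal ?_)
  have h1 : Measurable D.F := by
    refine Measurable.add ?_ hD.psi_lsc.measurable
    exact measurable_coe_real_ereal.comp hD.differentiable_avg.continuous.measurable
  exact h1.sub measurable_const

/-- Quadratic growth of the objective around its minimizer. -/
theorem Admissible.mu_sq_le_gapR (hD : D.Admissible) {xs : Vec p} (hxs : D.ψ xs ≠ ⊤)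
    (hmin : ∀ z, D.F xs ≤ D.F z) {x : Vec p} (hx : D.ψ x ≠ ⊤) :
    D.μ / 2 * ‖x - xs‖ ^ 2 ≤ D.gapR x := by
  have hμ := hD.mu_pos
  rw [hD.gapR_eq hxs hmin hx]
  -- the optimality of `xs` against the points `xs + t (x - xs)` with small `t`
  have key : ∀ t : ℝ, 0 < t → t ≤ 1 →
      (1 - t) * (D.μ / 2 * ‖x - xs‖ ^ 2) ≤ D.FR x - D.FR xs := by
    intro t ht ht1
    obtain ⟨h1, h2⟩ := hD.psi_combo hxs hx ht.le ht1
    have h3 := hD.FR_le hxs hmin h1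
    have h4 := hD.strongConvex.2 (Set.mem_univ xs) (Set.mem_univ x) (sub_nonneg.2 ht1) ht.le
      (by ring)
    have e : (1 - t) • xs + t • x = xs + t • (x - xs) := by
      rw [sub_smul, one_smul, smul_sub]; abel
    rw [e, norm_sub_rev] at h4
    simp only [smul_eq_mul] at h4
    unfold FR at h3 ⊢
    have h5 : 0 ≤ t * (D.avg x + (D.ψ x).toReal - (D.avg xs + (D.ψ xs).toReal)
        - (1 - t) * (D.μ / 2 * ‖x - xs‖ ^ 2)) := by linarith
    linarith [nonneg_of_mul_nonneg_right h5 ht]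
  have hlim : Filter.Tendsto (fun t : ℝ => (1 - t) * (D.μ / 2 * ‖x - xs‖ ^ 2))
      (nhdsWithin 0 (Set.Ioi 0)) (nhds (D.μ / 2 * ‖x - xs‖ ^ 2)) := by
    have : Continuous fun t : ℝ => (1 - t) * (D.μ / 2 * ‖x - xs‖ ^ 2) := by fun_prop
    simpa using (this.tendsto 0).mono_left (nhdsWithin_le_nhds (s := Set.Ioi 0))
  refine le_of_tendsto hlim ?_
  filter_upwards [Ioc_mem_nhdsGT (zero_lt_one (α := ℝ))] with t ht
  exact key t ht.1 ht.2

end Problem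

/-! ### One step of the method, pathwise -/

namespace Problem

variable {n p : ℕ} {D : Problem n p} {η : ℝ}

/-- The parameter `δ` attached to the step size `η` when `γ = μ`. -/
def delta (D : Problem n p) (η : ℝ) : ℝ := Real.sqrt (5 * η * D.μ / (3 * n))

/-- The extrapolation weight `θ` attached to the step size `η`. -/
def theta (D : Problem n p) (η : ℝ) : ℝ :=
  (3 * n * D.delta η - 5 * D.μ * η) / (3 - 5 * D.μ * η)

/-- The extrapolated point `y = θ v + (1 - θ) a`. -/
def mix (D : Problem n p) (η : ℝ) (v a : Vec p) : Vec p :=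
  D.theta η • v + (1 - D.theta η) • a

/-- The update of `v` when `γ = μ`. -/
def vstep (D : Problem n p) (η : ℝ) (v y x : Vec p) : Vec p :=
  (1 - D.delta η) • v + D.delta η • y + (D.delta η / (D.μ * η)) • (x - y)

theorem Admissible.delta_pos (hD : D.Admissible) (hη : 0 < η) : 0 < D.delta η := by
  have h1 := hD.mu_pos
  have h2 := hD.cast_pos
  exact Real.sqrt_pos.2 (by positivity)

theorem Admissible.delta_sq (hD : D.Admissible) (hη : 0 < η) :
    3 * n * D.delta η ^ 2 = 5 * η * D.μ := by
  have h1 := hD.mu_pos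
  have h2 := hD.cast_pos
  unfold delta
  rw [Real.sq_sqrt (by positivity)]
  field_simp

theorem Admissible.mul_delta_le (hD : D.Admissible) (hη : 0 < η) (hle : η ≤ D.eta) :
    n * D.delta η ≤ 1 / 3 := by
  have h1 := hD.mul_mu_le hle
  have h2 := hD.cast_pos
  have h3 := hD.delta_sq hη
  have h4 : (n * D.delta η) ^ 2 ≤ (1 / 3) ^ 2 := by nlinarith
  exact le_of_sq_le_sq h4 (by norm_num)

theorem Admissible.delta_le (hD : D.Admissible) (hη : 0 < η) (hle : η ≤ D.eta) :
    D.delta η ≤ 1 / 3 := by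
  have h1 := hD.mul_delta_le hη hle
  have h2 := hD.one_le_cast
  have h3 := hD.delta_pos hη
  nlinarith

/-- Up to the factor `1 - n δ²`, the extrapolation weight is `n δ (1 - δ)`. -/
theorem Admissible.theta_eq (hD : D.Admissible) (hη : 0 < η) (hle : η ≤ D.eta) :
    0 < 1 - n * D.delta η ^ 2 ∧
      D.theta η * (1 - n * D.delta η ^ 2) = n * D.delta η * (1 - D.delta η) := by
  have h1 := hD.mul_delta_le hη hle
  have h2 := hD.delta_le hη hle
  have h3 := hD.delta_pos hη
  have h4 := hD.delta_sq hη
  have hn := hD.cast_pos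
  have hpos : 0 < 1 - n * D.delta η ^ 2 := by nlinarith
  refine ⟨hpos, ?_⟩
  have e : 3 - 5 * D.μ * η = 3 * (1 - n * D.delta η ^ 2) := by linarith
  unfold theta
  rw [e, div_mul_eq_mul_div, div_eq_iff (by positivity)]
  have e2 : 5 * D.μ * η = 3 * n * D.delta η ^ 2 := by linarith
  rw [e2]
  ring

theorem Admissible.theta_pos (hD : D.Admissible) (hη : 0 < η) (hle : η ≤ D.eta) :
    0 < D.theta η := by
  obtain ⟨h1, h2⟩ := hD.theta_eq hη hle
  have h3 := hD.delta_pos hη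
  have h4 := hD.delta_le hη hle
  have hn := hD.cast_pos
  have h5 : 0 < n * D.delta η * (1 - D.delta η) := by
    apply mul_pos (mul_pos hn h3); linarith
  rw [← h2] at h5
  exact pos_of_mul_pos_left h5 h1.le

theorem Admissible.theta_sq_le (hD : D.Admissible) (hη : 0 < η) (hle : η ≤ D.eta) :
    D.theta η ^ 2 ≤ 5 / 3 * (D.μ * η * n) := by
  obtain ⟨h1, h2⟩ := hD.theta_eq hη hle
  have h3 := hD.delta_pos hη
  have h4 := hD.mul_delta_le hη hle
  have h5 := hD.delta_sq hη
  have h6 := hD.theta_pos hη hle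
  have hn := hD.cast_pos
  have h7 : D.theta η ≤ n * D.delta η := by
    have h8 : n * D.delta η * (1 - D.delta η) ≤ n * D.delta η * (1 - n * D.delta η ^ 2) := by
      apply mul_le_mul_of_nonneg_left _ (by positivity)
      nlinarith
    rw [← h2] at h8
    exact le_of_mul_le_mul_right h8 h1
  have h8 : D.theta η ^ 2 ≤ (n * D.delta η) ^ 2 := pow_le_pow_left₀ h6.le h7 2
  nlinarith

theorem Admissible.le_theta_sq (hD : D.Admissible) (hη : 0 < η) (hle : η ≤ D.eta) :
    20 / 27 * (D.μ * η * n) ≤ D.theta η ^ 2 := by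
  obtain ⟨h1, h2⟩ := hD.theta_eq hη hle
  have h3 := hD.delta_pos hη
  have h4 := hD.delta_le hη hle
  have h5 := hD.delta_sq hη
  have h6 := hD.theta_pos hη hle
  have hn := hD.cast_pos
  have h7 : 2 / 3 * (n * D.delta η) ≤ D.theta η := by
    have h8 : 2 / 3 * (n * D.delta η) ≤ n * D.delta η * (1 - D.delta η) := by
      have : 0 < n * D.delta η := by positivity
      nlinarith
    have h9 : D.theta η * (1 - n * D.delta η ^ 2) ≤ D.theta η := by
      have : 0 ≤ D.theta η * (n * D.delta η ^ 2) := by positivity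
      linarith
    linarith
  have h8 : (2 / 3 * (n * D.delta η)) ^ 2 ≤ D.theta η ^ 2 :=
    pow_le_pow_left₀ (by positivity) h7 2
  nlinarith

/-- The coupling of `v`, `y` and the anchor that balances the two comparison points. -/
theorem Admissible.mix_relation (hD : D.Admissible) (hη : 0 < η) (hle : η ≤ D.eta)
    (v a : Vec p) :
    (D.delta η * (1 - D.delta η)) • (v - D.mix η v a)
      = -((1 / (n : ℝ) - D.delta η) • (a - D.mix η v a)) := by
  obtain ⟨h1, h2⟩ := hD.theta_eq hη hle
  have hn := hD.cast_pos
  have e1 : v - D.mix η v a = (1 - D.theta η) • (v - a) := by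
    unfold mix; module
  have e2 : a - D.mix η v a = -(D.theta η • (v - a)) := by
    unfold mix; module
  rw [e1, e2, smul_neg, neg_neg, smul_smul, smul_smul]
  congr 1
  have h3 : n * (D.delta η * (1 - D.delta η) * (1 - D.theta η))
      = n * ((1 / (n : ℝ) - D.delta η) * D.theta η) := by
    have e : n * ((1 / (n : ℝ) - D.delta η) * D.theta η)
        = (1 - n * D.delta η) * D.theta η := by field_simp
    rw [e]
    linear_combination -h2
  exact mul_left_cancel₀ hn.ne' h3

/-- Descent of the objective in a proximal step along an inexact gradient `g`, compared with an
arbitrary point `z`. -/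
theorem Admissible.FR_prox_le (hD : D.Admissible) (hη : 0 < η) {y g x z : Vec p}
    (hx : IsProx η D.ψ (y - η • g) x) (hz : D.ψ z ≠ ⊤) :
    D.FR x ≤ D.FR z - D.breg z y - (η⁻¹ - D.LQ / 2) * ‖x - y‖ ^ 2
      + η⁻¹ * inner ℝ (x - y) (z - y) + inner ℝ (g - D.gradAvg y) (z - x) := by
  have h1 := mul_le_mul_of_nonneg_left (hD.inner_le_of_isProx hη hx hz) (inv_pos.2 hη).le
  rw [inv_mul_cancel_left₀ hη.ne'] at h1
  have h2 := hD.breg_le y x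
  have e1 : y - η • g - x = -(x - y) - η • g := by abel
  have e2 : z - x = (z - y) - (x - y) := by abel
  rw [e1] at h1
  unfold breg at h2 ⊢
  unfold FR
  rw [e2] at h1 ⊢
  simp only [inner_sub_left _ _ ((z - y) - (x - y)), inner_neg_left, inner_smul_left, conj_trivial,
    inner_sub_right _ (z - y) (x - y)] at h1 ⊢
  rw [real_inner_self_eq_norm_sq] at h1
  have e3 : η⁻¹ * (-inner ℝ (x - y) (z - y) - -‖x - y‖ ^ 2
      - (η * inner ℝ g (z - y) - η * inner ℝ g (x - y)))
      = -(η⁻¹ * inner ℝ (x - y) (z - y)) + η⁻¹ * ‖x - y‖ ^ 2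
        - (inner ℝ g (z - y) - inner ℝ g (x - y)) := by field_simp; ring
  rw [e3] at h1
  linarith

/-- The potential inequality of one step. The error of the gradient estimate enters only through
the last term. -/
theorem Admissible.potential_step (hD : D.Admissible) (hη : 0 < η) (hle : η ≤ D.eta)
    {v a g x xs : Vec p} (hx : IsProx η D.ψ (D.mix η v a - η • g) x)
    (ha : D.ψ a ≠ ⊤) (hxs : D.ψ xs ≠ ⊤) :
    1 / (n : ℝ) * (D.FR x - D.FR xs) + D.μ / 2 * ‖D.vstep η v (D.mix η v a) x - xs‖ ^ 2
      ≤ (1 - D.delta η) * (D.μ / 2 * ‖v - xs‖ ^ 2)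
        + (1 / (n : ℝ) - D.delta η) * (D.FR a - D.FR xs)
        - (1 / (n : ℝ) - D.delta η) * D.breg a (D.mix η v a)
        + inner ℝ (g - D.gradAvg (D.mix η v a))
            (D.delta η • xs + (1 / (n : ℝ) - D.delta η) • a - (1 / (n : ℝ)) • x) := by
  have hn := hD.cast_pos
  have hμ := hD.mu_pos
  have hδ := hD.delta_pos hη
  have hδ1 := hD.delta_le hη hle
  have hnδ := hD.mul_delta_le hη hle
  have hδsq := hD.delta_sq hη
  have hrel := hD.mix_relation hη hle v a
  have hLQ := hD.mul_LQ_le hle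
  set δ := D.delta η
  set y := D.mix η v a
  set β := 1 / (n : ℝ) - δ with hβ
  have hβ0 : 0 ≤ β := by
    rw [hβ, sub_nonneg, le_div_iff₀ hn]; linarith
  have h1 := mul_le_mul_of_nonneg_left (hD.FR_prox_le hη hx hxs) hδ.le
  have h2 := mul_le_mul_of_nonneg_left (hD.FR_prox_le hη hx ha) hβ0
  have h3 := mul_le_mul_of_nonneg_left (hD.mu_sq_le_breg y xs) hδ.le
  -- the error terms
  have hΔ : inner ℝ (g - D.gradAvg y) (δ • xs + β • a - (1 / (n : ℝ)) • x)
      = δ * inner ℝ (g - D.gradAvg y) (xs - x) + β * inner ℝ (g - D.gradAvg y) (a - x) := by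
    rw [← real_inner_smul_right, ← real_inner_smul_right, ← inner_add_right]
    congr 1
    rw [hβ]; module
  rw [hΔ]
  -- expansion of the square
  set u := v - y with hu
  set w := y - xs with hw
  set r := x - y with hr
  set s := a - y with hs
  have hvs : v - xs = u + w := by rw [hu, hw]; abel
  have hxsy : xs - y = -w := by rw [hw]; abel
  have hnew : D.vstep η v y x - xs = ((1 - δ) • u + w) + (δ / (D.μ * η)) • r := by
    rw [hu, hw, hr]; unfold vstep; module
  have hur : δ * (1 - δ) * inner ℝ r u = -(β * inner ℝ r s) := by
    have := congrArg (fun t => inner ℝ r t) hrel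
    simpa [inner_smul_right] using this
  have hsq : ‖(1 - δ) • u + w‖ ^ 2 ≤ (1 - δ) * ‖u + w‖ ^ 2 + δ * ‖w‖ ^ 2 := by
    rw [norm_add_sq_real, norm_add_sq_real, norm_smul, Real.norm_eq_abs,
      abs_of_pos (by linarith : (0:ℝ) < 1 - δ), inner_smul_left]
    simp only [conj_trivial]
    have : 0 ≤ δ * (1 - δ) * ‖u‖ ^ 2 :=
      mul_nonneg (mul_nonneg hδ.le (by linarith)) (sq_nonneg _)
    nlinarith
  rw [hvs, hnew, norm_add_sq_real, inner_smul_right, norm_smul, Real.norm_eq_abs,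
    abs_of_pos (by positivity : 0 < δ / (D.μ * η)), mul_pow, inner_add_left, inner_smul_left,
    real_inner_comm r u, real_inner_comm r w]
  simp only [conj_trivial]
  rw [hxsy, norm_neg] at h3
  rw [hxsy, inner_neg_right] at h1
  have hcoef : D.μ / 2 * ((δ / (D.μ * η)) ^ 2 * ‖r‖ ^ 2)
      = 5 / 6 * (1 / n) * η⁻¹ * ‖r‖ ^ 2 := by
    have : δ ^ 2 = 5 * η * D.μ / (3 * n) := by
      rw [eq_div_iff (by positivity)]; linarith
    rw [div_pow, this]
    field_simp
    ring
  have hcoef2 : ∀ t, D.μ / 2 * (2 * (δ / (D.μ * η) * t)) = η⁻¹ * (δ * t) := fun t => by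
    field_simp
  have hLQ' : D.LQ ≤ η⁻¹ / 3 := by
    rw [← one_div, div_div, le_div_iff₀ (by positivity)]; linarith
  have hrr : 1 / (n : ℝ) * (D.LQ / 2 - η⁻¹ / 6) * ‖r‖ ^ 2 ≤ 0 := by
    apply mul_nonpos_of_nonpos_of_nonneg _ (sq_nonneg _)
    apply mul_nonpos_of_nonneg_of_nonpos (by positivity)
    linarith
  have h1n : 1 / (n : ℝ) = δ + β := by rw [hβ]; ring
  have hsq' := mul_le_mul_of_nonneg_left hsq (by positivity : 0 ≤ D.μ / 2)
  have hur' : η⁻¹ * (δ * ((1 - δ) * inner ℝ r u)) = -(η⁻¹ * (β * inner ℝ r s)) := by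
    rw [← mul_assoc δ, hur]; ring
  rw [mul_add, mul_add, hcoef, hcoef2, mul_add δ, mul_add η⁻¹, hur']
  rw [h1n] at hrr ⊢
  linarith

/-- Energy estimate for the difference of two proximal gradient steps with over-relaxation
`5 / 3`: up to the perturbation `e` of one of the gradients, the relaxed step is nonexpansive. -/
theorem relaxed_step_le {E : Type*} [NormedAddCommGroup E] [InnerProductSpace ℝ E] {η : ℝ}
    (hη : 0 < η) {dx dy dG e : E} (h1 : ‖dx‖ ^ 2 ≤ inner ℝ dx (dy - η • dG - η • e))
    (h2 : 3 * η * ‖dG‖ ^ 2 ≤ inner ℝ dy dG) :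
    ‖(5 / 3 : ℝ) • dx - (2 / 3 : ℝ) • dy‖ ^ 2
      ≤ ‖dy‖ ^ 2 - 5 / 18 * ‖dx - dy‖ ^ 2 - 10 / 3 * η * inner ℝ dx e := by
  -- the cross term of `dx - dy` and `dG` is split with half of the available `5 / 9 ‖dx - dy‖²`
  have h3 : 0 ≤ ‖(dx - dy) + (6 * η) • dG‖ ^ 2 := sq_nonneg _
  have h2' := mul_le_mul_of_nonneg_left h2 hη.le
  rw [norm_add_sq_real, inner_smul_right, inner_sub_left, norm_smul, Real.norm_eq_abs,
    abs_of_pos (by positivity), mul_pow] at h3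
  rw [inner_sub_right, inner_sub_right, inner_smul_right, inner_smul_right] at h1
  rw [norm_sub_sq_real, norm_smul, norm_smul, inner_smul_left, inner_smul_right]
  rw [norm_sub_sq_real] at h3 ⊢
  simp only [conj_trivial, Real.norm_eq_abs]
  rw [abs_of_pos (by norm_num : (0:ℝ) < 5 / 3), abs_of_pos (by norm_num : (0:ℝ) < 2 / 3)]
  nlinarith

/-- A gradient step of a cocoercive map is nonexpansive. -/
theorem norm_sub_smul_le {E : Type*} [NormedAddCommGroup E] [InnerProductSpace ℝ E] {η : ℝ}
    (hη : 0 < η) {dy dG : E} (h2 : 3 * η * ‖dG‖ ^ 2 ≤ inner ℝ dy dG) :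
    ‖dy - η • dG‖ ≤ ‖dy‖ := by
  refine le_of_sq_le_sq ?_ (norm_nonneg _)
  rw [norm_sub_sq_real, inner_smul_right, norm_smul, Real.norm_eq_abs, abs_of_pos hη]
  have := mul_le_mul_of_nonneg_left h2 hη.le
  nlinarith [sq_nonneg (η * ‖dG‖)]

/-- Step sizes at most `1 / (3 L_Q)` leave a factor `3` in the cocoercivity of the weighted
gradients, which pays for the over-relaxation in `relaxed_step_le`. -/
theorem Admissible.cocoercive (hD : D.Admissible) (hη : 0 < η) (hle : η ≤ D.eta) (i : Fin n)
    (y z : Vec p) :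
    3 * η * ‖D.wgrad i z - D.wgrad i y‖ ^ 2 ≤ inner ℝ (z - y) (D.wgrad i z - D.wgrad i y) := by
  have h1 := hD.sq_norm_wgrad_sub_le_inner i y z
  have h2 := hD.mul_LQ_le hle
  have h3 := hD.LQ_pos
  have h4 : 0 ≤ inner ℝ (z - y) (D.wgrad i z - D.wgrad i y) :=
    nonneg_of_mul_nonneg_right ((sq_nonneg _).trans h1) h3
  nlinarith

/-- The noiseless step from `(v, a)` with the component `i`: the proximal point. -/
def idealX (D : Problem n p) (η : ℝ) (i : Fin n) (v a : Vec p) : Vec p :=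
  D.prox η (D.mix η v a - η • (D.wgrad i (D.mix η v a) - D.wgrad i a + D.gradAvg a))

/-- The noiseless step from `(v, a)` with the component `i`: the new value of `v`. -/
def idealV (D : Problem n p) (η : ℝ) (i : Fin n) (v a : Vec p) : Vec p :=
  D.vstep η v (D.mix η v a) (D.idealX η i v a)

section Compare

variable {v V a e x : Vec p} {i : Fin n}

theorem mix_sub_mix (D : Problem n p) (η : ℝ) (v V a : Vec p) :
    D.mix η v a - D.mix η V a = D.theta η • (v - V) := by
  unfold mix; module

/-- Comparison of a step with gradient perturbation `e` and the noiseless step with the same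
component and the same anchor: energy estimate for the `v`-variables. -/
theorem Admissible.vstep_sub_idealV_le (hD : D.Admissible) (hP : D.Proper) (hη : 0 < η)
    (hle : η ≤ D.eta)
    (hx : IsProx η D.ψ (D.mix η v a
      - η • (D.wgrad i (D.mix η v a) - D.wgrad i a + D.gradAvg a + e)) x) :
    D.theta η ^ 2 * ‖D.vstep η v (D.mix η v a) x - D.idealV η i V a‖ ^ 2
      ≤ D.theta η ^ 2 * ‖v - V‖ ^ 2
        - 5 / 18 * ‖(x - D.idealX η i V a) - D.theta η • (v - V)‖ ^ 2
        - 10 / 3 * η * inner ℝ (x - D.idealX η i V a) e := by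
  have hμ := hD.mu_pos
  have hn := hD.cast_pos
  obtain ⟨h1, h2⟩ := hD.theta_eq hη hle
  have hδ := hD.delta_pos hη
  have hδ1 := hD.delta_le hη hle
  have hδsq := hD.delta_sq hη
  have hθ := hD.theta_pos hη hle
  have hnδ := hD.mul_delta_le hη hle
  have hfirm := hD.firmly_nonexpansive hP hη hx (hD.isProx_prox hP hη
    (D.mix η V a - η • (D.wgrad i (D.mix η V a) - D.wgrad i a + D.gradAvg a)))
  have hco := hD.cocoercive hη hle i (D.mix η V a) (D.mix η v a)
  have hmix := D.mix_sub_mix η v V a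
  set y := D.mix η v a with hy
  set Y := D.mix η V a with hY
  have hX : D.prox η (Y - η • (D.wgrad i Y - D.wgrad i a + D.gradAvg a)) = D.idealX η i V a := rfl
  rw [hX] at hfirm
  set X := D.idealX η i V a with hXd
  have e1 : y - η • (D.wgrad i y - D.wgrad i a + D.gradAvg a + e)
      - (Y - η • (D.wgrad i Y - D.wgrad i a + D.gradAvg a))
      = (y - Y) - η • (D.wgrad i y - D.wgrad i Y) - η • e := by module
  rw [e1] at hfirm
  have key := relaxed_step_le hη hfirm hco
  rw [hmix] at key
  rw [norm_smul (D.theta η) (v - V), mul_pow, Real.norm_eq_abs, sq_abs] at key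
  refine le_trans ?_ key
  -- the relaxation parameter is `5 / 3`, up to a factor `c ≤ 1`
  set c := 1 - (1 - D.theta η) * D.delta η with hc
  have hc1 : c * (1 - n * D.delta η ^ 2) = 1 - D.delta η := by
    rw [hc]; linear_combination D.delta η * h2
  have hκ : D.theta η * (D.delta η / (D.μ * η)) = 5 / 3 * c := by
    have : D.delta η / (D.μ * η) = 5 / (3 * n * D.delta η) := by
      rw [div_eq_div_iff (by positivity) (by positivity)]; linarith
    rw [this, ← mul_left_inj' h1.ne', mul_assoc (5 / 3), hc1, mul_right_comm, h2]
    field_simp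
  have hc0 : 0 ≤ c := by
    have h : 0 ≤ c * (1 - n * D.delta η ^ 2) := by rw [hc1]; linarith
    exact nonneg_of_mul_nonneg_left h h1
  have hcle : c ≤ 1 := by
    have : c * (1 - n * D.delta η ^ 2) ≤ 1 * (1 - n * D.delta η ^ 2) := by
      rw [hc1]; nlinarith
    exact le_of_mul_le_mul_right this h1
  have hV : D.theta η • (D.vstep η v y x - D.idealV η i V a)
      = c • ((5 / 3 : ℝ) • (x - X) - (2 / 3 : ℝ) • (D.theta η • (v - V))) := by
    have e3 : D.theta η • (D.vstep η v y x - D.idealV η i V a)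
        = (1 - D.delta η) • (D.theta η • (v - V)) + (D.theta η * D.delta η) • (y - Y)
          + (D.theta η * (D.delta η / (D.μ * η))) • ((x - X) - (y - Y)) := by
      unfold idealV vstep; rw [← hY, ← hXd]; module
    rw [e3, hκ, hmix, hc]
    module
  rw [← sq_abs (D.theta η), ← Real.norm_eq_abs, ← mul_pow, ← norm_smul, hV, norm_smul,
    Real.norm_eq_abs, mul_pow, sq_abs]
  exact mul_le_of_le_one_left (sq_nonneg _) (pow_le_one₀ hc0 hcle)

/-- Comparison of a step with gradient perturbation `e` and the noiseless step with the same
component and the same anchor: the proximal points. -/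
theorem Admissible.norm_sub_idealX_le (hD : D.Admissible) (hP : D.Proper) (hη : 0 < η)
    (hle : η ≤ D.eta)
    (hx : IsProx η D.ψ (D.mix η v a
      - η • (D.wgrad i (D.mix η v a) - D.wgrad i a + D.gradAvg a + e)) x) :
    ‖x - D.idealX η i V a‖ ≤ D.theta η * ‖v - V‖ + η * ‖e‖ := by
  have hθ := hD.theta_pos hη hle
  have hne := hD.norm_sub_le_of_isProx hP hη hx (hD.isProx_prox hP hη
    (D.mix η V a - η • (D.wgrad i (D.mix η V a) - D.wgrad i a + D.gradAvg a)))
  have hco := norm_sub_smul_le hη (hD.cocoercive hη hle i (D.mix η V a) (D.mix η v a))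
  rw [D.mix_sub_mix, norm_smul (D.theta η) (v - V), Real.norm_eq_abs, abs_of_pos hθ] at hco
  set y := D.mix η v a
  set Y := D.mix η V a
  have e1 : y - η • (D.wgrad i y - D.wgrad i a + D.gradAvg a + e)
      - (Y - η • (D.wgrad i Y - D.wgrad i a + D.gradAvg a))
      = (y - Y - η • (D.wgrad i y - D.wgrad i Y)) - η • e := by module
  rw [e1, D.mix_sub_mix] at hne
  refine hne.trans ((norm_sub_le _ _).trans ?_)
  rw [norm_smul η, Real.norm_eq_abs, abs_of_pos hη]
  linarith

end Compare

end Problem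

/-! ### Conditionally centered perturbations and independent draws -/

section Prob

variable {Ω : Type*} {m m' mΩ : MeasurableSpace Ω} {P : Measure Ω}
  {E : Type*} [NormedAddCommGroup E]

theorem integrable_inner_of_memLp [InnerProductSpace ℝ E] {f g : Ω → E} (hf : MemLp f 2 P)
    (hg : MemLp g 2 P) :
    Integrable (fun ω => inner ℝ (f ω) (g ω)) P := by
  have hf' := hf.integrable_norm_pow (by norm_num)
  have hg' := hg.integrable_norm_pow (by norm_num)
  refine (hf'.add hg').mono' (hf.1.inner hg.1) (Filter.Eventually.of_forall fun ω => ?_)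
  rw [Real.norm_eq_abs]
  refine (abs_real_inner_le_norm _ _).trans ?_
  simp only [Pi.add_apply]
  nlinarith [sq_nonneg (‖f ω‖ - ‖g ω‖), sq_nonneg ‖f ω‖, sq_nonneg ‖g ω‖]

theorem integrable_sq_norm_of_memLp {f : Ω → E} (hf : MemLp f 2 P) :
    Integrable (fun ω => ‖f ω‖ ^ 2) P := by
  simpa using hf.integrable_norm_pow (by norm_num)

/-- A perturbation centered given `m` is orthogonal to everything `m`-measurable. -/
theorem integral_inner_eq_zero_of_condExp [InnerProductSpace ℝ E] [IsProbabilityMeasure P]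
    [CompleteSpace E] (hm : m ≤ mΩ) {ζ H : Ω → E} (hζ : MemLp ζ 2 P) (h0 : P[ζ | m] =ᵐ[P] 0)
    (hHm : StronglyMeasurable[m] H) (hH : MemLp H 2 P) :
    ∫ ω, inner ℝ (ζ ω) (H ω) ∂P = 0 := by
  have h := condExp_bilin_of_stronglyMeasurable_right (μ := P) (innerSL ℝ) hHm
    (f := ζ) (integrable_inner_of_memLp hζ hH) (hζ.integrable (by norm_num))
  have h2 := integral_condExp hm (μ := P) (f := fun ω => innerSL ℝ (ζ ω) (H ω))
  rw [integral_congr_ae h] at h2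
  have h3 : ∫ ω, (innerSL ℝ) ((P[ζ | m]) ω) (H ω) ∂P = 0 := by
    rw [integral_congr_ae (g := fun _ => (0 : ℝ))]
    · simp
    · filter_upwards [h0] with ω hω
      simp [hω]
  rw [h3] at h2
  exact h2.symm

/-- Integration over an event independent of the integrand. -/
theorem setIntegral_of_indep [NormedSpace ℝ E] [IsProbabilityMeasure P]
    [CompleteSpace E] (hm : m ≤ mΩ) (hm' : m' ≤ mΩ)
    (hindep : Indep m' m P)
    {s : Set Ω} (hs : MeasurableSet[m'] s) {Z : Ω → E} (hZm : StronglyMeasurable[m] Z)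
    (hZ : Integrable Z P) : ∫ ω in s, Z ω ∂P = P.real s • ∫ ω, Z ω ∂P := by
  rw [← setIntegral_condExp hm' hZ hs]
  have h := condExp_indep_eq hm hm' hZm hindep.symm
  rw [setIntegral_congr_ae (hm' s hs) (g := fun _ => ∫ ω, Z ω ∂P)]
  · simp
  · filter_upwards [h] with ω hω _ using hω

theorem measurable_sq_norm [MeasurableSpace E] [OpensMeasurableSpace E] {u : Ω → E}
    (hu : Measurable[m] u) : Measurable[m] (fun ω => ‖u ω‖ ^ 2) :=
  (continuous_norm.pow 2).measurable.comp hu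

variable {n : ℕ} {idx : Ω → Fin n}

theorem apply_index_eq_sum_indicator (Z : Fin n → Ω → E) :
    (fun ω => Z (idx ω) ω) = fun ω => ∑ i, Set.indicator {ω | idx ω = i} (Z i) ω := by
  funext ω
  rw [Finset.sum_eq_single (idx ω)]
  · exact (Set.indicator_of_mem (s := {ω' | idx ω' = idx ω}) rfl (Z (idx ω))).symm
  · intro i _ hi
    exact Set.indicator_of_notMem (s := {ω | idx ω = i}) (fun h => hi (Eq.symm h)) (Z i)
  · simp

theorem measurableSet_index_eq (hidx : Measurable idx) (i : Fin n) :
    MeasurableSet {ω | idx ω = i} :=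
  hidx (measurableSet_singleton i)

theorem integrable_apply_index (hidx : Measurable idx) {Z : Fin n → Ω → E}
    (hZ : ∀ i, Integrable (Z i) P) : Integrable (fun ω => Z (idx ω) ω) P := by
  rw [apply_index_eq_sum_indicator]
  exact integrable_finsetSum _ fun i _ => (hZ i).indicator (measurableSet_index_eq hidx i)

theorem integral_apply_index [NormedSpace ℝ E] (hidx : Measurable idx) {Z : Fin n → Ω → E}
    (hZ : ∀ i, Integrable (Z i) P) :
    ∫ ω, Z (idx ω) ω ∂P = ∑ i, ∫ ω in {ω | idx ω = i}, Z i ω ∂P := by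
  rw [apply_index_eq_sum_indicator, integral_finsetSum _ fun i _ =>
    (hZ i).indicator (measurableSet_index_eq hidx i)]
  exact Finset.sum_congr rfl fun i _ => integral_indicator (measurableSet_index_eq hidx i)

theorem memLp_apply_index (hidx : Measurable idx) {Z : Fin n → Ω → E}
    (hZ : ∀ i, MemLp (Z i) 2 P) : MemLp (fun ω => Z (idx ω) ω) 2 P := by
  rw [apply_index_eq_sum_indicator]
  exact memLp_finsetSum _ fun i _ => (hZ i).indicator (measurableSet_index_eq hidx i)

/-- Averaging over an index drawn independently of the past. -/
theorem integral_apply_index_of_indep [NormedSpace ℝ E] [IsProbabilityMeasure P]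
    [CompleteSpace E] (hm : m ≤ mΩ) (hidx : Measurable idx)
    (hindep : Indep (MeasurableSpace.comap idx ⊤) m P) {q : Fin n → ℝ} (hq : ∀ i, 0 ≤ q i)
    (hlaw : ∀ i, P {ω | idx ω = i} = ENNReal.ofReal (q i)) {Z : Fin n → Ω → E}
    (hZm : ∀ i, StronglyMeasurable[m] (Z i)) (hZ : ∀ i, Integrable (Z i) P) :
    ∫ ω, Z (idx ω) ω ∂P = ∑ i, q i • ∫ ω, Z i ω ∂P := by
  rw [integral_apply_index hidx hZ]
  refine Finset.sum_congr rfl fun i _ => ?_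
  rw [setIntegral_of_indep (s := {ω | idx ω = i}) hm hidx.comap_le hindep
    ⟨{i}, trivial, rfl⟩ (hZm i) (hZ i)]
  congr 1
  rw [measureReal_def, hlaw i, ENNReal.toReal_ofReal (hq i)]

/-- Measurability of a selection among finitely many measurable functions. -/
theorem measurable_apply_index {α : Type*} [MeasurableSpace α] (hidx : Measurable[m] idx)
    {Z : Fin n → Ω → α} (hZ : ∀ i, Measurable[m] (Z i)) :
    Measurable[m] (fun ω => Z (idx ω) ω) := by
  intro s hs
  have : (fun ω => Z (idx ω) ω) ⁻¹' s = ⋃ i, {ω | idx ω = i} ∩ Z i ⁻¹' s := by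
    ext ω; simp
  rw [this]
  exact MeasurableSet.iUnion fun i =>
    (hidx (measurableSet_singleton i)).inter (hZ i hs)

variable {c : Ω → Bool}

theorem measurable_ite_coin {α : Type*} [MeasurableSpace α] (hc : Measurable[m] c)
    {Z W : Ω → α} (hZ : Measurable[m] Z) (hW : Measurable[m] W) :
    Measurable[m] (fun ω => if c ω then Z ω else W ω) :=
  Measurable.ite (m := m) (p := fun ω => c ω = true) (hc (measurableSet_singleton true)) hZ hW

/-- Averaging over a coin, where the integrand on heads may use later information. -/
theorem integral_ite_coin [NormedSpace ℝ E] (hc : Measurable c) {Z W : Ω → E} (hZ : Integrable Z P)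
    (hW : Integrable W P) :
    ∫ ω, (if c ω then Z ω else W ω) ∂P
      = ∫ ω in {ω | c ω = true}, Z ω ∂P + ∫ ω in {ω | c ω = false}, W ω ∂P := by
  have h1 : MeasurableSet {ω | c ω = true} := hc (measurableSet_singleton true)
  have h2 : MeasurableSet {ω | c ω = false} := hc (measurableSet_singleton false)
  rw [← integral_indicator h1, ← integral_indicator h2,
    ← integral_add (hZ.indicator h1) (hW.indicator h2)]
  congr 1
  funext ω
  cases h : c ω <;> simp [Set.indicator, h]

theorem integrable_ite_coin (hc : Measurable c) {Z W : Ω → E} (hZ : Integrable Z P)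
    (hW : Integrable W P) : Integrable (fun ω => if c ω then Z ω else W ω) P := by
  have h1 : MeasurableSet {ω | c ω = true} := hc (measurableSet_singleton true)
  exact Integrable.piecewise (s := {ω | c ω = true}) h1 hZ.integrableOn hW.integrableOn

theorem memLp_ite_coin (hc : Measurable c) {Z W : Ω → E} (hZ : MemLp Z 2 P)
    (hW : MemLp W 2 P) : MemLp (fun ω => if c ω then Z ω else W ω) 2 P := by
  have h1 : MeasurableSet {ω | c ω = true} := hc (measurableSet_singleton true)
  exact MemLp.piecewise (s := {ω | c ω = true}) h1 (hZ.restrict _) (hW.restrict _)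

theorem measureReal_coin [IsProbabilityMeasure P] (hc : Measurable c) {r : ℝ} (hr : 0 ≤ r)
    (hlaw : P {ω | c ω = true} = ENNReal.ofReal r) :
    P.real {ω | c ω = true} = r ∧ P.real {ω | c ω = false} = 1 - r := by
  have h1 : MeasurableSet {ω | c ω = true} := hc (measurableSet_singleton true)
  have e : {ω | c ω = false} = {ω | c ω = true}ᶜ := by ext ω; simp
  have h2 : P.real {ω | c ω = true} = r := by
    rw [measureReal_def, hlaw, ENNReal.toReal_ofReal hr]
  refine ⟨h2, ?_⟩
  rw [e, probReal_compl_eq_one_sub h1, h2]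

theorem setIntegral_coin_false [NormedSpace ℝ E] [IsProbabilityMeasure P]
    [CompleteSpace E] (hm : m ≤ mΩ) (hc : Measurable c)
    (hindep : Indep (MeasurableSpace.comap c ⊤) m P) {r : ℝ} (hr : 0 ≤ r)
    (hlaw : P {ω | c ω = true} = ENNReal.ofReal r) {W : Ω → E} (hWm : StronglyMeasurable[m] W)
    (hW : Integrable W P) :
    ∫ ω in {ω | c ω = false}, W ω ∂P = (1 - r) • ∫ ω, W ω ∂P := by
  rw [setIntegral_of_indep (s := {ω | c ω = false}) hm hc.comap_le hindep
    ⟨{false}, trivial, rfl⟩ hWm hW,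
    (measureReal_coin hc hr hlaw).2]

theorem setIntegral_coin_true [NormedSpace ℝ E] [IsProbabilityMeasure P]
    [CompleteSpace E] (hm : m ≤ mΩ) (hc : Measurable c)
    (hindep : Indep (MeasurableSpace.comap c ⊤) m P) {r : ℝ} (hr : 0 ≤ r)
    (hlaw : P {ω | c ω = true} = ENNReal.ofReal r) {W : Ω → E} (hWm : StronglyMeasurable[m] W)
    (hW : Integrable W P) :
    ∫ ω in {ω | c ω = true}, W ω ∂P = r • ∫ ω, W ω ∂P := by
  rw [setIntegral_of_indep (s := {ω | c ω = true}) hm hc.comap_le hindep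
    ⟨{true}, trivial, rfl⟩ hWm hW,
    (measureReal_coin hc hr hlaw).1]

/-- A bound on the conditional expectation integrates over events of the past. -/
theorem setIntegral_le_of_condExp_le [IsProbabilityMeasure P] (hm : m ≤ mΩ) {Z : Ω → ℝ}
    (hZ : Integrable Z P) {r : ℝ}
    (h : P[Z | m] ≤ᵐ[P] fun _ => r) {s : Set Ω} (hs : MeasurableSet[m] s) :
    ∫ ω in s, Z ω ∂P ≤ r * P.real s := by
  rw [← setIntegral_condExp hm hZ hs]
  have h1 : ∫ ω in s, (P[Z | m]) ω ∂P ≤ ∫ ω in s, (fun _ => r) ω ∂P :=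
    setIntegral_mono_ae integrable_condExp.integrableOn (integrable_const r).integrableOn h
  refine h1.trans (le_of_eq ?_)
  simp [mul_comm]

theorem setIntegral_eq_zero_of_condExp [NormedSpace ℝ E] [IsProbabilityMeasure P]
    [CompleteSpace E] (hm : m ≤ mΩ) {Z : Ω → E}
    (hZ : Integrable Z P)
    (h : P[Z | m] =ᵐ[P] 0) {s : Set Ω} (hs : MeasurableSet[m] s) :
    ∫ ω in s, Z ω ∂P = 0 := by
  rw [← setIntegral_condExp hm hZ hs, setIntegral_congr_ae (hm s hs) (g := fun _ => (0 : E))]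
  · simp
  · filter_upwards [h] with ω hω _ using hω

theorem memLp_comp_lipschitz [IsProbabilityMeasure P] {F G : Type*} [NormedAddCommGroup F]
    [NormedAddCommGroup G] {K : NNReal} {h : F → G} (hh : LipschitzWith K h) {u : Ω → F}
    (hu : MemLp u 2 P) :
    MemLp (fun ω => h (u ω)) 2 P := by
  have h0 : LipschitzWith K (fun x => h x - h 0) :=
    LipschitzWith.of_dist_le_mul fun x y => by
      rw [dist_sub_right]; exact hh.dist_le_mul x y
  have h1 := (h0.comp_memLp (by simp) hu).add (memLp_const (μ := P) (p := 2) (h 0))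
  refine h1.ae_eq (Filter.Eventually.of_forall fun ω => ?_)
  simp

end Prob

/-! ### The noiseless step is Lipschitz -/

/-- Lipschitz continuity with an unspecified constant. -/
def IsLip {α β : Type*} [PseudoEMetricSpace α] [PseudoEMetricSpace β] (f : α → β) : Prop :=
  ∃ K, LipschitzWith K f

namespace IsLip

variable {α β E : Type*} [PseudoEMetricSpace α] [PseudoEMetricSpace β]
  [NormedAddCommGroup E] {f g : α → E}

theorem comp {γ : Type*} [PseudoEMetricSpace γ] {f : β → γ} {g : α → β} (hf : IsLip f)
    (hg : IsLip g) : IsLip (fun x => f (g x)) := by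
  obtain ⟨K, hK⟩ := hf
  obtain ⟨K', hK'⟩ := hg
  exact ⟨_, hK.comp hK'⟩

theorem add (hf : IsLip f) (hg : IsLip g) : IsLip (fun x => f x + g x) := by
  obtain ⟨K, hK⟩ := hf
  obtain ⟨K', hK'⟩ := hg
  exact ⟨_, hK.add hK'⟩

theorem sub (hf : IsLip f) (hg : IsLip g) : IsLip (fun x => f x - g x) := by
  obtain ⟨K, hK⟩ := hf
  obtain ⟨K', hK'⟩ := hg
  exact ⟨_, hK.sub hK'⟩

theorem smul [NormedSpace ℝ E] (c : ℝ) (hf : IsLip f) : IsLip (fun x => c • f x) :=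
  IsLip.comp ⟨_, lipschitzWith_smul c⟩ hf

theorem const (b : β) : IsLip (fun _ : α => b) := ⟨0, LipschitzWith.const b⟩

theorem fst : IsLip (fun s : α × β => s.1) := ⟨1, LipschitzWith.prod_fst⟩

theorem snd : IsLip (fun s : α × β => s.2) := ⟨1, LipschitzWith.prod_snd⟩

theorem prodMk {γ : Type*} [PseudoEMetricSpace γ] {f : α → β} {g : α → γ} (hf : IsLip f)
    (hg : IsLip g) : IsLip (fun x => (f x, g x)) := by
  obtain ⟨K, hK⟩ := hf
  obtain ⟨K', hK'⟩ := hg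
  exact ⟨_, hK.prodMk hK'⟩

theorem continuous (hf : IsLip f) : Continuous f := hf.choose_spec.continuous

theorem measurable_comp {Ω F : Type*} {m : MeasurableSpace Ω} [NormedAddCommGroup F]
    [MeasurableSpace F] [OpensMeasurableSpace F] [MeasurableSpace E] [BorelSpace E] {h : F → E}
    (hh : IsLip h) {u : Ω → F} (hu : Measurable[m] u) : Measurable[m] (fun ω => h (u ω)) :=
  hh.continuous.measurable.comp hu

theorem memLp {Ω : Type*} {mΩ : MeasurableSpace Ω} {P : Measure Ω} [IsProbabilityMeasure P]
    {F : Type*} [NormedAddCommGroup F] {h : F → E} (hh : IsLip h) {u : Ω → F}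
    (hu : MemLp u 2 P) : MemLp (fun ω => h (u ω)) 2 P :=
  memLp_comp_lipschitz hh.choose_spec hu

end IsLip

namespace Problem

variable {n p : ℕ} {D : Problem n p} {η : ℝ}

theorem Admissible.isLip_prox (hD : D.Admissible) (hP : D.Proper) (hη : 0 < η) :
    IsLip (D.prox η) := ⟨1, hD.lipschitzWith_prox hP hη⟩

theorem Admissible.isLip_wgrad (hD : D.Admissible) (i : Fin n) : IsLip (D.wgrad i) :=
  ⟨_, hD.lipschitzWith_wgrad i⟩

theorem Admissible.isLip_gradAvg (hD : D.Admissible) : IsLip D.gradAvg :=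
  hD.exists_lipschitzWith_gradAvg

/-- The proximal point of the step from `(v, a)` with the component `i` and gradient
perturbation `e`. -/
def stepX (D : Problem n p) (η : ℝ) (i : Fin n) (v a e : Vec p) : Vec p :=
  D.prox η (D.mix η v a - η • (D.wgrad i (D.mix η v a) - D.wgrad i a + D.gradAvg a + e))

section

variable {α : Type*} [PseudoEMetricSpace α] {v a e y x : α → Vec p}

theorem isLip_mix (D : Problem n p) (η : ℝ) (hv : IsLip v) (ha : IsLip a) :
    IsLip (fun s => D.mix η (v s) (a s)) :=
  (hv.smul _).add (ha.smul _)

theorem isLip_vstep (D : Problem n p) (η : ℝ) (hv : IsLip v) (hy : IsLip y) (hx : IsLip x) :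
    IsLip (fun s => D.vstep η (v s) (y s) (x s)) :=
  ((hv.smul _).add (hy.smul _)).add ((hx.sub hy).smul _)

theorem Admissible.isLip_stepX (hD : D.Admissible) (hP : D.Proper) (hη : 0 < η) (i : Fin n)
    (hv : IsLip v) (ha : IsLip a) (he : IsLip e) :
    IsLip (fun s => D.stepX η i (v s) (a s) (e s)) := by
  have hm := D.isLip_mix η hv ha
  exact (hD.isLip_prox hP hη).comp (hm.sub ((((((hD.isLip_wgrad i).comp hm).sub
    ((hD.isLip_wgrad i).comp ha)).add (hD.isLip_gradAvg.comp ha)).add he).smul η))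

theorem Admissible.isLip_idealX (hD : D.Admissible) (hP : D.Proper) (hη : 0 < η) (i : Fin n)
    (hv : IsLip v) (ha : IsLip a) : IsLip (fun s => D.idealX η i (v s) (a s)) := by
  have hm := D.isLip_mix η hv ha
  exact (hD.isLip_prox hP hη).comp (hm.sub (((((hD.isLip_wgrad i).comp hm).sub
    ((hD.isLip_wgrad i).comp ha)).add (hD.isLip_gradAvg.comp ha)).smul η))

theorem Admissible.isLip_idealV (hD : D.Admissible) (hP : D.Proper) (hη : 0 < η) (i : Fin n)
    (hv : IsLip v) (ha : IsLip a) : IsLip (fun s => D.idealV η i (v s) (a s)) :=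
  D.isLip_vstep η hv (D.isLip_mix η hv ha) (hD.isLip_idealX hP hη i hv ha)

end

end Problem

/-! ### Runs of the method with `γ₀ = μ` -/

namespace Run

variable {n p : ℕ} {D : Problem n p} {Ω : Type*} [mΩ : MeasurableSpace Ω] {P : Measure Ω}
  {η : ℕ → ℝ} {x₀ : Ω → Vec p}

/-- The standing assumptions on a run: an admissible problem, step sizes at most the constant
step size, and a square integrable initial point in the domain of the regularizer. -/
structure Good (R : Run D P η D.μ x₀) : Prop where
  adm : D.Admissible
  proper : D.Proper
  η_pos : ∀ k, 0 < η (k + 1)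
  η_le : ∀ k, η (k + 1) ≤ D.eta
  x₀_memLp : MemLp x₀ 2 P
  x₀_dom : ∀ ω, D.ψ (x₀ ω) ≠ ⊤

/-- The perturbation of the stored full gradient at the anchor. It is kept until the anchor is
updated, so it is not centered given the past of a later iteration. -/
def anchorNoise (R : Run D P η D.μ x₀) (k : ℕ) (ω : Ω) : Vec p :=
  R.zbar k ω - D.gradAvg (R.anchor k ω)

/-- The fresh gradient perturbation of iteration `k + 1`. -/
def freshNoise (R : Run D P η D.μ x₀) (k : ℕ) (ω : Ω) : Vec p :=
  (1 / (D.q (R.idx (k + 1) ω) * n)) • (R.ζ (k + 1) ω - R.ζ' (k + 1) ω)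

/-- The sampling error of iteration `k + 1`. -/
def sampleNoise (R : Run D P η D.μ x₀) (k : ℕ) (ω : Ω) : Vec p :=
  (D.wgrad (R.idx (k + 1) ω) (R.y k ω) - D.wgrad (R.idx (k + 1) ω) (R.anchor k ω))
    - (D.gradAvg (R.y k ω) - D.gradAvg (R.anchor k ω))

/-- The shadow of `v`: the sequence that is reset to `v` at every update of the anchor and
otherwise performs noiseless steps with the same sampled components. -/
def shadow (R : Run D P η D.μ x₀) : ℕ → Ω → Vec p
  | 0, ω => R.v 0 ω
  | k + 1, ω => if R.refresh (k + 1) ω then R.v (k + 1) ω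
      else D.idealV (η (k + 1)) (R.idx (k + 1) ω) (R.shadow k ω) (R.anchor k ω)

variable {R : Run D P η D.μ x₀}

theorem γ_eq (R : Run D P η D.μ x₀) (k : ℕ) : R.γ k = D.μ := by
  induction k with
  | zero => exact R.γ_zero
  | succ k ih => rw [R.γ_succ, ih]; ring

theorem δ_eq_delta (R : Run D P η D.μ x₀) (k : ℕ) : R.δ (k + 1) = D.delta (η (k + 1)) := by
  rw [R.δ_eq, R.γ_eq]; rfl

theorem y_eq_mix (R : Run D P η D.μ x₀) (k : ℕ) (ω : Ω) :
    R.y k ω = D.mix (η (k + 1)) (R.v k ω) (R.anchor k ω) := by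
  rw [R.y_eq, R.δ_eq_delta]; rfl

theorem Good.v_succ (h : R.Good) (k : ℕ) (ω : Ω) :
    R.v (k + 1) ω = D.vstep (η (k + 1)) (R.v k ω) (R.y k ω) (R.x (k + 1) ω) := by
  have := h.adm.mu_pos.ne'
  rw [R.v_succ, R.δ_eq_delta, R.γ_eq, mul_div_cancel_left₀ _ this]; rfl

/-- The gradient estimator is the noiseless variance-reduced one plus two perturbations. -/
theorem g_eq_ideal (R : Run D P η D.μ x₀) (k : ℕ) (ω : Ω) :
    R.g (k + 1) ω = D.wgrad (R.idx (k + 1) ω) (R.y k ω)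
      - D.wgrad (R.idx (k + 1) ω) (R.anchor k ω) + D.gradAvg (R.anchor k ω)
      + (R.anchorNoise k ω + R.freshNoise k ω) := by
  rw [R.g_eq]
  unfold Problem.wgrad anchorNoise freshNoise
  module

/-- The error of the gradient estimator. -/
theorem g_sub (R : Run D P η D.μ x₀) (k : ℕ) (ω : Ω) :
    R.g (k + 1) ω - D.gradAvg (R.y k ω)
      = R.sampleNoise k ω + R.freshNoise k ω + R.anchorNoise k ω := by
  rw [R.g_eq_ideal]
  unfold sampleNoise
  abel

theorem anchorNoise_zero (R : Run D P η D.μ x₀) (ω : Ω) :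
    R.anchorNoise 0 ω = (1 / (n : ℝ)) • ∑ i, R.ξ 0 i ω := by
  unfold anchorNoise Problem.gradAvg
  rw [R.zbar_zero, Finset.sum_add_distrib]
  module

theorem anchorNoise_succ (R : Run D P η D.μ x₀) (k : ℕ) (ω : Ω) :
    R.anchorNoise (k + 1) ω = if R.refresh (k + 1) ω then (1 / (n : ℝ)) • ∑ i, R.ξ (k + 1) i ω
      else R.anchorNoise k ω := by
  unfold anchorNoise
  rw [R.zbar_succ, R.anchor_succ]
  split_ifs with h
  · unfold Problem.gradAvg
    rw [Finset.sum_add_distrib]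
    module
  · rfl

theorem Good.psi_x (h : R.Good) (k : ℕ) (ω : Ω) : D.ψ (R.x k ω) ≠ ⊤ := by
  cases k with
  | zero => rw [R.x_zero]; exact h.x₀_dom ω
  | succ k =>
    obtain ⟨z, hz⟩ := h.proper.dom_nonempty
    exact h.adm.psi_ne_top_of_isProx (h.η_pos k) (R.x_succ k ω) hz

theorem Good.psi_anchor (h : R.Good) (k : ℕ) (ω : Ω) : D.ψ (R.anchor k ω) ≠ ⊤ := by
  induction k with
  | zero => rw [R.anchor_zero]; exact h.x₀_dom ω
  | succ k ih =>
    rw [R.anchor_succ]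
    split_ifs
    · exact h.psi_x _ _
    · exact ih

theorem Good.x_succ (h : R.Good) (k : ℕ) (ω : Ω) :
    R.x (k + 1) ω = D.prox (η (k + 1)) (R.y k ω - η (k + 1) • R.g (k + 1) ω) :=
  h.adm.eq_prox h.proper (h.η_pos k) (R.x_succ k ω)

/-! ### Measurability and square integrability of the iterates -/

theorem mCoin_le (R : Run D P η D.μ x₀) (k : ℕ) : R.mCoin k ≤ mΩ :=
  (R.mCoin_le_mAll k).trans (R.mAll_le k)

theorem mNoise_le (R : Run D P η D.μ x₀) (k : ℕ) : R.mNoise (k + 1) ≤ mΩ :=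
  (R.mNoise_le_mCoin k).trans (R.mCoin_le _)

theorem mIdx_le (R : Run D P η D.μ x₀) (k : ℕ) : R.mIdx (k + 1) ≤ mΩ :=
  (R.mIdx_le_mNoise k).trans (R.mNoise_le _)

theorem mAll_le_mNoise (R : Run D P η D.μ x₀) (k : ℕ) : R.mAll k ≤ R.mNoise (k + 1) :=
  (R.mAll_le_mIdx k).trans (R.mIdx_le_mNoise k)

theorem mAll_le_mCoin (R : Run D P η D.μ x₀) (k : ℕ) : R.mAll k ≤ R.mCoin (k + 1) :=
  (R.mAll_le_mNoise k).trans (R.mNoise_le_mCoin k)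

theorem Good.x_eq_stepX (h : R.Good) (k : ℕ) :
    R.x (k + 1) = fun ω => D.stepX (η (k + 1)) (R.idx (k + 1) ω) (R.v k ω) (R.anchor k ω)
      (R.anchorNoise k ω + R.freshNoise k ω) :=
  funext fun ω => by rw [h.x_succ, R.g_eq_ideal, R.y_eq_mix]; rfl

theorem Good.v_eq_vstep (h : R.Good) (k : ℕ) :
    R.v (k + 1) = fun ω => D.vstep (η (k + 1)) (R.v k ω)
      (D.mix (η (k + 1)) (R.v k ω) (R.anchor k ω)) (R.x (k + 1) ω) :=
  funext fun ω => by rw [h.v_succ, R.y_eq_mix]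

theorem shadow_succ (R : Run D P η D.μ x₀) (k : ℕ) :
    R.shadow (k + 1) = fun ω => if R.refresh (k + 1) ω then R.v (k + 1) ω
      else D.idealV (η (k + 1)) (R.idx (k + 1) ω) (R.shadow k ω) (R.anchor k ω) := rfl

theorem measurableSet_refresh (R : Run D P η D.μ x₀) (k : ℕ) (b : Bool) :
    MeasurableSet[R.mCoin (k + 1)] {ω | R.refresh (k + 1) ω = b} :=
  R.refresh_meas k (measurableSet_singleton b)

theorem measurable_freshNoise (R : Run D P η D.μ x₀) (k : ℕ) :
    Measurable[R.mNoise (k + 1)] (R.freshNoise k) :=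
  measurable_apply_index (Z := fun i ω => (1 / (D.q i * n)) • (R.ζ (k + 1) ω - R.ζ' (k + 1) ω))
    ((R.idx_meas k).mono (R.mIdx_le_mNoise k) le_rfl)
    fun i => (measurable_const_smul (1 / (D.q i * n))).comp ((R.ζ_meas k).sub (R.ζ'_meas k))

/-- The measurability of the state and of the next iterate, which determine each other and are
obtained together by induction. -/
theorem Good.measurable_state (h : R.Good) (k : ℕ) :
    Measurable[R.mCoin k] (R.v k) ∧ Measurable[R.mCoin k] (R.anchor k) ∧
      Measurable[R.mAll k] (R.anchorNoise k) ∧ Measurable[R.mNoise (k + 1)] (R.x (k + 1)) := by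
  -- the point `x (k + 1)` is measurable as soon as the state at time `k` is
  have hx : ∀ k, Measurable[R.mCoin k] (R.v k) → Measurable[R.mCoin k] (R.anchor k) →
      Measurable[R.mAll k] (R.anchorNoise k) → Measurable[R.mNoise (k + 1)] (R.x (k + 1)) := by
    intro k hv ha he
    have hle : R.mCoin k ≤ R.mNoise (k + 1) := (R.mCoin_le_mAll k).trans (R.mAll_le_mNoise k)
    have hv' := hv.mono hle le_rfl
    have ha' := ha.mono hle le_rfl
    have hm : Measurable[R.mNoise (k + 1)]
        (fun ω => R.anchorNoise k ω + R.freshNoise k ω) :=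
      (he.mono (R.mAll_le_mNoise k) le_rfl).add (R.measurable_freshNoise k)
    rw [h.x_eq_stepX k]
    exact measurable_apply_index (Z := fun i ω => D.stepX (η (k + 1)) i (R.v k ω) (R.anchor k ω)
      (R.anchorNoise k ω + R.freshNoise k ω))
      ((R.idx_meas k).mono (R.mIdx_le_mNoise k) le_rfl) fun i =>
      (h.adm.isLip_stepX h.proper (h.η_pos k) i IsLip.fst (IsLip.fst.comp IsLip.snd)
        (IsLip.snd.comp IsLip.snd)).measurable_comp
        (u := fun ω => (R.v k ω, R.anchor k ω, R.anchorNoise k ω + R.freshNoise k ω))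
        (hv'.prodMk (ha'.prodMk hm))
  suffices hs : Measurable[R.mCoin k] (R.v k) ∧ Measurable[R.mCoin k] (R.anchor k) ∧
      Measurable[R.mAll k] (R.anchorNoise k) from
    ⟨hs.1, hs.2.1, hs.2.2, hx k hs.1 hs.2.1 hs.2.2⟩
  have hξ : ∀ k, Measurable[R.mAll k] (fun ω => (1 / (n : ℝ)) • ∑ i, R.ξ k i ω) := fun k =>
    (measurable_const_smul (1 / (n : ℝ))).comp
      (Finset.measurable_fun_sum _ fun i _ => R.ξ_meas k i)
  induction k with
  | zero =>
    have h1 : R.v 0 = x₀ := funext R.v_zero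
    have h2 : R.anchor 0 = x₀ := funext R.anchor_zero
    have h3 : R.anchorNoise 0 = fun ω => (1 / (n : ℝ)) • ∑ i, R.ξ 0 i ω :=
      funext R.anchorNoise_zero
    rw [h1, h2, h3]
    exact ⟨R.x₀_meas, R.x₀_meas, hξ 0⟩
  | succ k ih =>
    obtain ⟨hv, ha, he⟩ := ih
    have hx' := (hx k hv ha he).mono (R.mNoise_le_mCoin k) le_rfl
    have hle : R.mCoin k ≤ R.mCoin (k + 1) := (R.mCoin_le_mAll k).trans (R.mAll_le_mCoin k)
    have hv' := hv.mono hle le_rfl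
    have ha' := ha.mono hle le_rfl
    refine ⟨?_, ?_, ?_⟩
    · rw [h.v_eq_vstep k]
      have hy := (D.isLip_mix (η (k + 1)) IsLip.fst IsLip.snd).measurable_comp
        (u := fun ω => (R.v k ω, R.anchor k ω)) (hv'.prodMk ha')
      exact (D.isLip_vstep (η (k + 1)) IsLip.fst (IsLip.fst.comp IsLip.snd)
        (IsLip.snd.comp IsLip.snd)).measurable_comp (u := fun ω =>
          (R.v k ω, D.mix (η (k + 1)) (R.v k ω) (R.anchor k ω), R.x (k + 1) ω))
        (hv'.prodMk (hy.prodMk hx'))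
    · have : R.anchor (k + 1) = fun ω => if R.refresh (k + 1) ω then R.x (k + 1) ω
          else R.anchor k ω := funext fun ω => R.anchor_succ k ω
      rw [this]
      exact measurable_ite_coin (R.refresh_meas k) hx' ha'
    · have : R.anchorNoise (k + 1) = fun ω => if R.refresh (k + 1) ω then
          (1 / (n : ℝ)) • ∑ i, R.ξ (k + 1) i ω else R.anchorNoise k ω :=
        funext fun ω => R.anchorNoise_succ k ω
      rw [this]
      exact measurable_ite_coin ((R.refresh_meas k).mono (R.mCoin_le_mAll _) le_rfl) (hξ (k + 1))
        (he.mono ((R.mAll_le_mCoin k).trans (R.mCoin_le_mAll _)) le_rfl)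

theorem Good.measurable_v (h : R.Good) (k : ℕ) : Measurable[R.mCoin k] (R.v k) :=
  (h.measurable_state k).1

theorem Good.measurable_anchor (h : R.Good) (k : ℕ) : Measurable[R.mCoin k] (R.anchor k) :=
  (h.measurable_state k).2.1

theorem Good.measurable_anchorNoise (h : R.Good) (k : ℕ) :
    Measurable[R.mAll k] (R.anchorNoise k) :=
  (h.measurable_state k).2.2.1

theorem Good.measurable_x (h : R.Good) (k : ℕ) : Measurable[R.mNoise (k + 1)] (R.x (k + 1)) :=
  (h.measurable_state k).2.2.2

theorem Good.measurable_y (h : R.Good) (k : ℕ) : Measurable[R.mCoin k] (R.y k) := by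
  have : R.y k = fun ω => D.mix (η (k + 1)) (R.v k ω) (R.anchor k ω) :=
    funext fun ω => R.y_eq_mix k ω
  rw [this]
  exact (D.isLip_mix _ IsLip.fst IsLip.snd).measurable_comp (u := fun ω => (R.v k ω, R.anchor k ω))
    ((h.measurable_v k).prodMk (h.measurable_anchor k))

theorem Good.measurable_shadow (h : R.Good) (k : ℕ) : Measurable[R.mCoin k] (R.shadow k) := by
  induction k with
  | zero => exact h.measurable_v 0
  | succ k ih =>
    have hle : R.mCoin k ≤ R.mCoin (k + 1) := (R.mCoin_le_mAll k).trans (R.mAll_le_mCoin k)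
    have hidx : Measurable[R.mCoin (k + 1)] (R.idx (k + 1)) :=
      (R.idx_meas k).mono ((R.mIdx_le_mNoise k).trans (R.mNoise_le_mCoin k)) le_rfl
    rw [R.shadow_succ]
    exact measurable_ite_coin (R.refresh_meas k) (h.measurable_v _)
      (measurable_apply_index
        (Z := fun i ω => D.idealV (η (k + 1)) i (R.shadow k ω) (R.anchor k ω)) hidx fun i =>
        (h.adm.isLip_idealV h.proper (h.η_pos k) i IsLip.fst IsLip.snd).measurable_comp
          (u := fun ω => (R.shadow k ω, R.anchor k ω))
          ((ih.mono hle le_rfl).prodMk ((h.measurable_anchor k).mono hle le_rfl)))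

theorem measurable_idx (R : Run D P η D.μ x₀) (k : ℕ) : Measurable (R.idx (k + 1)) :=
  (R.idx_meas k).mono (R.mIdx_le k) le_rfl

theorem measurable_refresh (R : Run D P η D.μ x₀) (k : ℕ) : Measurable (R.refresh (k + 1)) :=
  (R.refresh_meas k).mono (R.mCoin_le _) le_rfl

theorem memLp_freshNoise (R : Run D P η D.μ x₀) (k : ℕ) : MemLp (R.freshNoise k) 2 P :=
  memLp_apply_index (Z := fun i ω => (1 / (D.q i * n)) • (R.ζ (k + 1) ω - R.ζ' (k + 1) ω))
    (R.measurable_idx k) fun i => ((R.ζ_memLp k).sub (R.ζ'_memLp k)).const_smul (1 / (D.q i * n))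

/-- The error of sampling the component `i` at time `k`. -/
def sampleErr (R : Run D P η D.μ x₀) (k : ℕ) (i : Fin n) (ω : Ω) : Vec p :=
  (D.wgrad i (R.y k ω) - D.wgrad i (R.anchor k ω))
    - (D.gradAvg (R.y k ω) - D.gradAvg (R.anchor k ω))

theorem Good.measurable_sampleErr (h : R.Good) (k : ℕ) (i : Fin n) :
    Measurable[R.mAll k] (R.sampleErr k i) := by
  have hy := (h.measurable_y k).mono (R.mCoin_le_mAll k) le_rfl
  have ha := (h.measurable_anchor k).mono (R.mCoin_le_mAll k) le_rfl
  exact (((h.adm.isLip_wgrad i).measurable_comp hy).sub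
    ((h.adm.isLip_wgrad i).measurable_comp ha)).sub
    ((h.adm.isLip_gradAvg.measurable_comp hy).sub (h.adm.isLip_gradAvg.measurable_comp ha))

/-- The sampling error is centered. -/
theorem Good.sum_q_sampleErr (h : R.Good) (k : ℕ) (ω : Ω) :
    ∑ i, D.q i • R.sampleErr k i ω = 0 := by
  simp only [sampleErr, smul_sub, Finset.sum_sub_distrib, h.adm.sum_wgrad, ← Finset.sum_smul,
    h.adm.q_sum, one_smul, sub_self]

theorem memLp_average (R : Run D P η D.μ x₀) (k : ℕ) :
    MemLp (fun ω => (1 / (n : ℝ)) • ∑ i, R.ξ k i ω) 2 P :=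
  (memLp_finsetSum _ fun i _ => R.ξ_memLp k i).const_smul (1 / (n : ℝ))

theorem Good.measurable_sampleNoise (h : R.Good) (k : ℕ) :
    Measurable[R.mIdx (k + 1)] (R.sampleNoise k) :=
  measurable_apply_index (R.idx_meas k)
    fun i => (h.measurable_sampleErr k i).mono (R.mAll_le_mIdx k) le_rfl

variable [IsProbabilityMeasure P]

/-- The square integrability of the state and of the next iterate, by the same induction as
`Good.measurable_state`. -/
theorem Good.memLp_state (h : R.Good) (k : ℕ) :
    MemLp (R.v k) 2 P ∧ MemLp (R.anchor k) 2 P ∧ MemLp (R.anchorNoise k) 2 P ∧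
      MemLp (R.x (k + 1)) 2 P := by
  have hx : ∀ k, MemLp (R.v k) 2 P → MemLp (R.anchor k) 2 P → MemLp (R.anchorNoise k) 2 P →
      MemLp (R.x (k + 1)) 2 P := by
    intro k hv ha he
    rw [h.x_eq_stepX k]
    exact memLp_apply_index (Z := fun i ω => D.stepX (η (k + 1)) i (R.v k ω) (R.anchor k ω)
      (R.anchorNoise k ω + R.freshNoise k ω)) (R.measurable_idx k) fun i =>
      (h.adm.isLip_stepX h.proper (h.η_pos k) i IsLip.fst (IsLip.fst.comp IsLip.snd)
        (IsLip.snd.comp IsLip.snd)).memLp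
        (u := fun ω => (R.v k ω, R.anchor k ω, R.anchorNoise k ω + R.freshNoise k ω))
        (.of_fst_snd ⟨hv, .of_fst_snd ⟨ha, he.add (R.memLp_freshNoise k)⟩⟩)
  suffices hs : MemLp (R.v k) 2 P ∧ MemLp (R.anchor k) 2 P ∧ MemLp (R.anchorNoise k) 2 P from
    ⟨hs.1, hs.2.1, hs.2.2, hx k hs.1 hs.2.1 hs.2.2⟩
  have hξ : ∀ k, MemLp (fun ω => (1 / (n : ℝ)) • ∑ i, R.ξ k i ω) 2 P := fun k =>
    (memLp_finsetSum _ fun i _ => R.ξ_memLp k i).const_smul (1 / (n : ℝ))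
  induction k with
  | zero =>
    have h1 : R.v 0 = x₀ := funext R.v_zero
    have h2 : R.anchor 0 = x₀ := funext R.anchor_zero
    have h3 : R.anchorNoise 0 = fun ω => (1 / (n : ℝ)) • ∑ i, R.ξ 0 i ω :=
      funext R.anchorNoise_zero
    rw [h1, h2, h3]
    exact ⟨h.x₀_memLp, h.x₀_memLp, hξ 0⟩
  | succ k ih =>
    obtain ⟨hv, ha, he⟩ := ih
    have hx' := hx k hv ha he
    refine ⟨?_, ?_, ?_⟩
    · rw [h.v_eq_vstep k]
      exact (D.isLip_vstep (η (k + 1)) IsLip.fst (IsLip.fst.comp IsLip.snd)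
        (IsLip.snd.comp IsLip.snd)).memLp (u := fun ω =>
          (R.v k ω, D.mix (η (k + 1)) (R.v k ω) (R.anchor k ω), R.x (k + 1) ω))
        (.of_fst_snd ⟨hv, .of_fst_snd ⟨(D.isLip_mix _ IsLip.fst IsLip.snd).memLp
          (u := fun ω => (R.v k ω, R.anchor k ω)) (.of_fst_snd ⟨hv, ha⟩), hx'⟩⟩)
    · have : R.anchor (k + 1) = fun ω => if R.refresh (k + 1) ω then R.x (k + 1) ω
          else R.anchor k ω := funext fun ω => R.anchor_succ k ω
      rw [this]
      exact memLp_ite_coin (R.measurable_refresh k) hx' ha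
    · have : R.anchorNoise (k + 1) = fun ω => if R.refresh (k + 1) ω then
          (1 / (n : ℝ)) • ∑ i, R.ξ (k + 1) i ω else R.anchorNoise k ω :=
        funext fun ω => R.anchorNoise_succ k ω
      rw [this]
      exact memLp_ite_coin (R.measurable_refresh k) (hξ (k + 1)) he

theorem Good.memLp_v (h : R.Good) (k : ℕ) : MemLp (R.v k) 2 P := (h.memLp_state k).1

theorem Good.memLp_anchor (h : R.Good) (k : ℕ) : MemLp (R.anchor k) 2 P := (h.memLp_state k).2.1

theorem Good.memLp_anchorNoise (h : R.Good) (k : ℕ) : MemLp (R.anchorNoise k) 2 P :=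
  (h.memLp_state k).2.2.1

theorem Good.memLp_x (h : R.Good) (k : ℕ) : MemLp (R.x k) 2 P := by
  cases k with
  | zero =>
    have : R.x 0 = x₀ := funext R.x_zero
    rw [this]
    exact h.x₀_memLp
  | succ k => exact (h.memLp_state k).2.2.2

theorem Good.memLp_y (h : R.Good) (k : ℕ) : MemLp (R.y k) 2 P := by
  have : R.y k = fun ω => D.mix (η (k + 1)) (R.v k ω) (R.anchor k ω) :=
    funext fun ω => R.y_eq_mix k ω
  rw [this]
  exact (D.isLip_mix _ IsLip.fst IsLip.snd).memLp (u := fun ω => (R.v k ω, R.anchor k ω))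
    (.of_fst_snd ⟨h.memLp_v k, h.memLp_anchor k⟩)

theorem Good.memLp_shadow (h : R.Good) (k : ℕ) : MemLp (R.shadow k) 2 P := by
  induction k with
  | zero => exact h.memLp_v 0
  | succ k ih =>
    rw [R.shadow_succ]
    exact memLp_ite_coin (R.measurable_refresh k) (h.memLp_v _)
      (memLp_apply_index
        (Z := fun i ω => D.idealV (η (k + 1)) i (R.shadow k ω) (R.anchor k ω))
        (R.measurable_idx k) fun i =>
        (h.adm.isLip_idealV h.proper (h.η_pos k) i IsLip.fst IsLip.snd).memLp
          (u := fun ω => (R.shadow k ω, R.anchor k ω)) (.of_fst_snd ⟨ih, h.memLp_anchor k⟩))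

end Run

namespace Run

variable {n p : ℕ} {D : Problem n p} {Ω : Type*} [mΩ : MeasurableSpace Ω] {P : Measure Ω}
  {η : ℕ → ℝ} {x₀ : Ω → Vec p} {R : Run D P η D.μ x₀} [IsProbabilityMeasure P]

/-! ### Moments of the gradient errors -/

/-- The fresh perturbation is centered given the past and the drawn index. -/
theorem integral_inner_freshNoise (R : Run D P η D.μ x₀) (k : ℕ) {H : Ω → Vec p}
    (hHm : Measurable[R.mIdx (k + 1)] H) (hH : MemLp H 2 P) :
    ∫ ω, inner ℝ (R.freshNoise k ω) (H ω) ∂P = 0 := by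
  set H' : Ω → Vec p := fun ω => (1 / (D.q (R.idx (k + 1) ω) * n)) • H ω with hH'
  have hm' : StronglyMeasurable[R.mIdx (k + 1)] H' :=
    (measurable_apply_index (Z := fun i ω => (1 / (D.q i * n)) • H ω) (R.idx_meas k)
      fun i => (measurable_const_smul (1 / (D.q i * (n : ℝ)))).comp hHm).stronglyMeasurable
  have hL' : MemLp H' 2 P :=
    memLp_apply_index (Z := fun i ω => (1 / (D.q i * n)) • H ω) (R.measurable_idx k)
      fun i => hH.const_smul (1 / (D.q i * (n : ℝ)))
  have e : ∀ ω, inner ℝ (R.freshNoise k ω) (H ω)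
      = inner ℝ (R.ζ (k + 1) ω) (H' ω) - inner ℝ (R.ζ' (k + 1) ω) (H' ω) := by
    intro ω
    simp only [freshNoise, hH', inner_smul_left, inner_smul_right, inner_sub_left, conj_trivial]
    ring
  simp_rw [e]
  rw [integral_sub (integrable_inner_of_memLp (R.ζ_memLp k) hL')
    (integrable_inner_of_memLp (R.ζ'_memLp k) hL'),
    integral_inner_eq_zero_of_condExp (R.mIdx_le k) (R.ζ_memLp k) (R.ζ_mean k) hm' hL',
    integral_inner_eq_zero_of_condExp (R.mIdx_le k) (R.ζ'_memLp k) (R.ζ'_mean k) hm' hL', sub_zero]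

/-- The variance of the fresh perturbation. The importance weights `1 / (q_i n)` enter squared, and
averaging over the index turns one of the two factors into `1 / n`. -/
theorem Good.integral_sq_freshNoise_le (h : R.Good) (k : ℕ) :
    ∫ ω, ‖R.freshNoise k ω‖ ^ 2 ∂P ≤ 4 * D.rhoQ * D.σ ^ 2 := by
  have hn := h.adm.cast_pos
  have hζ := integrable_sq_norm_of_memLp (R.ζ_memLp k)
  have hζ' := integrable_sq_norm_of_memLp (R.ζ'_memLp k)
  have hsub := integrable_sq_norm_of_memLp ((R.ζ_memLp k).sub (R.ζ'_memLp k))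
  have e : ∀ ω, ‖R.freshNoise k ω‖ ^ 2
      = (1 / (D.q (R.idx (k + 1) ω) * n)) ^ 2 * ‖(R.ζ (k + 1) - R.ζ' (k + 1)) ω‖ ^ 2 := by
    intro ω
    simp only [freshNoise, Pi.sub_apply]
    rw [norm_smul, mul_pow, Real.norm_eq_abs, sq_abs]
  simp_rw [e]
  rw [integral_apply_index (R.measurable_idx k)
    (Z := fun i ω => (1 / (D.q i * n)) ^ 2 * ‖(R.ζ (k + 1) - R.ζ' (k + 1)) ω‖ ^ 2)
    fun i => hsub.const_mul _]
  have hterm : ∀ i, ∫ ω in {ω | R.idx (k + 1) ω = i},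
      (1 / (D.q i * n)) ^ 2 * ‖(R.ζ (k + 1) - R.ζ' (k + 1)) ω‖ ^ 2 ∂P
      ≤ 4 * D.σ ^ 2 * D.rhoQ * (1 / (n : ℝ)) := by
    intro i
    have hq := h.adm.q_pos i
    have hs : MeasurableSet[R.mIdx (k + 1)] {ω | R.idx (k + 1) ω = i} :=
      R.idx_meas k (measurableSet_singleton i)
    have hPs : P.real {ω | R.idx (k + 1) ω = i} = D.q i := by
      rw [measureReal_def, R.idx_law, ENNReal.toReal_ofReal hq.le]
    have h1 := setIntegral_le_of_condExp_le (R.mIdx_le k) hζ (R.ζ_var k) hs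
    have h2 := setIntegral_le_of_condExp_le (R.mIdx_le k) hζ' (R.ζ'_var k) hs
    rw [hPs] at h1 h2
    rw [integral_const_mul]
    have h3 : ∫ ω in {ω | R.idx (k + 1) ω = i}, ‖(R.ζ (k + 1) - R.ζ' (k + 1)) ω‖ ^ 2 ∂P
        ≤ ∫ ω in {ω | R.idx (k + 1) ω = i},
          (2 * ‖R.ζ (k + 1) ω‖ ^ 2 + 2 * ‖R.ζ' (k + 1) ω‖ ^ 2) ∂P := by
      refine integral_mono hsub.integrableOn
        ((hζ.const_mul 2).add (hζ'.const_mul 2)).integrableOn fun ω => ?_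
      simp only [Pi.sub_apply]
      nlinarith [norm_sub_sq_real (R.ζ (k + 1) ω) (R.ζ' (k + 1) ω),
        norm_add_sq_real (R.ζ (k + 1) ω) (R.ζ' (k + 1) ω),
        sq_nonneg ‖R.ζ (k + 1) ω + R.ζ' (k + 1) ω‖]
    rw [integral_add (hζ.const_mul 2).integrableOn (hζ'.const_mul 2).integrableOn,
      integral_const_mul, integral_const_mul] at h3
    have h4 : ∫ ω in {ω | R.idx (k + 1) ω = i}, ‖(R.ζ (k + 1) - R.ζ' (k + 1)) ω‖ ^ 2 ∂P
        ≤ 4 * D.σ ^ 2 * D.q i := by linarith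
    calc (1 / (D.q i * n)) ^ 2 * ∫ ω in {ω | R.idx (k + 1) ω = i},
          ‖(R.ζ (k + 1) - R.ζ' (k + 1)) ω‖ ^ 2 ∂P
        ≤ (1 / (D.q i * n)) ^ 2 * (4 * D.σ ^ 2 * D.q i) :=
          mul_le_mul_of_nonneg_left h4 (sq_nonneg _)
      _ = 4 * D.σ ^ 2 * (1 / (D.q i * n)) * (1 / n) := by field_simp
      _ ≤ 4 * D.σ ^ 2 * D.rhoQ * (1 / n) := by
          refine mul_le_mul_of_nonneg_right ?_ (by positivity)
          exact mul_le_mul_of_nonneg_left (h.adm.inv_q_le_rhoQ i) (by positivity)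
  refine (Finset.sum_le_sum fun i _ => hterm i).trans (le_of_eq ?_)
  rw [Finset.sum_const, Finset.card_univ, Fintype.card_fin, nsmul_eq_mul]
  field_simp

theorem Good.memLp_sampleErr (h : R.Good) (k : ℕ) (i : Fin n) :
    MemLp (R.sampleErr k i) 2 P :=
  (((h.adm.isLip_wgrad i).memLp (h.memLp_y k)).sub
    ((h.adm.isLip_wgrad i).memLp (h.memLp_anchor k))).sub
    ((h.adm.isLip_gradAvg.memLp (h.memLp_y k)).sub
      (h.adm.isLip_gradAvg.memLp (h.memLp_anchor k)))

theorem Good.memLp_sampleNoise (h : R.Good) (k : ℕ) : MemLp (R.sampleNoise k) 2 P :=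
  memLp_apply_index (R.measurable_idx k) (h.memLp_sampleErr k)

/-- The sampling error is centered given the past. -/
theorem Good.integral_inner_sampleNoise (h : R.Good) (k : ℕ) {H : Ω → Vec p}
    (hHm : Measurable[R.mAll k] H) (hH : MemLp H 2 P) :
    ∫ ω, inner ℝ (R.sampleNoise k ω) (H ω) ∂P = 0 := by
  have hint := fun i => integrable_inner_of_memLp (h.memLp_sampleErr k i) hH
  have e := integral_apply_index_of_indep (R.mAll_le k) (R.measurable_idx k) (R.idx_indep k)
    (fun i => (h.adm.q_pos i).le) (R.idx_law k)
    (Z := fun i ω => inner ℝ (R.sampleErr k i ω) (H ω))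
    (fun i => (h.measurable_sampleErr k i).stronglyMeasurable.inner hHm.stronglyMeasurable) hint
  refine e.trans ?_
  simp_rw [smul_eq_mul, ← integral_const_mul]
  rw [← integral_finsetSum _ fun i _ => (hint i).const_mul _]
  refine (integral_congr_ae (Filter.Eventually.of_forall fun ω => ?_)).trans (integral_zero _ _)
  have := congrArg (fun t => inner ℝ t (H ω)) (h.sum_q_sampleErr k ω)
  simpa [sum_inner, inner_smul_left] using this

theorem Good.integrable_breg (h : R.Good) (k : ℕ) :
    Integrable (fun ω => D.breg (R.anchor k ω) (R.y k ω)) P := by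
  have hd := integrable_sq_norm_of_memLp ((h.memLp_anchor k).sub (h.memLp_y k))
  have ha := (h.measurable_anchor k).mono (R.mCoin_le k) le_rfl
  have hy := (h.measurable_y k).mono (R.mCoin_le k) le_rfl
  have hc := h.adm.differentiable_avg.continuous.measurable
  refine (hd.const_mul (D.LQ / 2)).mono' ?_ (Filter.Eventually.of_forall fun ω => ?_)
  · exact (((hc.comp ha).sub (hc.comp hy)).sub
      ((h.adm.isLip_gradAvg.measurable_comp hy).inner (ha.sub hy))).aestronglyMeasurable
  · rw [Real.norm_eq_abs, abs_of_nonneg (h.adm.breg_nonneg _ _)]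
    exact h.adm.breg_le _ _

/-- Variance of the sampled gradient. -/
theorem Good.integral_sq_sampleNoise_le (h : R.Good) (k : ℕ) :
    ∫ ω, ‖R.sampleNoise k ω‖ ^ 2 ∂P
      ≤ 2 * D.LQ * ∫ ω, D.breg (R.anchor k ω) (R.y k ω) ∂P := by
  have hint := fun i => integrable_sq_norm_of_memLp (h.memLp_sampleErr k i)
  have e := integral_apply_index_of_indep (R.mAll_le k) (R.measurable_idx k) (R.idx_indep k)
    (fun i => (h.adm.q_pos i).le) (R.idx_law k)
    (Z := fun i ω => ‖R.sampleErr k i ω‖ ^ 2)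
    (fun i => (measurable_sq_norm (h.measurable_sampleErr k i)).stronglyMeasurable) hint
  refine e.le.trans ?_
  simp_rw [smul_eq_mul, ← integral_const_mul]
  rw [← integral_finsetSum _ fun i _ => (hint i).const_mul _]
  refine integral_mono (integrable_finsetSum _ fun i _ => (hint i).const_mul _)
    ((h.integrable_breg k).const_mul _) fun ω => ?_
  refine le_trans ?_ (h.adm.sum_sq_wgrad_sub_le (R.y k ω) (R.anchor k ω))
  -- the variance is at most the second moment
  set w : Fin n → Vec p := fun i => D.wgrad i (R.y k ω) - D.wgrad i (R.anchor k ω) with hw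
  set wb : Vec p := D.gradAvg (R.y k ω) - D.gradAvg (R.anchor k ω) with hwb
  have hmean : ∑ i, D.q i • w i = wb := by
    simp only [hw, smul_sub, Finset.sum_sub_distrib, h.adm.sum_wgrad, hwb]
  have h1 : ∑ i, D.q i * ‖w i - wb‖ ^ 2 = ∑ i, D.q i * ‖w i‖ ^ 2 - ‖wb‖ ^ 2 := by
    have h2 : ∑ i, D.q i * inner ℝ (w i) wb = ‖wb‖ ^ 2 := by
      rw [← real_inner_self_eq_norm_sq]
      nth_rewrite 2 [← hmean]
      rw [sum_inner]
      exact Finset.sum_congr rfl fun i _ => by rw [inner_smul_left, conj_trivial]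
    have h3 : ∀ i, D.q i * ‖w i - wb‖ ^ 2
        = D.q i * ‖w i‖ ^ 2 - 2 * (D.q i * inner ℝ (w i) wb) + D.q i * ‖wb‖ ^ 2 := fun i => by
      rw [norm_sub_sq_real]; ring
    simp_rw [h3]
    rw [Finset.sum_add_distrib, Finset.sum_sub_distrib, ← Finset.mul_sum, h2, ← Finset.sum_mul,
      h.adm.q_sum]
    ring
  change ∑ i, D.q i * ‖w i - wb‖ ^ 2 ≤ ∑ i, D.q i * ‖w i‖ ^ 2
  rw [h1]
  linarith [sq_nonneg ‖wb‖]

theorem Good.integral_sq_error_le (h : R.Good) (k : ℕ) :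
    ∫ ω, ‖R.sampleNoise k ω + R.freshNoise k ω‖ ^ 2 ∂P
      ≤ 2 * D.LQ * ∫ ω, D.breg (R.anchor k ω) (R.y k ω) ∂P + 4 * D.rhoQ * D.σ ^ 2 := by
  have h0 := R.integral_inner_freshNoise k (h.measurable_sampleNoise k)
    (h.memLp_sampleNoise k)
  have h1 := h.integral_sq_sampleNoise_le k
  have h2 := h.integral_sq_freshNoise_le k
  have i1 := integrable_sq_norm_of_memLp (h.memLp_sampleNoise k)
  have i2 := integrable_sq_norm_of_memLp (R.memLp_freshNoise k)
  have i3 := integrable_inner_of_memLp (R.memLp_freshNoise k) (h.memLp_sampleNoise k)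
  have e : ∀ ω, ‖R.sampleNoise k ω + R.freshNoise k ω‖ ^ 2 = ‖R.sampleNoise k ω‖ ^ 2
      + (2 * inner ℝ (R.freshNoise k ω) (R.sampleNoise k ω) + ‖R.freshNoise k ω‖ ^ 2) := fun ω => by
    rw [norm_add_sq_real, real_inner_comm]; ring
  simp_rw [e]
  have h3 : ∫ ω, (‖R.sampleNoise k ω‖ ^ 2
      + (2 * inner ℝ (R.freshNoise k ω) (R.sampleNoise k ω) + ‖R.freshNoise k ω‖ ^ 2)) ∂P = _ :=
    integral_add i1 ((i3.const_mul 2).add i2)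
  rw [h3, integral_add (i3.const_mul 2) i2, integral_const_mul, h0]
  linarith

/-- Variance of the average of the perturbations at an anchor, on an event of the past. -/
theorem setIntegral_sq_average_le (R : Run D P η D.μ x₀) (hD : D.Admissible) (k : ℕ) {s : Set Ω}
    (hs : MeasurableSet[R.mCoin k] s) :
    ∫ ω in s, ‖(1 / (n : ℝ)) • ∑ i, R.ξ k i ω‖ ^ 2 ∂P ≤ D.σ ^ 2 / n * P.real s := by
  have hn := hD.cast_pos
  have hint : ∀ i j, Integrable (fun ω => inner ℝ (R.ξ k i ω) (R.ξ k j ω)) P := fun i j =>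
    integrable_inner_of_memLp (R.ξ_memLp k i) (R.ξ_memLp k j)
  have e : ∀ ω, ‖(1 / (n : ℝ)) • ∑ i, R.ξ k i ω‖ ^ 2
      = (1 / (n : ℝ)) ^ 2 * ∑ i, ∑ j, inner ℝ (R.ξ k i ω) (R.ξ k j ω) := fun ω => by
    rw [norm_smul, mul_pow, Real.norm_eq_abs, sq_abs, ← real_inner_self_eq_norm_sq, sum_inner]
    simp_rw [inner_sum]
  simp_rw [e]
  rw [integral_const_mul, integral_finsetSum _ fun i _ =>
    (integrable_finsetSum _ fun j _ => hint i j).integrableOn]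
  have hrow : ∀ i, ∫ ω in s, ∑ j, inner ℝ (R.ξ k i ω) (R.ξ k j ω) ∂P ≤ D.σ ^ 2 * P.real s := by
    intro i
    rw [integral_finsetSum _ fun j _ => (hint i j).integrableOn, Finset.sum_eq_single i]
    · simp_rw [real_inner_self_eq_norm_sq]
      exact setIntegral_le_of_condExp_le (R.mCoin_le k)
        (integrable_sq_norm_of_memLp (R.ξ_memLp k i)) (R.ξ_var k i) hs
    · intro j _ hj
      exact setIntegral_eq_zero_of_condExp (R.mCoin_le k) (hint i j)
        (R.ξ_uncorr k i j hj.symm) hs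
    · simp
  refine (mul_le_mul_of_nonneg_left (Finset.sum_le_sum fun i _ => hrow i)
    (sq_nonneg _)).trans (le_of_eq ?_)
  rw [Finset.sum_const, Finset.card_univ, Fintype.card_fin, nsmul_eq_mul]
  field_simp

theorem measureReal_refresh (R : Run D P η D.μ x₀) (k : ℕ) :
    P.real {ω | R.refresh (k + 1) ω = true} = 1 / (n : ℝ) :=
  (measureReal_coin (R.measurable_refresh k) (by positivity) (R.refresh_law k)).1

theorem setIntegral_no_refresh (R : Run D P η D.μ x₀) (k : ℕ) {W : Ω → ℝ}
    (hWm : Measurable[R.mNoise (k + 1)] W) (hW : Integrable W P) :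
    ∫ ω in {ω | R.refresh (k + 1) ω = false}, W ω ∂P = (1 - 1 / (n : ℝ)) * ∫ ω, W ω ∂P :=
  setIntegral_coin_false (R.mNoise_le k) (R.measurable_refresh k) (R.refresh_indep k)
    (by positivity) (R.refresh_law k) hWm.stronglyMeasurable hW

theorem setIntegral_refresh (R : Run D P η D.μ x₀) (k : ℕ) {W : Ω → ℝ}
    (hWm : Measurable[R.mNoise (k + 1)] W) (hW : Integrable W P) :
    ∫ ω in {ω | R.refresh (k + 1) ω = true}, W ω ∂P = 1 / (n : ℝ) * ∫ ω, W ω ∂P :=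
  setIntegral_coin_true (R.mNoise_le k) (R.measurable_refresh k) (R.refresh_indep k)
    (by positivity) (R.refresh_law k) hWm.stronglyMeasurable hW

/-- The stored gradient averages `n` uncorrelated perturbations, which divides the variance by
`n`. -/
theorem Good.integral_sq_anchorNoise_le (h : R.Good) (k : ℕ) :
    ∫ ω, ‖R.anchorNoise k ω‖ ^ 2 ∂P ≤ D.σ ^ 2 / n := by
  induction k with
  | zero =>
    simp_rw [R.anchorNoise_zero]
    simpa using R.setIntegral_sq_average_le h.adm 0 MeasurableSet.univ
  | succ k ih =>
    have e : ∀ ω, ‖R.anchorNoise (k + 1) ω‖ ^ 2 = if R.refresh (k + 1) ω then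
        ‖(1 / (n : ℝ)) • ∑ i, R.ξ (k + 1) i ω‖ ^ 2 else ‖R.anchorNoise k ω‖ ^ 2 := fun ω => by
      rw [R.anchorNoise_succ]; split_ifs <;> rfl
    simp_rw [e]
    have i1 := integrable_sq_norm_of_memLp (R.memLp_average (k + 1))
    have i2 := integrable_sq_norm_of_memLp (h.memLp_anchorNoise k)
    rw [integral_ite_coin (R.measurable_refresh k) i1 i2, R.setIntegral_no_refresh k
      (measurable_sq_norm ((h.measurable_anchorNoise k).mono (R.mAll_le_mNoise k) le_rfl)) i2]
    have h1 := R.setIntegral_sq_average_le h.adm (k + 1) (R.measurableSet_refresh k true)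
    rw [R.measureReal_refresh] at h1
    have hn := h.adm.one_le_cast
    have h2 : (0 : ℝ) ≤ 1 - 1 / n := by
      rw [sub_nonneg, div_le_one (by linarith)]; exact hn
    have h3 := mul_le_mul_of_nonneg_left ih h2
    linarith

/-! ### Decoupling of the anchor perturbation from the shadow -/

/-- The perturbation of the stored gradient is uncorrelated with every Lipschitz function of the
shadow and the anchor: since the last update of the anchor, the shadow has only used sampled
components, which are independent of that perturbation. -/
theorem Good.integral_inner_anchorNoise (h : R.Good) (k : ℕ) {H : Vec p × Vec p → Vec p}
    (hH : IsLip H) :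
    ∫ ω, inner ℝ (R.anchorNoise k ω) (H (R.shadow k ω, R.anchor k ω)) ∂P = 0 := by
  -- the new perturbation at an anchor is centered given the information at the update
  have hnew : ∀ k {Z : Ω → Vec p}, Measurable[R.mCoin k] Z → MemLp Z 2 P →
      ∫ ω, inner ℝ ((1 / (n : ℝ)) • ∑ i, R.ξ k i ω) (Z ω) ∂P = 0 := by
    intro k Z hZm hZ
    simp_rw [inner_smul_left, sum_inner]
    rw [integral_const_mul, integral_finsetSum _ fun i _ =>
      integrable_inner_of_memLp (R.ξ_memLp k i) hZ, Finset.sum_eq_zero fun i _ =>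
      integral_inner_eq_zero_of_condExp (R.mCoin_le k) (R.ξ_memLp k i) (R.ξ_mean k i)
        hZm.stronglyMeasurable hZ, mul_zero]
  have hpair : ∀ k, MemLp (fun ω => (R.shadow k ω, R.anchor k ω)) 2 P := fun k =>
    .of_fst_snd ⟨h.memLp_shadow k, h.memLp_anchor k⟩
  have hpairm : ∀ k, Measurable[R.mCoin k] (fun ω => (R.shadow k ω, R.anchor k ω)) := fun k =>
    (h.measurable_shadow k).prodMk (h.measurable_anchor k)
  induction k generalizing H with
  | zero =>
    simp_rw [R.anchorNoise_zero]
    exact hnew 0 (hH.measurable_comp (hpairm 0)) (hH.memLp (hpair 0))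
  | succ k ih =>
    set Hi : Fin n → Vec p × Vec p → Vec p :=
      fun i s => H (D.idealV (η (k + 1)) i s.1 s.2, s.2) with hHi
    have hHil : ∀ i, IsLip (Hi i) := fun i =>
      hH.comp ((h.adm.isLip_idealV h.proper (h.η_pos k) i IsLip.fst IsLip.snd).prodMk IsLip.snd)
    have hstep : ∀ ω, inner ℝ (R.anchorNoise (k + 1) ω)
        (H (R.shadow (k + 1) ω, R.anchor (k + 1) ω)) = if R.refresh (k + 1) ω then
          inner ℝ ((1 / (n : ℝ)) • ∑ i, R.ξ (k + 1) i ω)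
            (H (R.shadow (k + 1) ω, R.anchor (k + 1) ω))
        else inner ℝ (R.anchorNoise k ω)
          (Hi (R.idx (k + 1) ω) (R.shadow k ω, R.anchor k ω)) := fun ω => by
      by_cases hc : R.refresh (k + 1) ω = true
      · rw [R.anchorNoise_succ, if_pos hc, if_pos hc]
      · have hsh : R.shadow (k + 1) ω = D.idealV (η (k + 1)) (R.idx (k + 1) ω) (R.shadow k ω)
            (R.anchor k ω) := if_neg hc
        rw [R.anchorNoise_succ, R.anchor_succ, hsh, if_neg hc, if_neg hc, if_neg hc]
    have i1 := integrable_inner_of_memLp (R.memLp_average (k + 1)) (hH.memLp (hpair (k + 1)))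
    have i2 : ∀ i, Integrable (fun ω => inner ℝ (R.anchorNoise k ω)
        (Hi i (R.shadow k ω, R.anchor k ω))) P := fun i =>
      integrable_inner_of_memLp (h.memLp_anchorNoise k) ((hHil i).memLp (hpair k))
    have hle : R.mCoin k ≤ R.mAll k := R.mCoin_le_mAll k
    have hm2 : ∀ i, Measurable[R.mAll k] (fun ω => inner ℝ (R.anchorNoise k ω)
        (Hi i (R.shadow k ω, R.anchor k ω))) := fun i =>
      (h.measurable_anchorNoise k).inner
        ((hHil i).measurable_comp ((hpairm k).mono hle le_rfl))
    have i3 := integrable_apply_index (R.measurable_idx k) i2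
    have hm3 : Measurable[R.mNoise (k + 1)] (fun ω => inner ℝ (R.anchorNoise k ω)
        (Hi (R.idx (k + 1) ω) (R.shadow k ω, R.anchor k ω))) :=
      measurable_apply_index ((R.idx_meas k).mono (R.mIdx_le_mNoise k) le_rfl)
        fun i => (hm2 i).mono (R.mAll_le_mNoise k) le_rfl
    simp_rw [hstep]
    rw [integral_ite_coin (R.measurable_refresh k) i1 i3, R.setIntegral_no_refresh k hm3 i3,
      integral_apply_index_of_indep (R.mAll_le k) (R.measurable_idx k) (R.idx_indep k)
        (fun i => (h.adm.q_pos i).le) (R.idx_law k) (fun i => (hm2 i).stronglyMeasurable) i2,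
      Finset.sum_eq_zero fun i _ => by rw [ih (hHil i), smul_zero], mul_zero, add_zero]
    -- on the event of an update, the integrand is the new perturbation against the past
    have hs := R.measurableSet_refresh k true
    rw [← integral_indicator (R.mCoin_le _ _ hs)]
    have e : ∀ ω, Set.indicator {ω | R.refresh (k + 1) ω = true}
        (fun ω => inner ℝ ((1 / (n : ℝ)) • ∑ i, R.ξ (k + 1) i ω)
          (H (R.shadow (k + 1) ω, R.anchor (k + 1) ω))) ω
        = inner ℝ ((1 / (n : ℝ)) • ∑ i, R.ξ (k + 1) i ω)
          (Set.indicator {ω | R.refresh (k + 1) ω = true}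
            (fun ω => H (R.shadow (k + 1) ω, R.anchor (k + 1) ω)) ω) := fun ω => by
      by_cases hω : ω ∈ {ω | R.refresh (k + 1) ω = true}
      · rw [Set.indicator_of_mem hω, Set.indicator_of_mem hω]
      · rw [Set.indicator_of_notMem hω, Set.indicator_of_notMem hω, inner_zero_right]
    simp_rw [e]
    exact hnew (k + 1) ((hH.measurable_comp (hpairm (k + 1))).indicator hs)
      ((hH.memLp (hpair (k + 1))).indicator (R.mCoin_le _ _ hs))

end Run

namespace Run

variable {n p : ℕ} {D : Problem n p} {Ω : Type*} [mΩ : MeasurableSpace Ω] {P : Measure Ω}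
  {η : ℕ → ℝ} {x₀ : Ω → Vec p} {R : Run D P η D.μ x₀}

/-! ### The distance to the shadow -/

/-- The proximal point of the step without the fresh perturbation, but with the perturbation at the
anchor. -/
def cleanX (R : Run D P η D.μ x₀) (k : ℕ) (ω : Ω) : Vec p :=
  D.stepX (η (k + 1)) (R.idx (k + 1) ω) (R.v k ω) (R.anchor k ω) (R.anchorNoise k ω)

/-- The proximal point of the noiseless step from the shadow. -/
def shadowX (R : Run D P η D.μ x₀) (k : ℕ) (ω : Ω) : Vec p :=
  D.idealX (η (k + 1)) (R.idx (k + 1) ω) (R.shadow k ω) (R.anchor k ω)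

/-- The new value of `v` in the noiseless step from the shadow. -/
def shadowV (R : Run D P η D.μ x₀) (k : ℕ) (ω : Ω) : Vec p :=
  D.idealV (η (k + 1)) (R.idx (k + 1) ω) (R.shadow k ω) (R.anchor k ω)

/-- The step of the run, with the gradient written as the noiseless one plus a perturbation. -/
theorem isProx_x (R : Run D P η D.μ x₀) (k : ℕ) (ω : Ω) :
    IsProx (η (k + 1)) D.ψ (D.mix (η (k + 1)) (R.v k ω) (R.anchor k ω)
      - η (k + 1) • (D.wgrad (R.idx (k + 1) ω) (D.mix (η (k + 1)) (R.v k ω) (R.anchor k ω))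
        - D.wgrad (R.idx (k + 1) ω) (R.anchor k ω) + D.gradAvg (R.anchor k ω)
        + (R.anchorNoise k ω + R.freshNoise k ω))) (R.x (k + 1) ω) := by
  have := R.x_succ k ω
  rwa [R.g_eq_ideal, R.y_eq_mix] at this

theorem Good.measurable_v_noise (h : R.Good) (k : ℕ) :
    Measurable[R.mNoise (k + 1)] (R.v (k + 1)) := by
  have hle : R.mCoin k ≤ R.mNoise (k + 1) := (R.mCoin_le_mAll k).trans (R.mAll_le_mNoise k)
  have hv := (h.measurable_v k).mono hle le_rfl
  have ha := (h.measurable_anchor k).mono hle le_rfl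
  have hy := (D.isLip_mix (η (k + 1)) IsLip.fst IsLip.snd).measurable_comp
    (u := fun ω => (R.v k ω, R.anchor k ω)) (hv.prodMk ha)
  rw [h.v_eq_vstep k]
  exact (D.isLip_vstep (η (k + 1)) IsLip.fst (IsLip.fst.comp IsLip.snd)
    (IsLip.snd.comp IsLip.snd)).measurable_comp (u := fun ω =>
      (R.v k ω, D.mix (η (k + 1)) (R.v k ω) (R.anchor k ω), R.x (k + 1) ω))
    (hv.prodMk (hy.prodMk (h.measurable_x k)))

theorem Good.measurable_pair (h : R.Good) (k : ℕ) :
    Measurable[R.mAll k] (fun ω => (R.shadow k ω, R.anchor k ω)) :=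
  ((h.measurable_shadow k).prodMk (h.measurable_anchor k)).mono (R.mCoin_le_mAll k) le_rfl

theorem Good.measurable_shadowX (h : R.Good) (k : ℕ) :
    Measurable[R.mIdx (k + 1)] (R.shadowX k) :=
  measurable_apply_index
    (Z := fun i ω => D.idealX (η (k + 1)) i (R.shadow k ω) (R.anchor k ω)) (R.idx_meas k)
    fun i => (h.adm.isLip_idealX h.proper (h.η_pos k) i IsLip.fst IsLip.snd).measurable_comp
      (u := fun ω => (R.shadow k ω, R.anchor k ω))
      ((h.measurable_pair k).mono (R.mAll_le_mIdx k) le_rfl)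

theorem Good.measurable_shadowV (h : R.Good) (k : ℕ) :
    Measurable[R.mIdx (k + 1)] (R.shadowV k) :=
  measurable_apply_index
    (Z := fun i ω => D.idealV (η (k + 1)) i (R.shadow k ω) (R.anchor k ω)) (R.idx_meas k)
    fun i => (h.adm.isLip_idealV h.proper (h.η_pos k) i IsLip.fst IsLip.snd).measurable_comp
      (u := fun ω => (R.shadow k ω, R.anchor k ω))
      ((h.measurable_pair k).mono (R.mAll_le_mIdx k) le_rfl)

theorem Good.measurable_cleanX (h : R.Good) (k : ℕ) :
    Measurable[R.mIdx (k + 1)] (R.cleanX k) :=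
  measurable_apply_index (Z := fun i ω => D.stepX (η (k + 1)) i (R.v k ω) (R.anchor k ω)
    (R.anchorNoise k ω)) (R.idx_meas k) fun i =>
    ((h.adm.isLip_stepX h.proper (h.η_pos k) i IsLip.fst (IsLip.fst.comp IsLip.snd)
      (IsLip.snd.comp IsLip.snd)).measurable_comp
      (u := fun ω => (R.v k ω, R.anchor k ω, R.anchorNoise k ω))
      (((h.measurable_v k).mono (R.mCoin_le_mAll k) le_rfl).prodMk
        (((h.measurable_anchor k).mono (R.mCoin_le_mAll k) le_rfl).prodMk
          (h.measurable_anchorNoise k)))).mono (R.mAll_le_mIdx k) le_rfl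

theorem Good.norm_x_sub_cleanX_le (h : R.Good) (k : ℕ) (ω : Ω) :
    ‖R.x (k + 1) ω - R.cleanX k ω‖ ≤ η (k + 1) * ‖R.freshNoise k ω‖ := by
  have h1 := h.adm.norm_sub_le_of_isProx h.proper (h.η_pos k) (R.isProx_x k ω)
    (h.adm.isProx_prox h.proper (h.η_pos k)
      (D.mix (η (k + 1)) (R.v k ω) (R.anchor k ω)
      - η (k + 1) • (D.wgrad (R.idx (k + 1) ω) (D.mix (η (k + 1)) (R.v k ω) (R.anchor k ω))
        - D.wgrad (R.idx (k + 1) ω) (R.anchor k ω) + D.gradAvg (R.anchor k ω)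
        + R.anchorNoise k ω)))
  refine h1.trans (le_of_eq ?_)
  rw [show ∀ a b c d : Vec p, (a - η (k + 1) • (b + (c + d))) - (a - η (k + 1) • (b + c))
    = -(η (k + 1) • d) from fun a b c d => by module, norm_neg, norm_smul, Real.norm_eq_abs,
    abs_of_pos (h.η_pos k)]

/-- Growth of the distance to the shadow in one step, pathwise. The inner product with the fresh
perturbation is centered. -/
theorem Good.sq_norm_sub_shadowV_le (h : R.Good) (k : ℕ) (ω : Ω) :
    D.theta (η (k + 1)) ^ 2 * ‖R.v (k + 1) ω - R.shadowV k ω‖ ^ 2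
      ≤ (1 + 1 / (4 * n)) * D.theta (η (k + 1)) ^ 2 * ‖R.v k ω - R.shadow k ω‖ ^ 2
        + (10 + 100 / 9 * n) * η (k + 1) ^ 2 * ‖R.anchorNoise k ω‖ ^ 2
        + 10 / 3 * η (k + 1) ^ 2 * ‖R.freshNoise k ω‖ ^ 2
        - 10 / 3 * η (k + 1) * inner ℝ (R.freshNoise k ω) (R.cleanX k ω - R.shadowX k ω) := by
  have hn := h.adm.cast_pos
  have hη := h.η_pos k
  have hθ := h.adm.theta_pos hη (h.η_le k)
  have key := h.adm.vstep_sub_idealV_le h.proper hη (h.η_le k) (V := R.shadow k ω)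
    (R.isProx_x k ω)
  rw [← R.y_eq_mix, ← h.v_succ] at key
  have hc := h.norm_x_sub_cleanX_le k ω
  change D.theta (η (k + 1)) ^ 2 * ‖R.v (k + 1) ω - R.shadowV k ω‖ ^ 2
    ≤ D.theta (η (k + 1)) ^ 2 * ‖R.v k ω - R.shadow k ω‖ ^ 2
      - 5 / 18 * ‖(R.x (k + 1) ω - R.shadowX k ω)
        - D.theta (η (k + 1)) • (R.v k ω - R.shadow k ω)‖ ^ 2
      - 10 / 3 * η (k + 1) * inner ℝ (R.x (k + 1) ω - R.shadowX k ω)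
        (R.anchorNoise k ω + R.freshNoise k ω) at key
  set t := η (k + 1)
  set θ := D.theta t
  set e := R.anchorNoise k ω
  set ν := R.freshNoise k ω
  set d := R.v k ω - R.shadow k ω
  set X := R.shadowX k ω
  set x := R.x (k + 1) ω
  set xc := R.cleanX k ω
  -- the anchor perturbation: the part along `θ d` is not centered and is split by Young's
  -- inequality with weight `1 / (4 n)`
  have h1 : -(10 / 3 * t * inner ℝ (x - X) e) ≤ 5 / 18 * ‖(x - X) - θ • d‖ ^ 2
      + 10 * t ^ 2 * ‖e‖ ^ 2 + 10 / 3 * t * (θ * ‖d‖ * ‖e‖) := by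
    have e1 : inner ℝ (x - X) e = inner ℝ ((x - X) - θ • d) e + θ * inner ℝ d e := by
      rw [← real_inner_smul_left, ← inner_add_left, sub_add_cancel]
    have h2 := neg_le_of_abs_le (abs_real_inner_le_norm ((x - X) - θ • d) e)
    have h3 := neg_le_of_abs_le (abs_real_inner_le_norm d e)
    have h4 := mul_le_mul_of_nonneg_left h3 hθ.le
    have h5 : 0 ≤ 5 / 18 * (‖(x - X) - θ • d‖ - 6 * t * ‖e‖) ^ 2 := by positivity
    rw [e1]
    nlinarith
  have h2 : 10 / 3 * t * (θ * ‖d‖ * ‖e‖)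
      ≤ 1 / (4 * n) * θ ^ 2 * ‖d‖ ^ 2 + 100 / 9 * n * t ^ 2 * ‖e‖ ^ 2 := by
    have e1 : 1 / (4 * n) * θ ^ 2 * ‖d‖ ^ 2 + 100 / 9 * n * t ^ 2 * ‖e‖ ^ 2
        - 10 / 3 * t * (θ * ‖d‖ * ‖e‖)
        = (θ * ‖d‖ - 20 / 3 * n * t * ‖e‖) ^ 2 / (4 * n) := by field_simp; ring
    have : 0 ≤ (θ * ‖d‖ - 20 / 3 * n * t * ‖e‖) ^ 2 / (4 * n) := by positivity
    linarith
  -- the fresh perturbation: `x` is replaced by `cleanX`, which does not depend on it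
  have h3 : -(10 / 3 * t * inner ℝ (x - X) ν) ≤ 10 / 3 * t ^ 2 * ‖ν‖ ^ 2
      - 10 / 3 * t * inner ℝ ν (xc - X) := by
    have e1 : inner ℝ (x - X) ν = inner ℝ (x - xc) ν + inner ℝ ν (xc - X) := by
      rw [real_inner_comm (xc - X) ν, ← inner_add_left, sub_add_sub_cancel]
    have h4 := neg_le_of_abs_le (abs_real_inner_le_norm (x - xc) ν)
    have h5 := mul_le_mul_of_nonneg_right hc (norm_nonneg ν)
    rw [e1]
    nlinarith
  rw [inner_add_right] at key
  linarith

/-- The mean squared distance to the shadow. -/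
def shadowErr (R : Run D P η D.μ x₀) (k : ℕ) : ℝ := ∫ ω, ‖R.v k ω - R.shadow k ω‖ ^ 2 ∂P

theorem shadowErr_zero (R : Run D P η D.μ x₀) : R.shadowErr 0 = 0 := by
  simp [shadowErr, shadow]

variable [IsProbabilityMeasure P]

theorem Good.memLp_pair (h : R.Good) (k : ℕ) :
    MemLp (fun ω => (R.shadow k ω, R.anchor k ω)) 2 P :=
  .of_fst_snd ⟨h.memLp_shadow k, h.memLp_anchor k⟩

theorem Good.memLp_shadowX (h : R.Good) (k : ℕ) : MemLp (R.shadowX k) 2 P :=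
  memLp_apply_index
    (Z := fun i ω => D.idealX (η (k + 1)) i (R.shadow k ω) (R.anchor k ω)) (R.measurable_idx k)
    fun i => (h.adm.isLip_idealX h.proper (h.η_pos k) i IsLip.fst IsLip.snd).memLp
      (u := fun ω => (R.shadow k ω, R.anchor k ω)) (h.memLp_pair k)

theorem Good.memLp_shadowV (h : R.Good) (k : ℕ) : MemLp (R.shadowV k) 2 P :=
  memLp_apply_index
    (Z := fun i ω => D.idealV (η (k + 1)) i (R.shadow k ω) (R.anchor k ω)) (R.measurable_idx k)
    fun i => (h.adm.isLip_idealV h.proper (h.η_pos k) i IsLip.fst IsLip.snd).memLp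
      (u := fun ω => (R.shadow k ω, R.anchor k ω)) (h.memLp_pair k)

theorem Good.memLp_cleanX (h : R.Good) (k : ℕ) : MemLp (R.cleanX k) 2 P :=
  memLp_apply_index (Z := fun i ω => D.stepX (η (k + 1)) i (R.v k ω) (R.anchor k ω)
    (R.anchorNoise k ω)) (R.measurable_idx k) fun i =>
    (h.adm.isLip_stepX h.proper (h.η_pos k) i IsLip.fst (IsLip.fst.comp IsLip.snd)
      (IsLip.snd.comp IsLip.snd)).memLp
      (u := fun ω => (R.v k ω, R.anchor k ω, R.anchorNoise k ω))
      (.of_fst_snd ⟨h.memLp_v k, .of_fst_snd ⟨h.memLp_anchor k, h.memLp_anchorNoise k⟩⟩)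

/-- Growth of the distance to the shadow in one step, in the mean and before a possible reset. -/
theorem Good.integral_sq_norm_sub_shadowV_le (h : R.Good) (k : ℕ) :
    ∫ ω, ‖R.v (k + 1) ω - R.shadowV k ω‖ ^ 2 ∂P
      ≤ (1 + 1 / (4 * n)) * R.shadowErr k + 48 * (η (k + 1) * D.rhoQ * D.σ ^ 2 / (D.μ * n)) := by
  have hn := h.adm.one_le_cast
  have hn0 := h.adm.cast_pos
  have hμ := h.adm.mu_pos
  have hρ := h.adm.one_le_rhoQ
  have hη := h.η_pos k
  have hθ := h.adm.theta_pos hη (h.η_le k)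
  have hθl := h.adm.le_theta_sq hη (h.η_le k)
  have i0 := integrable_sq_norm_of_memLp ((h.memLp_v (k + 1)).sub (h.memLp_shadowV k))
  have i1 := integrable_sq_norm_of_memLp ((h.memLp_v k).sub (h.memLp_shadow k))
  have i2 := integrable_sq_norm_of_memLp (h.memLp_anchorNoise k)
  have i3 := integrable_sq_norm_of_memLp (R.memLp_freshNoise k)
  have i4 := integrable_inner_of_memLp (R.memLp_freshNoise k)
    ((h.memLp_cleanX k).sub (h.memLp_shadowX k))
  have z4 : ∫ ω, inner ℝ (R.freshNoise k ω) (R.cleanX k ω - R.shadowX k ω) ∂P = 0 :=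
    R.integral_inner_freshNoise k
      ((h.measurable_cleanX k).sub (h.measurable_shadowX k))
      ((h.memLp_cleanX k).sub (h.memLp_shadowX k))
  have b2 := h.integral_sq_anchorNoise_le k
  have b3 := h.integral_sq_freshNoise_le k
  have key := integral_mono (i0.const_mul _) ((((i1.const_mul _).add (i2.const_mul _)).add
    (i3.const_mul _)).sub (i4.const_mul _)) (h.sq_norm_sub_shadowV_le k)
  rw [integral_sub' (((i1.const_mul _).add (i2.const_mul _)).add (i3.const_mul _))
    (i4.const_mul _), integral_add' ((i1.const_mul _).add (i2.const_mul _)) (i3.const_mul _),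
    integral_add' (i1.const_mul _) (i2.const_mul _)] at key
  simp only [integral_const_mul, Pi.sub_apply] at key
  rw [z4] at key
  set A := ∫ ω, ‖R.v (k + 1) ω - R.shadowV k ω‖ ^ 2 ∂P
  change D.theta (η (k + 1)) ^ 2 * A
    ≤ (1 + 1 / (4 * n)) * D.theta (η (k + 1)) ^ 2 * R.shadowErr k + _ + _ - _ at key
  set t := η (k + 1)
  set θ := D.theta t
  set S := D.σ ^ 2 with hS
  have hS0 : 0 ≤ S := sq_nonneg _
  have c2 : (10 + 100 / 9 * (n : ℝ)) * t ^ 2 * ∫ ω, ‖R.anchorNoise k ω‖ ^ 2 ∂P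
      ≤ 190 / 9 * t ^ 2 * (D.rhoQ * S) := by
    have h1 : (10 + 100 / 9 * (n : ℝ)) * t ^ 2 * ∫ ω, ‖R.anchorNoise k ω‖ ^ 2 ∂P
        ≤ (10 + 100 / 9 * (n : ℝ)) * t ^ 2 * (S / n) :=
      mul_le_mul_of_nonneg_left b2 (by positivity)
    have h2 : (10 + 100 / 9 * (n : ℝ)) * t ^ 2 * (S / n) = t ^ 2 * S * (10 / n + 100 / 9) := by
      field_simp
    have h3 : 10 / (n : ℝ) ≤ 10 := div_le_self (by norm_num) hn
    have h4 : t ^ 2 * S * (10 / n + 100 / 9) ≤ t ^ 2 * S * (190 / 9) :=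
      mul_le_mul_of_nonneg_left (by linarith) (by positivity)
    have h5 : t ^ 2 * (1 * S) ≤ t ^ 2 * (D.rhoQ * S) :=
      mul_le_mul_of_nonneg_left (mul_le_mul_of_nonneg_right hρ hS0) (by positivity)
    linarith
  have c3 : 10 / 3 * t ^ 2 * ∫ ω, ‖R.freshNoise k ω‖ ^ 2 ∂P ≤ 40 / 3 * t ^ 2 * (D.rhoQ * S) := by
    have := mul_le_mul_of_nonneg_left b3 (by positivity : 0 ≤ 10 / 3 * t ^ 2)
    linarith
  have hnoise : 35 * t ^ 2 * (D.rhoQ * S) ≤ θ ^ 2 * (48 * (t * D.rhoQ * S / (D.μ * n))) := by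
    have h1 := mul_le_mul_of_nonneg_right hθl
      (by positivity : 0 ≤ 48 * (t * D.rhoQ * S / (D.μ * n)))
    have h2 : 20 / 27 * (D.μ * t * n) * (48 * (t * D.rhoQ * S / (D.μ * n)))
        = 320 / 9 * t ^ 2 * (D.rhoQ * S) := by field_simp; ring
    have h3 : 0 ≤ t ^ 2 * (D.rhoQ * S) := by positivity
    linarith
  have h0 : 0 ≤ t ^ 2 * (D.rhoQ * S) := by positivity
  have hfin : θ ^ 2 * A ≤ θ ^ 2 * ((1 + 1 / (4 * n)) * R.shadowErr k
      + 48 * (t * D.rhoQ * S / (D.μ * n))) := by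
    linarith
  exact le_of_mul_le_mul_left hfin (by positivity)

/-- The reset of the shadow at an update of the anchor. -/
theorem Good.shadowErr_succ (h : R.Good) (k : ℕ) :
    R.shadowErr (k + 1)
      = (1 - 1 / (n : ℝ)) * ∫ ω, ‖R.v (k + 1) ω - R.shadowV k ω‖ ^ 2 ∂P := by
  have i0 : Integrable (fun ω => ‖R.v (k + 1) ω - R.shadowV k ω‖ ^ 2) P :=
    integrable_sq_norm_of_memLp ((h.memLp_v (k + 1)).sub (h.memLp_shadowV k))
  have hm : Measurable[R.mNoise (k + 1)] (fun ω => ‖R.v (k + 1) ω - R.shadowV k ω‖ ^ 2) :=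
    measurable_sq_norm ((h.measurable_v_noise k).sub
      ((h.measurable_shadowV k).mono (R.mIdx_le_mNoise k) le_rfl))
  have e : ∀ ω, ‖R.v (k + 1) ω - R.shadow (k + 1) ω‖ ^ 2 = if R.refresh (k + 1) ω then (0 : ℝ)
      else ‖R.v (k + 1) ω - R.shadowV k ω‖ ^ 2 := fun ω => by
    by_cases hc : R.refresh (k + 1) ω = true
    · have : R.shadow (k + 1) ω = R.v (k + 1) ω := if_pos hc
      rw [this, if_pos hc]; simp
    · have : R.shadow (k + 1) ω = R.shadowV k ω := if_neg hc
      rw [this, if_neg hc]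
  unfold shadowErr
  simp_rw [e]
  rw [integral_ite_coin (R.measurable_refresh k) (Z := fun _ => (0 : ℝ))
    (integrable_const _) i0,
    R.setIntegral_no_refresh k hm i0]
  simp

/-- If the step sizes vary slowly, the run stays close to its shadow. The constant `288` is
`48 · 6`: a growth by `1 + 1 / (4 n)` and a variation of the step size by `1 + 1 / (2 n)` leave
`1 / (6 n)` or more of the factor `1 - 1 / n` from the resets. -/
theorem Good.shadowErr_le (h : R.Good)
    (hslow : ∀ k, η (k + 1) ≤ (1 + 1 / (2 * n)) * η (k + 2)) (k : ℕ) :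
    R.shadowErr k ≤ 288 * (η (k + 1) * D.rhoQ * D.σ ^ 2 / D.μ) := by
  have hn := h.adm.one_le_cast
  have hn0 := h.adm.cast_pos
  have hμ := h.adm.mu_pos
  have hρ := h.adm.one_le_rhoQ
  have hρ0 : 0 ≤ D.rhoQ := by linarith
  induction k with
  | zero =>
    rw [shadowErr_zero]
    have := h.η_pos 0
    positivity
  | succ k ih =>
    rw [h.shadowErr_succ]
    have h1 := h.integral_sq_norm_sub_shadowV_le k
    set r : ℝ := 1 / n with hr
    have hr0 : 0 < r := by positivity
    have hr1 : r ≤ 1 := by rw [hr, div_le_one hn0]; exact hn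
    have e1 : 1 / (4 * (n : ℝ)) = r / 4 := by rw [hr]; field_simp
    have e2 : 1 / (2 * (n : ℝ)) = r / 2 := by rw [hr]; field_simp
    set q := D.rhoQ * D.σ ^ 2 / D.μ with hq
    have hq0 : 0 ≤ q := by positivity
    have e3 : η (k + 1) * D.rhoQ * D.σ ^ 2 / (D.μ * n) = η (k + 1) * q * r := by
      rw [hq, hr]; field_simp
    have e4 : ∀ j, η j * D.rhoQ * D.σ ^ 2 / D.μ = η j * q := fun j => by rw [hq]; ring
    rw [e1, e3] at h1
    rw [e4] at ih
    rw [e4]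
    have hs := hslow k
    rw [e2] at hs
    have hηk := h.η_pos k
    have hηk1 := h.η_pos (k + 1)
    have h2 : (1 - r) * ∫ ω, ‖R.v (k + 1) ω - R.shadowV k ω‖ ^ 2 ∂P
        ≤ (1 - r) * ((1 + r / 4) * (288 * (η (k + 1) * q)) + 48 * (η (k + 1) * q * r)) := by
      refine mul_le_mul_of_nonneg_left (h1.trans ?_) (by linarith)
      have := mul_le_mul_of_nonneg_left ih (by linarith : 0 ≤ 1 + r / 4)
      linarith
    refine h2.trans ?_
    have h3 : (1 - r) * ((1 + r / 4) * (288 * (η (k + 1) * q)) + 48 * (η (k + 1) * q * r))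
        = 288 * q * η (k + 1) * ((1 - r) * (1 + r / 4 + r / 6)) := by ring
    have h4 : 0 ≤ (1 - r) * (1 + r / 4 + r / 6) := mul_nonneg (by linarith) (by linarith)
    have h5 : η (k + 1) * ((1 - r) * (1 + r / 4 + r / 6))
        ≤ (1 + r / 2) * η (k + 2) * ((1 - r) * (1 + r / 4 + r / 6)) :=
      mul_le_mul_of_nonneg_right hs h4
    have h6 : (1 + r / 2) * ((1 - r) * (1 + r / 4 + r / 6)) ≤ 1 := by nlinarith [sq_nonneg r]
    have h7 := mul_le_mul_of_nonneg_left h6 hηk1.le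
    have h8 : η (k + 1) * ((1 - r) * (1 + r / 4 + r / 6)) ≤ η (k + 1 + 1) := by
      change _ ≤ η (k + 2)
      change η (k + 2) * _ ≤ η (k + 2) * 1 at h7
      linarith
    have h9 := mul_le_mul_of_nonneg_left h8 (by positivity : 0 ≤ 288 * q)
    rw [h3]
    linarith

end Run

/-! ### Decrease of the potential -/

/-- `f` is integrable with mean `v`. -/
def HasMean {Ω : Type*} [MeasurableSpace Ω] (P : Measure Ω) (f : Ω → ℝ) (v : ℝ) : Prop :=
  Integrable f P ∧ ∫ ω, f ω ∂P = v

namespace HasMean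

variable {Ω : Type*} [MeasurableSpace Ω] {P : Measure Ω} {f g : Ω → ℝ} {v w : ℝ}

theorem of_integrable (hf : Integrable f P) : HasMean P f (∫ ω, f ω ∂P) := ⟨hf, rfl⟩

theorem add (hf : HasMean P f v) (hg : HasMean P g w) :
    HasMean P (fun ω => f ω + g ω) (v + w) :=
  ⟨hf.1.add hg.1, by rw [integral_add hf.1 hg.1, hf.2, hg.2]⟩

theorem sub (hf : HasMean P f v) (hg : HasMean P g w) :
    HasMean P (fun ω => f ω - g ω) (v - w) :=
  ⟨hf.1.sub hg.1, by rw [integral_sub hf.1 hg.1, hf.2, hg.2]⟩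

theorem const_mul (hf : HasMean P f v) (c : ℝ) : HasMean P (fun ω => c * f ω) (c * v) :=
  ⟨hf.1.const_mul c, by rw [integral_const_mul, hf.2]⟩

end HasMean

namespace Run

variable {n p : ℕ} {D : Problem n p} {Ω : Type*} [mΩ : MeasurableSpace Ω] {P : Measure Ω}
  {η : ℕ → ℝ} {x₀ : Ω → Vec p} {R : Run D P η D.μ x₀}

/-- The proximal point with the conditional mean, given the past, of the gradient estimator. -/
def meanX (R : Run D P η D.μ x₀) (k : ℕ) (ω : Ω) : Vec p :=
  D.prox (η (k + 1)) (R.y k ω - η (k + 1) • (D.gradAvg (R.y k ω) + R.anchorNoise k ω))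

theorem Good.isLip_meanX (h : R.Good) (k : ℕ) :
    IsLip (fun s : Vec p × Vec p =>
      D.prox (η (k + 1)) (s.1 - η (k + 1) • (D.gradAvg s.1 + s.2))) :=
  (h.adm.isLip_prox h.proper (h.η_pos k)).comp
    (IsLip.fst.sub (((h.adm.isLip_gradAvg.comp IsLip.fst).add IsLip.snd).smul _))

theorem Good.measurable_meanX (h : R.Good) (k : ℕ) : Measurable[R.mAll k] (R.meanX k) :=
  (h.isLip_meanX k).measurable_comp (u := fun ω => (R.y k ω, R.anchorNoise k ω))
    (((h.measurable_y k).mono (R.mCoin_le_mAll k) le_rfl).prodMk (h.measurable_anchorNoise k))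

theorem Good.norm_x_sub_meanX_le (h : R.Good) (k : ℕ) (ω : Ω) :
    ‖R.x (k + 1) ω - R.meanX k ω‖
      ≤ η (k + 1) * ‖R.sampleNoise k ω + R.freshNoise k ω‖ := by
  have hx := R.x_succ k ω
  rw [← sub_add_cancel (R.g (k + 1) ω) (D.gradAvg (R.y k ω)), R.g_sub] at hx
  have h1 := h.adm.norm_sub_le_of_isProx h.proper (h.η_pos k) hx
    (h.adm.isProx_prox h.proper (h.η_pos k)
      (R.y k ω - η (k + 1) • (D.gradAvg (R.y k ω) + R.anchorNoise k ω)))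
  refine h1.trans (le_of_eq ?_)
  rw [show ∀ a b c d e : Vec p, (a - η (k + 1) • (b + d + e + c)) - (a - η (k + 1) • (c + e))
    = -(η (k + 1) • (b + d)) from fun a b c d e => by module, norm_neg, norm_smul,
    Real.norm_eq_abs, abs_of_pos (h.η_pos k)]

/-- One step of the potential, pathwise. The inner products are centered: the first two since
`meanX` is known before the draws of the step, the last one since the shadow carries no
information on the perturbation at the anchor. -/
theorem Good.potential_succ_le (h : R.Good) {xs : Vec p} (hxs : D.ψ xs ≠ ⊤)
    (hmin : ∀ z, D.F xs ≤ D.F z) (k : ℕ) (ω : Ω) :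
    1 / (n : ℝ) * D.gapR (R.x (k + 1) ω) + D.μ / 2 * ‖R.v (k + 1) ω - xs‖ ^ 2
      ≤ (1 - D.delta (η (k + 1))) * (D.μ / 2 * ‖R.v k ω - xs‖ ^ 2)
        + (1 / (n : ℝ) - D.delta (η (k + 1))) * D.gapR (R.anchor k ω)
        - (1 / (n : ℝ) - D.delta (η (k + 1))) * D.breg (R.anchor k ω) (R.y k ω)
        + inner ℝ (R.sampleNoise k ω) (D.delta (η (k + 1)) • xs
          + (1 / (n : ℝ) - D.delta (η (k + 1))) • R.anchor k ω - (1 / (n : ℝ)) • R.meanX k ω)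
        + inner ℝ (R.freshNoise k ω) (D.delta (η (k + 1)) • xs
          + (1 / (n : ℝ) - D.delta (η (k + 1))) • R.anchor k ω - (1 / (n : ℝ)) • R.meanX k ω)
        + inner ℝ (R.anchorNoise k ω) (D.delta (η (k + 1)) • xs
          + (1 / (n : ℝ) - D.delta (η (k + 1))) • R.anchor k ω - (1 / (n : ℝ)) • R.shadowX k ω)
        + η (k + 1) / n * ‖R.sampleNoise k ω + R.freshNoise k ω‖ ^ 2
        + (1 / 2 + 3 / (2 * n)) * η (k + 1) * ‖R.anchorNoise k ω‖ ^ 2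
        + η (k + 1) / (2 * n) * ‖R.freshNoise k ω‖ ^ 2
        + 5 / 6 * D.μ / n * ‖R.v k ω - R.shadow k ω‖ ^ 2 := by
  have hn := h.adm.cast_pos
  have hη := h.η_pos k
  have hθ := h.adm.theta_pos hη (h.η_le k)
  have hθ2 := h.adm.theta_sq_le hη (h.η_le k)
  have hx := R.x_succ k ω
  rw [R.y_eq_mix] at hx
  have key := h.adm.potential_step hη (h.η_le k) hx (h.psi_anchor k ω) hxs
  rw [← R.y_eq_mix, ← h.v_succ, R.g_sub, ← h.adm.gapR_eq hxs hmin (h.psi_x _ _),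
    ← h.adm.gapR_eq hxs hmin (h.psi_anchor _ _)] at key
  have hm := h.norm_x_sub_meanX_le k ω
  have hX := h.adm.norm_sub_idealX_le h.proper hη (h.η_le k) (V := R.shadow k ω)
    (R.isProx_x k ω)
  change ‖R.x (k + 1) ω - R.shadowX k ω‖ ≤ _ at hX
  refine key.trans ?_
  set t := η (k + 1)
  set δ := D.delta t
  set θ := D.theta t
  set s := R.sampleNoise k ω
  set ν := R.freshNoise k ω
  set e := R.anchorNoise k ω
  set d := R.v k ω - R.shadow k ω
  set X := R.shadowX k ω
  set x := R.x (k + 1) ω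
  set xm := R.meanX k ω
  set z := δ • xs + (1 / (n : ℝ) - δ) • R.anchor k ω
  have e1 : inner ℝ (s + ν + e) (z - (1 / (n : ℝ)) • x)
      = inner ℝ s (z - (1 / (n : ℝ)) • xm) + inner ℝ ν (z - (1 / (n : ℝ)) • xm)
        + inner ℝ e (z - (1 / (n : ℝ)) • X)
        - 1 / (n : ℝ) * inner ℝ (s + ν) (x - xm) - 1 / (n : ℝ) * inner ℝ e (x - X) := by
    simp only [inner_add_left, inner_sub_right, inner_smul_right]
    ring
  have h1 : -(inner ℝ (s + ν) (x - xm)) ≤ t * ‖s + ν‖ ^ 2 := by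
    have h2 := neg_le_of_abs_le (abs_real_inner_le_norm (s + ν) (x - xm))
    have h3 := mul_le_mul_of_nonneg_left hm (norm_nonneg (s + ν))
    linarith
  have h2 : -(inner ℝ e (x - X)) ≤ (n / 2 + 3 / 2) * t * ‖e‖ ^ 2 + t / 2 * ‖ν‖ ^ 2
      + 5 / 6 * D.μ * ‖d‖ ^ 2 := by
    have h3 := neg_le_of_abs_le (abs_real_inner_le_norm e (x - X))
    have h4 := mul_le_mul_of_nonneg_left
      (hX.trans (add_le_add_right (mul_le_mul_of_nonneg_left (norm_add_le e ν) hη.le) _))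
      (norm_nonneg e)
    have h5 : θ * ‖d‖ * ‖e‖ ≤ 5 / 6 * D.μ * ‖d‖ ^ 2 + n / 2 * t * ‖e‖ ^ 2 := by
      have h6 : 0 ≤ (θ * ‖d‖ - n * t * ‖e‖) ^ 2 := sq_nonneg _
      have h7 := mul_le_mul_of_nonneg_right hθ2 (sq_nonneg ‖d‖)
      have h8 : 0 < n * t := by positivity
      refine le_of_mul_le_mul_left ?_ h8
      nlinarith
    have h6 : 0 ≤ t * (‖e‖ - ‖ν‖) ^ 2 := by positivity
    nlinarith
  have h3 := mul_le_mul_of_nonneg_left (add_le_add h1 h2) (by positivity : 0 ≤ 1 / (n : ℝ))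
  have e2 : 1 / (n : ℝ) * (t * ‖s + ν‖ ^ 2 + ((n / 2 + 3 / 2) * t * ‖e‖ ^ 2 + t / 2 * ‖ν‖ ^ 2
      + 5 / 6 * D.μ * ‖d‖ ^ 2)) = t / n * ‖s + ν‖ ^ 2
      + (1 / 2 + 3 / (2 * n)) * t * ‖e‖ ^ 2 + t / (2 * n) * ‖ν‖ ^ 2
      + 5 / 6 * D.μ / n * ‖d‖ ^ 2 := by field_simp; ring
  rw [e2] at h3
  rw [e1]
  linarith

theorem Good.measurable_combination (h : R.Good) (k : ℕ) (xs : Vec p) (a b c : ℝ) :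
    Measurable[R.mAll k]
      (fun ω => a • xs + b • R.anchor k ω - c • R.meanX k ω) :=
  (measurable_const.add ((measurable_const_smul b).comp
      ((h.measurable_anchor k).mono (R.mCoin_le_mAll k) le_rfl))).sub
    ((measurable_const_smul c).comp (h.measurable_meanX k))

theorem Good.measurable_gapR_anchor (h : R.Good) (k : ℕ) :
    Measurable[R.mNoise (k + 1)] (fun ω => D.gapR (R.anchor k ω)) :=
  h.adm.measurable_gapR.comp ((h.measurable_anchor k).mono
    ((R.mCoin_le_mAll k).trans (R.mAll_le_mNoise k)) le_rfl)

/-- The potential: the mean gap at the anchor plus the weighted mean squared distance of `v` to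
the minimizer. -/
def potential (R : Run D P η D.μ x₀) (xs : Vec p) (k : ℕ) : ℝ :=
  ∫ ω, D.gapR (R.anchor k ω) ∂P + D.μ / 2 * ∫ ω, ‖R.v k ω - xs‖ ^ 2 ∂P

theorem Good.integral_gapR_anchor_le (h : R.Good) (xs : Vec p) (k : ℕ) :
    ∫ ω, D.gapR (R.anchor k ω) ∂P ≤ R.potential xs k := by
  have := h.adm.mu_pos
  unfold potential
  have : 0 ≤ ∫ ω, ‖R.v k ω - xs‖ ^ 2 ∂P := integral_nonneg fun ω => sq_nonneg _
  exact le_add_of_nonneg_right (by positivity)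

variable [IsProbabilityMeasure P]

theorem Good.memLp_meanX (h : R.Good) (k : ℕ) : MemLp (R.meanX k) 2 P :=
  (h.isLip_meanX k).memLp (u := fun ω => (R.y k ω, R.anchorNoise k ω))
    (.of_fst_snd ⟨h.memLp_y k, h.memLp_anchorNoise k⟩)

/-- The proximal point of the shadow step is uncorrelated with the perturbation at the anchor,
for each value of the index and hence for the sampled one. -/
theorem Good.integral_inner_shadowX (h : R.Good) (k : ℕ) :
    ∫ ω, inner ℝ (R.anchorNoise k ω) (R.shadowX k ω) ∂P = 0 := by
  have hl := fun i => h.adm.isLip_idealX h.proper (h.η_pos k) i IsLip.fst IsLip.snd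
  have hm : ∀ i, Measurable[R.mAll k]
      (fun ω => D.idealX (η (k + 1)) i (R.shadow k ω) (R.anchor k ω)) := fun i =>
    (hl i).measurable_comp (u := fun ω => (R.shadow k ω, R.anchor k ω)) (h.measurable_pair k)
  have hL : ∀ i, MemLp (fun ω => D.idealX (η (k + 1)) i (R.shadow k ω) (R.anchor k ω)) 2 P :=
    fun i => (hl i).memLp (u := fun ω => (R.shadow k ω, R.anchor k ω)) (h.memLp_pair k)
  have e := integral_apply_index_of_indep (R.mAll_le k) (R.measurable_idx k) (R.idx_indep k)
    (fun i => (h.adm.q_pos i).le) (R.idx_law k)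
    (Z := fun i ω => inner ℝ (R.anchorNoise k ω)
      (D.idealX (η (k + 1)) i (R.shadow k ω) (R.anchor k ω)))
    (fun i => (h.measurable_anchorNoise k).stronglyMeasurable.inner (hm i).stronglyMeasurable)
    (fun i => integrable_inner_of_memLp (h.memLp_anchorNoise k) (hL i))
  refine e.trans (Finset.sum_eq_zero fun i _ => ?_)
  rw [h.integral_inner_anchorNoise k (hl i), smul_zero]

theorem Good.memLp_combination (h : R.Good) (k : ℕ) (xs : Vec p) (a b c : ℝ) {Z : Ω → Vec p}
    (hZ : MemLp Z 2 P) : MemLp (fun ω => a • xs + b • R.anchor k ω - c • Z ω) 2 P :=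
  ((memLp_const (a • xs)).add ((h.memLp_anchor k).const_smul b)).sub (hZ.const_smul c)

theorem Good.integral_inner_anchorNoise_combination (h : R.Good) (k : ℕ) (xs : Vec p)
    (a b c : ℝ) :
    ∫ ω, inner ℝ (R.anchorNoise k ω) (a • xs + b • R.anchor k ω - c • R.shadowX k ω) ∂P = 0 := by
  have hH : IsLip (fun s : Vec p × Vec p => a • xs + b • s.2) :=
    (IsLip.const (a • xs)).add (IsLip.snd.smul b)
  have z1 : ∫ ω, inner ℝ (R.anchorNoise k ω) (a • xs + b • R.anchor k ω) ∂P = 0 :=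
    h.integral_inner_anchorNoise k hH
  have lz : MemLp (fun ω => a • xs + b • R.anchor k ω) 2 P :=
    (memLp_const (a • xs)).add ((h.memLp_anchor k).const_smul b)
  have m1 : HasMean P (fun ω => inner ℝ (R.anchorNoise k ω) (a • xs + b • R.anchor k ω)) 0 :=
    ⟨integrable_inner_of_memLp (h.memLp_anchorNoise k) lz, z1⟩
  have m2 : HasMean P (fun ω => inner ℝ (R.anchorNoise k ω) (R.shadowX k ω)) 0 :=
    ⟨integrable_inner_of_memLp (h.memLp_anchorNoise k) (h.memLp_shadowX k),
      h.integral_inner_shadowX k⟩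
  have e : ∀ ω, inner ℝ (R.anchorNoise k ω) (a • xs + b • R.anchor k ω - c • R.shadowX k ω)
      = inner ℝ (R.anchorNoise k ω) (a • xs + b • R.anchor k ω)
        - c * inner ℝ (R.anchorNoise k ω) (R.shadowX k ω) := fun ω => by
    rw [inner_sub_right, inner_smul_right]
  simp_rw [e]
  simpa using (m1.sub (m2.const_mul c)).2

/-- The right-hand side of the pathwise potential estimate is integrable, and its mean is
bounded through the moments of the perturbations. -/
theorem Good.integral_potential_bound (h : R.Good) (xs : Vec p) (k : ℕ)
    (hslow : ∀ k, η (k + 1) ≤ (1 + 1 / (2 * n)) * η (k + 2))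
    (ha : Integrable (fun ω => D.gapR (R.anchor k ω)) P) :
    ∃ v, HasMean P (fun ω => (1 - D.delta (η (k + 1))) * (D.μ / 2 * ‖R.v k ω - xs‖ ^ 2)
        + (1 / (n : ℝ) - D.delta (η (k + 1))) * D.gapR (R.anchor k ω)
        - (1 / (n : ℝ) - D.delta (η (k + 1))) * D.breg (R.anchor k ω) (R.y k ω)
        + inner ℝ (R.sampleNoise k ω) (D.delta (η (k + 1)) • xs
          + (1 / (n : ℝ) - D.delta (η (k + 1))) • R.anchor k ω - (1 / (n : ℝ)) • R.meanX k ω)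
        + inner ℝ (R.freshNoise k ω) (D.delta (η (k + 1)) • xs
          + (1 / (n : ℝ) - D.delta (η (k + 1))) • R.anchor k ω - (1 / (n : ℝ)) • R.meanX k ω)
        + inner ℝ (R.anchorNoise k ω) (D.delta (η (k + 1)) • xs
          + (1 / (n : ℝ) - D.delta (η (k + 1))) • R.anchor k ω - (1 / (n : ℝ)) • R.shadowX k ω)
        + η (k + 1) / n * ‖R.sampleNoise k ω + R.freshNoise k ω‖ ^ 2
        + (1 / 2 + 3 / (2 * n)) * η (k + 1) * ‖R.anchorNoise k ω‖ ^ 2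
        + η (k + 1) / (2 * n) * ‖R.freshNoise k ω‖ ^ 2
        + 5 / 6 * D.μ / n * ‖R.v k ω - R.shadow k ω‖ ^ 2) v ∧
      v ≤ (1 - D.delta (η (k + 1))) * (D.μ / 2 * ∫ ω, ‖R.v k ω - xs‖ ^ 2 ∂P)
          + (1 / (n : ℝ) - D.delta (η (k + 1))) * ∫ ω, D.gapR (R.anchor k ω) ∂P
          + 248 * (η (k + 1) * D.rhoQ * D.σ ^ 2 / n) := by
  have hn := h.adm.cast_pos
  have hn1 := h.adm.one_le_cast
  have hμ := h.adm.mu_pos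
  have hρ := h.adm.one_le_rhoQ
  have hη := h.η_pos k
  have hδ := h.adm.delta_pos hη
  have hδ' := h.adm.mul_delta_le hη (h.η_le k)
  have hLQ := h.adm.mul_LQ_le (h.η_le k)
  have lm := h.memLp_combination k xs (D.delta (η (k + 1))) (1 / (n : ℝ) - D.delta (η (k + 1)))
    (1 / (n : ℝ)) (h.memLp_meanX k)
  have mm := h.measurable_combination k xs (D.delta (η (k + 1)))
    (1 / (n : ℝ) - D.delta (η (k + 1))) (1 / (n : ℝ))
  have lX := h.memLp_combination k xs (D.delta (η (k + 1))) (1 / (n : ℝ) - D.delta (η (k + 1)))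
    (1 / (n : ℝ)) (h.memLp_shadowX k)
  have m1 : HasMean P (fun ω => ‖R.v k ω - xs‖ ^ 2) _ :=
    .of_integrable (integrable_sq_norm_of_memLp ((h.memLp_v k).sub (memLp_const xs)))
  have m2 := HasMean.of_integrable (h.integrable_breg k)
  have m3 : HasMean P _ 0 := ⟨integrable_inner_of_memLp (h.memLp_sampleNoise k) lm,
    h.integral_inner_sampleNoise k mm lm⟩
  have m4 : HasMean P _ 0 := ⟨integrable_inner_of_memLp (R.memLp_freshNoise k) lm,
    R.integral_inner_freshNoise k (mm.mono (R.mAll_le_mIdx k) le_rfl) lm⟩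
  have m5 : HasMean P _ 0 := ⟨integrable_inner_of_memLp (h.memLp_anchorNoise k) lX,
    h.integral_inner_anchorNoise_combination k _ _ _ _⟩
  have m6 : HasMean P (fun ω => ‖R.sampleNoise k ω + R.freshNoise k ω‖ ^ 2) _ :=
    .of_integrable (integrable_sq_norm_of_memLp
      ((h.memLp_sampleNoise k).add (R.memLp_freshNoise k)))
  have m7 := HasMean.of_integrable (integrable_sq_norm_of_memLp (h.memLp_anchorNoise k))
  have m8 := HasMean.of_integrable (integrable_sq_norm_of_memLp (R.memLp_freshNoise k))
  have m9 : HasMean P (fun ω => ‖R.v k ω - R.shadow k ω‖ ^ 2) (R.shadowErr k) :=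
    .of_integrable (integrable_sq_norm_of_memLp ((h.memLp_v k).sub (h.memLp_shadow k)))
  refine ⟨_, (((((((((((m1.const_mul _).const_mul _).add
    ((HasMean.of_integrable ha).const_mul _)).sub
    (m2.const_mul _)).add m3).add m4).add m5).add (m6.const_mul _)).add (m7.const_mul _)).add
    (m8.const_mul _)).add (m9.const_mul _)), ?_⟩
  have bw := h.integral_sq_error_le k
  have be := h.integral_sq_anchorNoise_le k
  have bν := h.integral_sq_freshNoise_le k
  have bd := h.shadowErr_le hslow k
  have hb : 0 ≤ ∫ ω, D.breg (R.anchor k ω) (R.y k ω) ∂P :=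
    integral_nonneg fun ω => h.adm.breg_nonneg _ _
  set t := η (k + 1)
  set δ := D.delta t
  set S := D.σ ^ 2 with hS
  have hS0 : 0 ≤ S := sq_nonneg _
  have hρS : S ≤ D.rhoQ * S := le_mul_of_one_le_left hS0 hρ
  set br := ∫ ω, D.breg (R.anchor k ω) (R.y k ω) ∂P
  -- the Bregman term absorbs the sampling variance since `2 L_Q η ≤ 2 / 3 ≤ 1 - n δ`
  have c1 : t / n * ∫ ω, ‖R.sampleNoise k ω + R.freshNoise k ω‖ ^ 2 ∂P
      ≤ (1 / n - δ) * br + 4 * (t * D.rhoQ * S / n) := by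
    have h1 := mul_le_mul_of_nonneg_left bw (by positivity : 0 ≤ t / n)
    have h2 : t / n * (2 * D.LQ * br + 4 * D.rhoQ * S)
        = 2 * (t * D.LQ) / n * br + 4 * (t * D.rhoQ * S / n) := by ring
    have h3 : 2 * (t * D.LQ) / n ≤ 1 / n - δ := by
      rw [div_le_iff₀ hn, sub_mul, one_div_mul_cancel hn.ne']
      linarith
    have h4 := mul_le_mul_of_nonneg_right h3 hb
    linarith
  have c2 : (1 / 2 + 3 / (2 * n)) * t * ∫ ω, ‖R.anchorNoise k ω‖ ^ 2 ∂P
      ≤ 2 * (t * D.rhoQ * S / n) := by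
    have h1 : (1 / 2 + 3 / (2 * (n : ℝ))) * t ≤ 2 * t := by
      have : 3 / (2 * (n : ℝ)) ≤ 3 / 2 := by
        rw [div_le_div_iff₀ (by positivity) (by norm_num)]; linarith
      exact mul_le_mul_of_nonneg_right (by linarith) hη.le
    have h2 := mul_le_mul h1 be (integral_nonneg fun ω => sq_nonneg _) (by positivity)
    have h3 : S / n ≤ D.rhoQ * S / n := div_le_div_of_nonneg_right hρS hn.le
    have h4 := mul_le_mul_of_nonneg_left h3 (by positivity : 0 ≤ 2 * t)
    have h5 : 2 * t * (D.rhoQ * S / n) = 2 * (t * D.rhoQ * S / n) := by ring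
    linarith
  have c3 : t / (2 * n) * ∫ ω, ‖R.freshNoise k ω‖ ^ 2 ∂P ≤ 2 * (t * D.rhoQ * S / n) := by
    have h1 := mul_le_mul_of_nonneg_left bν (by positivity : 0 ≤ t / (2 * n))
    have h2 : t / (2 * n) * (4 * D.rhoQ * S) = 2 * (t * D.rhoQ * S / n) := by field_simp; ring
    linarith
  have c4 : 5 / 6 * D.μ / n * R.shadowErr k ≤ 240 * (t * D.rhoQ * S / n) := by
    have h1 := mul_le_mul_of_nonneg_left bd (by positivity : 0 ≤ 5 / 6 * D.μ / n)
    have h2 : 5 / 6 * D.μ / n * (288 * (t * D.rhoQ * S / D.μ)) = 240 * (t * D.rhoQ * S / n) := by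
      field_simp; ring
    linarith
  linarith

/-- One step of the potential in the mean. The integrability of the gap at `x (k + 1)` follows
from that at the anchor. -/
theorem Good.integral_potential_succ_le (h : R.Good) {xs : Vec p} (hxs : D.ψ xs ≠ ⊤)
    (hmin : ∀ z, D.F xs ≤ D.F z)
    (hslow : ∀ k, η (k + 1) ≤ (1 + 1 / (2 * n)) * η (k + 2)) (k : ℕ)
    (ha : Integrable (fun ω => D.gapR (R.anchor k ω)) P) :
    Integrable (fun ω => D.gapR (R.x (k + 1) ω)) P ∧
      1 / (n : ℝ) * ∫ ω, D.gapR (R.x (k + 1) ω) ∂P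
          + D.μ / 2 * ∫ ω, ‖R.v (k + 1) ω - xs‖ ^ 2 ∂P
        ≤ (1 - D.delta (η (k + 1))) * (D.μ / 2 * ∫ ω, ‖R.v k ω - xs‖ ^ 2 ∂P)
          + (1 / (n : ℝ) - D.delta (η (k + 1))) * ∫ ω, D.gapR (R.anchor k ω) ∂P
          + 248 * (η (k + 1) * D.rhoQ * D.σ ^ 2 / n) := by
  have hn := h.adm.cast_pos
  have hμ := h.adm.mu_pos
  obtain ⟨v, hm, hv⟩ := h.integral_potential_bound xs k hslow ha
  have iv' : Integrable (fun ω => ‖R.v (k + 1) ω - xs‖ ^ 2) P :=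
    integrable_sq_norm_of_memLp ((h.memLp_v (k + 1)).sub (memLp_const xs))
  have hpt := h.potential_succ_le hxs hmin k
  have hx : Integrable (fun ω => D.gapR (R.x (k + 1) ω)) P := by
    refine (hm.1.const_mul (n : ℝ)).mono' (h.adm.measurable_gapR.comp
      ((h.measurable_x k).mono (R.mNoise_le k) le_rfl)).aestronglyMeasurable
      (Filter.Eventually.of_forall fun ω => ?_)
    rw [Real.norm_eq_abs, abs_of_nonneg (D.gapR_nonneg _)]
    have h2 : 0 ≤ D.μ / 2 * ‖R.v (k + 1) ω - xs‖ ^ 2 := by positivity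
    have h3 := mul_le_mul_of_nonneg_left ((le_add_of_nonneg_right h2).trans (hpt ω)) hn.le
    rwa [← mul_assoc, mul_one_div_cancel hn.ne', one_mul] at h3
  refine ⟨hx, le_trans ?_ hv⟩
  have m := ((HasMean.of_integrable hx).const_mul (1 / (n : ℝ))).add
    ((HasMean.of_integrable iv').const_mul (D.μ / 2))
  rw [← m.2, ← hm.2]
  exact integral_mono m.1 hm.1 hpt

/-- The mean gap at the anchor moves to the mean gap at the new iterate with weight `1 / n`. -/
theorem Good.integral_gapR_anchor_succ (h : R.Good) (k : ℕ)
    (ha : Integrable (fun ω => D.gapR (R.anchor k ω)) P)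
    (hx : Integrable (fun ω => D.gapR (R.x (k + 1) ω)) P) :
    Integrable (fun ω => D.gapR (R.anchor (k + 1) ω)) P ∧
      ∫ ω, D.gapR (R.anchor (k + 1) ω) ∂P = 1 / (n : ℝ) * ∫ ω, D.gapR (R.x (k + 1) ω) ∂P
        + (1 - 1 / (n : ℝ)) * ∫ ω, D.gapR (R.anchor k ω) ∂P := by
  have e : (fun ω => D.gapR (R.anchor (k + 1) ω)) = fun ω => if R.refresh (k + 1) ω then
      D.gapR (R.x (k + 1) ω) else D.gapR (R.anchor k ω) := funext fun ω => by
    rw [R.anchor_succ]; split_ifs <;> rfl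
  rw [e]
  refine ⟨integrable_ite_coin (R.measurable_refresh k) hx ha, ?_⟩
  rw [integral_ite_coin (R.measurable_refresh k) hx ha,
    R.setIntegral_refresh k (W := fun ω => D.gapR (R.x (k + 1) ω))
      (h.adm.measurable_gapR.comp (h.measurable_x k)) hx,
    R.setIntegral_no_refresh k (h.measurable_gapR_anchor k) ha]

theorem Good.integrable_gapR_anchor (h : R.Good)
    (hslow : ∀ k, η (k + 1) ≤ (1 + 1 / (2 * n)) * η (k + 2))
    (h0 : Integrable (fun ω => D.gapR (x₀ ω)) P) (k : ℕ) :
    Integrable (fun ω => D.gapR (R.anchor k ω)) P := by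
  obtain ⟨xs, hxs, hmin⟩ := h.adm.exists_argmin h.proper
  induction k with
  | zero => simpa only [R.anchor_zero] using h0
  | succ k ih =>
    exact (h.integral_gapR_anchor_succ k ih
      (h.integral_potential_succ_le hxs hmin hslow k ih).1).1

theorem Good.integrable_gapR_x (h : R.Good)
    (hslow : ∀ k, η (k + 1) ≤ (1 + 1 / (2 * n)) * η (k + 2))
    (h0 : Integrable (fun ω => D.gapR (x₀ ω)) P) (k : ℕ) :
    Integrable (fun ω => D.gapR (R.x k ω)) P := by
  obtain ⟨xs, hxs, hmin⟩ := h.adm.exists_argmin h.proper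
  cases k with
  | zero => simpa only [R.x_zero] using h0
  | succ k =>
    exact (h.integral_potential_succ_le hxs hmin hslow k (h.integrable_gapR_anchor hslow h0 k)).1

/-- The recursion for the potential. Since `η / n = (3 / 5) δ² / μ`, the constant is
`248 · 3 / 5`. -/
theorem Good.potential_contracts (h : R.Good) {xs : Vec p} (hxs : D.ψ xs ≠ ⊤)
    (hmin : ∀ z, D.F xs ≤ D.F z)
    (hslow : ∀ k, η (k + 1) ≤ (1 + 1 / (2 * n)) * η (k + 2))
    (h0 : Integrable (fun ω => D.gapR (x₀ ω)) P) (k : ℕ) :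
    R.potential xs (k + 1) ≤ (1 - D.delta (η (k + 1))) * R.potential xs k
      + 744 / 5 * D.delta (η (k + 1)) ^ 2 * (D.rhoQ * D.σ ^ 2 / D.μ) := by
  have hn := h.adm.cast_pos
  have hμ := h.adm.mu_pos
  have ha := h.integrable_gapR_anchor hslow h0 k
  obtain ⟨hx, h1⟩ := h.integral_potential_succ_le hxs hmin hslow k ha
  have h2 := (h.integral_gapR_anchor_succ k ha hx).2
  have h3 := h.adm.delta_sq (h.η_pos k)
  have h4 : 744 / 5 * D.delta (η (k + 1)) ^ 2 * (D.rhoQ * D.σ ^ 2 / D.μ)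
      = 248 * (η (k + 1) * D.rhoQ * D.σ ^ 2 / n) := by
    field_simp
    linear_combination 248 * D.rhoQ * D.σ ^ 2 * h3
  unfold potential
  rw [h2, h4]
  linarith

theorem Good.potential_zero_le (h : R.Good) {xs : Vec p} (hxs : D.ψ xs ≠ ⊤)
    (hmin : ∀ z, D.F xs ≤ D.F z) (h0 : Integrable (fun ω => D.gapR (x₀ ω)) P) :
    R.potential xs 0 ≤ 2 * ∫ ω, D.gapR (x₀ ω) ∂P := by
  have h1 : Integrable (fun ω => ‖x₀ ω - xs‖ ^ 2) P :=
    integrable_sq_norm_of_memLp (h.x₀_memLp.sub (memLp_const xs))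
  have h2 := integral_mono (h1.const_mul (D.μ / 2)) h0
    fun ω => h.adm.mu_sq_le_gapR hxs hmin (h.x₀_dom ω)
  rw [integral_const_mul] at h2
  unfold potential
  simp only [R.anchor_zero, R.v_zero]
  linarith

end Run

/-! ### Step sizes -/

namespace Problem

variable {n p : ℕ} {D : Problem n p}

/-- The ratio `ρ_Q σ² / μ` of the noise level to the strong convexity constant. -/
def noise (D : Problem n p) : ℝ := D.rhoQ * D.σ ^ 2 / D.μ

theorem Admissible.noise_nonneg (hD : D.Admissible) : 0 ≤ D.noise := by
  have h1 := hD.mu_pos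
  have h2 := hD.one_le_rhoQ
  unfold noise
  positivity

theorem Admissible.B_eq (hD : D.Admissible) :
    D.B = 3 * Real.sqrt (3 / 5) * (D.noise * D.delta D.eta) := by
  have hμ := hD.mu_pos
  have hn := hD.cast_pos
  have hη := hD.eta_pos
  have e : D.eta / (D.μ * n) = 3 / 5 * (5 * D.eta * D.μ / (3 * n) / D.μ ^ 2) := by
    field_simp
  unfold B noise delta
  rw [e, Real.sqrt_mul (by norm_num), 
    Real.sqrt_div (by positivity : 0 ≤ 5 * D.eta * D.μ / (3 * n)), Real.sqrt_sq hμ.le]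
  ring

theorem Admissible.noise_mul_delta_le_B (hD : D.Admissible) :
    D.noise * D.delta D.eta ≤ D.B := by
  have h1 : 1 / 3 ≤ Real.sqrt (3 / 5) := Real.le_sqrt_of_sq_le (by norm_num)
  have h2 := mul_nonneg hD.noise_nonneg (hD.delta_pos hD.eta_pos).le
  rw [hD.B_eq]
  nlinarith

theorem Admissible.B_le (hD : D.Admissible) : D.B ≤ 3 * (D.noise * D.delta D.eta) := by
  have h1 : Real.sqrt (3 / 5) ≤ 1 := Real.sqrt_le_one.2 (by norm_num)
  have h2 := mul_nonneg hD.noise_nonneg (hD.delta_pos hD.eta_pos).le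
  rw [hD.B_eq]
  nlinarith

theorem Admissible.inv_delta_le (hD : D.Admissible) :
    (D.delta D.eta)⁻¹ ≤ 3 * (n + Real.sqrt (n * D.LQ / D.μ)) := by
  have hμ := hD.mu_pos
  have hn := hD.cast_pos
  have hη := hD.eta_pos
  have hL := hD.LQ_pos
  have hδ := hD.delta_pos hη
  have h1 : D.eta⁻¹ ≤ 3 * D.LQ + 15 * D.μ * n := by
    unfold eta
    rcases min_choice (1 / (3 * D.LQ)) (1 / (15 * D.μ * n)) with h | h <;> rw [h, one_div, inv_inv]
    · have : 0 < 15 * D.μ * n := by positivity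
      linarith
    · linarith
  have h2 : (D.delta D.eta)⁻¹ ^ 2 = 3 * n / (5 * D.μ) * D.eta⁻¹ := by
    have := hD.delta_sq hη
    field_simp
    linear_combination -this
  have h3 := mul_le_mul_of_nonneg_left h1 (by positivity : 0 ≤ 3 * n / (5 * D.μ))
  have h4 : 3 * n / (5 * D.μ) * (3 * D.LQ + 15 * D.μ * n)
      = 9 / 5 * (n * D.LQ / D.μ) + 9 * n ^ 2 := by
    field_simp
    ring
  have h5 : 0 ≤ n * D.LQ / D.μ := by positivity
  refine le_of_sq_le_sq ?_ (by positivity)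
  have h6 := Real.sq_sqrt h5
  have h7 := mul_nonneg hn.le (Real.sqrt_nonneg (n * D.LQ / D.μ))
  nlinarith

theorem Admissible.etaDecr_pos (hD : D.Admissible) (k : ℕ) : 0 < D.etaDecr k := by
  have hμ := hD.mu_pos
  have hn := hD.cast_pos
  exact lt_min hD.eta_pos (by positivity)

theorem etaDecr_le (D : Problem n p) (k : ℕ) : D.etaDecr k ≤ D.eta := min_le_left _ _

/-- Once the decreasing step sizes drop below the constant one, the iteration counter exceeds
`6 n`, so that they vary slowly. -/
theorem Admissible.etaDecr_slow (hD : D.Admissible) (k : ℕ) :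
    D.etaDecr (k + 1) ≤ (1 + 1 / (2 * n)) * D.etaDecr (k + 2) := by
  have hμ := hD.mu_pos
  have hn := hD.cast_pos
  have hn1 := hD.one_le_cast
  have hη := hD.eta_pos
  have hμη := hD.mul_mu_le le_rfl
  rcases le_total D.eta (12 * n / (5 * D.μ * (((k + 2 : ℕ) : ℝ) + 2) ^ 2)) with h | h
  · have e : D.etaDecr (k + 2) = D.eta := min_eq_left h
    rw [e]
    have : 0 < 1 / (2 * (n : ℝ)) * D.eta := by positivity
    linarith [D.etaDecr_le (k + 1)]
  · have e : D.etaDecr (k + 2) = 12 * n / (5 * D.μ * (((k + 2 : ℕ) : ℝ) + 2) ^ 2) := min_eq_right h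
    have e' : D.etaDecr (k + 1) ≤ 12 * n / (5 * D.μ * (((k + 1 : ℕ) : ℝ) + 2) ^ 2) :=
      min_le_right _ _
    rw [e]
    refine e'.trans ?_
    push_cast at h ⊢
    set s : ℝ := (k : ℝ) + 2 + 2 with hs
    have e1 : (k : ℝ) + 1 + 2 = s - 1 := by rw [hs]; ring
    have hs4 : 4 ≤ s := by rw [hs]; linarith [(Nat.cast_nonneg k : (0 : ℝ) ≤ k)]
    have hs1 : 0 < s - 1 := by linarith
    rw [e1]
    have h6 : 6 * n ≤ s := by
      rw [div_le_iff₀ (by positivity)] at h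
      refine le_of_sq_le_sq ?_ (by linarith)
      have h1 := mul_le_mul_of_nonneg_right h (by positivity : 0 ≤ 3 * (n : ℝ))
      have h2 := mul_le_mul_of_nonneg_right hμη (by positivity : 0 ≤ 15 * s ^ 2)
      nlinarith
    have key : 2 * n * s ^ 2 ≤ (2 * n + 1) * (s - 1) ^ 2 := by
      have : 0 ≤ s * (s - (4 * n + 2)) := mul_nonneg (by linarith) (by linarith)
      nlinarith
    have e2 : (1 + 1 / (2 * (n : ℝ))) * (12 * n / (5 * D.μ * s ^ 2))
        = 6 * (2 * n + 1) / (5 * D.μ * s ^ 2) := by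
      field_simp
      ring
    rw [e2, div_le_div_iff₀ (by positivity) (by positivity)]
    have := mul_le_mul_of_nonneg_left key (by positivity : 0 ≤ 30 * D.μ)
    nlinarith

theorem Admissible.delta_etaDecr (hD : D.Admissible) (k : ℕ) :
    D.delta (D.etaDecr k) = min (D.delta D.eta) (2 / ((k : ℝ) + 2)) := by
  have hμ := hD.mu_pos
  have hn := hD.cast_pos
  have hmono : Monotone D.delta := fun a b hab => by
    unfold delta
    apply Real.sqrt_le_sqrt
    gcongr
  have e : D.delta (12 * n / (5 * D.μ * ((k : ℝ) + 2) ^ 2)) = 2 / ((k : ℝ) + 2) := by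
    unfold delta
    rw [show 5 * (12 * n / (5 * D.μ * ((k : ℝ) + 2) ^ 2)) * D.μ / (3 * n)
      = (2 / ((k : ℝ) + 2)) ^ 2 by field_simp; ring]
    exact Real.sqrt_sq (by positivity)
  unfold etaDecr
  rw [hmono.map_min, e]

end Problem

/-! ### Scalar recursions -/

/-- A contraction with constant rate, down to the noise level. -/
theorem le_of_contraction {T : ℕ → ℝ} {δ a : ℝ} (hδ : 0 < δ) (hδ1 : δ ≤ 1) (ha : 0 ≤ a)
    (hT : ∀ k, T (k + 1) ≤ (1 - δ) * T k + a * δ ^ 2) (k : ℕ) :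
    T k ≤ (1 - δ) ^ k * max (T 0) 0 + a * δ := by
  induction k with
  | zero =>
    have := le_max_left (T 0) 0
    have h2 : 0 ≤ a * δ := by positivity
    simpa using this.trans (le_add_of_nonneg_right h2)
  | succ k ih =>
    have h1 := mul_le_mul_of_nonneg_left ih (by linarith : 0 ≤ 1 - δ)
    rw [pow_succ]
    linarith [hT k]

/-- A contraction whose rate `min δ (2 / (k + 2))` decreases: the recursion stays below a multiple
of the rate. -/
theorem le_of_decreasing_contraction {T : ℕ → ℝ} {δ a M : ℝ} (hδ : 0 < δ) (hδ1 : δ ≤ 1)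
    (haM : 2 * a ≤ M) (hM : 0 ≤ M) (h0 : T 0 ≤ M * δ)
    (hT : ∀ k : ℕ, T (k + 1) ≤ (1 - min δ (2 / (((k + 1 : ℕ) : ℝ) + 2))) * T k
      + a * min δ (2 / (((k + 1 : ℕ) : ℝ) + 2)) ^ 2) (k : ℕ) :
    T k ≤ M * min δ (2 / ((k : ℝ) + 2)) := by
  induction k with
  | zero => simpa [hδ1] using h0
  | succ k ih =>
    refine (hT k).trans ?_
    set d := min δ (2 / ((k : ℝ) + 2)) with hd
    set d' := min δ (2 / (((k + 1 : ℕ) : ℝ) + 2)) with hd'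
    have hk : (0 : ℝ) ≤ k := Nat.cast_nonneg k
    have hpos : 0 < d' := lt_min hδ (by positivity)
    have hle : d' ≤ 1 := (min_le_left _ _).trans hδ1
    -- the rates satisfy `1 / d' ≤ 1 / d + 1 / 2`
    have hstep : d * (1 - d' / 2) ≤ d' := by
      have hd1 : d ≤ δ := min_le_left _ _
      have hd2 : d ≤ 2 / ((k : ℝ) + 2) := min_le_right _ _
      have hd0 : 0 < d := lt_min hδ (by positivity)
      rcases min_choice δ (2 / (((k + 1 : ℕ) : ℝ) + 2)) with h | h
      · rw [← hd'] at h
        nlinarith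
      · rw [← hd'] at h
        push_cast at h
        have e : 1 - d' / 2 = d' * (((k : ℝ) + 2) / 2) := by rw [h]; field_simp; ring
        rw [e]
        have h3 : d * (((k : ℝ) + 2) / 2) ≤ 1 := by
          rw [le_div_iff₀ (by positivity)] at hd2
          linarith
        nlinarith
    have h1 := mul_le_mul_of_nonneg_left ih (by linarith : 0 ≤ 1 - d')
    have h2 : (1 - d') * d ≤ (1 - d' / 2) * d' := by
      have h3 : (1 - d') ≤ (1 - d' / 2) * (1 - d' / 2) := by nlinarith
      have hd0 : 0 < d := lt_min hδ (by positivity)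
      have h4 := mul_le_mul_of_nonneg_right h3 hd0.le
      have h5 := mul_le_mul_of_nonneg_left hstep (by linarith : 0 ≤ 1 - d' / 2)
      linarith
    have h3 := mul_le_mul_of_nonneg_left h2 hM
    have h4 := mul_le_mul_of_nonneg_right haM (sq_nonneg d')
    nlinarith

/-- If the average `a`, which moves to `b` with weight `1 / n`, is small after `n` steps, then one
of the `n` values of `b` is small. -/
theorem exists_le_of_averaging {n : ℕ} (hn : 0 < n) {a b : ℕ → ℝ} {ε : ℝ} (hε : 0 < ε)
    (ha : ∀ k, 0 ≤ a k)
    (hab : ∀ k, a (k + 1) = 1 / (n : ℝ) * b (k + 1) + (1 - 1 / (n : ℝ)) * a k)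
    {m : ℕ} (hm : a (m + n) < ε / 2) : ∃ k ≤ m + n, b k ≤ ε := by
  by_contra! hcon
  have hn0 : (0 : ℝ) < n := Nat.cast_pos.2 hn
  have hn1 : (1 : ℝ) ≤ n := Nat.one_le_cast.2 hn
  set r : ℝ := 1 / n with hr
  have hr0 : 0 < r := by positivity
  have hr1 : r ≤ 1 := by rw [hr, div_le_one hn0]; exact hn1
  have key : ∀ j ≤ n, ε * (1 - (1 - r) ^ j) ≤ a (m + j) := by
    intro j hj
    induction j with
    | zero => simpa using ha m
    | succ j ih =>
      have h1 := ih (by omega)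
      have h2 := hcon (m + j + 1) (by omega)
      have h3 := hab (m + j)
      have h4 := mul_le_mul_of_nonneg_left h1 (by linarith : 0 ≤ 1 - r)
      have h5 := mul_le_mul_of_nonneg_left h2.le hr0.le
      have e : a (m + (j + 1)) = a (m + j + 1) := rfl
      rw [e, h3, pow_succ]
      linarith
  have h1 := key n le_rfl
  have h2 : (1 - r) ^ n ≤ 1 / 2 := by
    have h3 : (1 - r) ^ n ≤ Real.exp (-r) ^ n :=
      pow_le_pow_left₀ (by linarith) (by linarith [Real.add_one_le_exp (-r)]) n
    have h4 : Real.exp (-r) ^ n = Real.exp (-1) := by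
      rw [← Real.exp_nat_mul]
      congr 1
      rw [hr]; field_simp
    have h5 : Real.exp (-1) ≤ 1 / 2 := by
      rw [Real.exp_neg, ← one_div]
      exact one_div_le_one_div_of_le (by norm_num) (by linarith [Real.add_one_le_exp (1 : ℝ)])
    linarith
  have h3 := mul_le_mul_of_nonneg_left (by linarith : 1 / 2 ≤ 1 - (1 - r) ^ n) hε.le
  linarith

/-- The number of steps a contraction needs. -/
theorem pow_mul_le_of_posLog_le {δ t B : ℝ} (hδ1 : δ ≤ 1) (ht : 0 ≤ t) (hB : 0 < B)
    {m : ℕ} (hm : Real.posLog (t / B) ≤ δ * m) : (1 - δ) ^ m * t ≤ B := by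
  rcases ht.eq_or_lt with rfl | ht
  · simpa using hB.le
  have h1 : (1 - δ) ^ m ≤ Real.exp (-(δ * m)) := by
    have h2 : (1 - δ) ^ m ≤ Real.exp (-δ) ^ m :=
      pow_le_pow_left₀ (by linarith) (by linarith [Real.add_one_le_exp (-δ)]) m
    rw [← Real.exp_nat_mul] at h2
    refine h2.trans (le_of_eq ?_)
    congr 1
    ring
  have h2 : Real.exp (-(δ * m)) ≤ B / t := by
    have h3 : Real.log (t / B) ≤ δ * m := (le_max_right _ _).trans hm
    have h4 : -(δ * m) ≤ Real.log (B / t) := by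
      rw [← inv_div t B, Real.log_inv]
      linarith
    exact (Real.le_log_iff_exp_le (by positivity)).1 h4
  have h3 := mul_le_mul_of_nonneg_right (h1.trans h2) ht.le
  rwa [div_mul_cancel₀ _ ht.ne'] at h3

/-! ### The two stages -/

namespace Run

variable {n p : ℕ} {D : Problem n p} {Ω : Type*} [mΩ : MeasurableSpace Ω] {P : Measure Ω}
  {η : ℕ → ℝ} {x₀ : Ω → Vec p} {R : Run D P η D.μ x₀}

theorem Good.psi_output (h : R.Good) (b : Bool) (k : ℕ) (ω : Ω) :
    D.ψ (R.output b k ω) ≠ ⊤ := by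
  unfold output
  split_ifs
  exacts [h.psi_anchor k ω, h.psi_x k ω]

variable [IsProbabilityMeasure P]

theorem Good.memLp_output (h : R.Good) (b : Bool) (k : ℕ) : MemLp (R.output b k) 2 P := by
  cases b
  exacts [h.memLp_x k, h.memLp_anchor k]

theorem Good.integrable_gapR_output (h : R.Good)
    (hslow : ∀ k, η (k + 1) ≤ (1 + 1 / (2 * n)) * η (k + 2))
    (h0 : Integrable (fun ω => D.gapR (x₀ ω)) P) (b : Bool) (k : ℕ) :
    Integrable (fun ω => D.gapR (R.output b k ω)) P := by
  cases b
  exacts [h.integrable_gapR_x hslow h0 k, h.integrable_gapR_anchor hslow h0 k]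

theorem Good.expGap_eq (h : R.Good)
    (hslow : ∀ k, η (k + 1) ≤ (1 + 1 / (2 * n)) * η (k + 2))
    (h0 : Integrable (fun ω => D.gapR (x₀ ω)) P) (b : Bool) (k : ℕ) :
    R.expGap b k = ENNReal.ofReal (∫ ω, D.gapR (R.output b k ω) ∂P) := by
  rw [ofReal_integral_eq_lintegral_ofReal (h.integrable_gapR_output hslow h0 b k)
    (Filter.Eventually.of_forall fun ω => D.gapR_nonneg _)]
  exact lintegral_congr fun ω => (h.adm.ofReal_gapR h.proper (h.psi_output b k ω)).symm

/-- If the mean gap at the anchor is small after `m + n` steps, then either output is good after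
at most `m + n` steps. -/
theorem Good.exists_integral_gapR_output_le (h : R.Good)
    (hslow : ∀ k, η (k + 1) ≤ (1 + 1 / (2 * n)) * η (k + 2))
    (h0 : Integrable (fun ω => D.gapR (x₀ ω)) P) (b : Bool) {ε : ℝ} (hε : 0 < ε) {m : ℕ}
    (hm : ∫ ω, D.gapR (R.anchor (m + n) ω) ∂P < ε / 2) :
    ∃ k ≤ m + n, ∫ ω, D.gapR (R.output b k ω) ∂P ≤ ε := by
  cases b
  · exact exists_le_of_averaging h.adm.n_pos hε
      (a := fun k => ∫ ω, D.gapR (R.anchor k ω) ∂P) (b := fun k => ∫ ω, D.gapR (R.x k ω) ∂P)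
      (fun k => integral_nonneg fun ω => D.gapR_nonneg _)
      (fun k => (h.integral_gapR_anchor_succ k (h.integrable_gapR_anchor hslow h0 k)
        (h.integrable_gapR_x hslow h0 (k + 1))).2) hm
  · exact ⟨m + n, le_rfl, hm.le.trans (by linarith)⟩

/-- The expected number of gradient evaluations in `K` iterations is `n + 3 K`. -/
theorem hasMean_evals (R : Run D P η D.μ x₀) (hn : 0 < n) (K : ℕ) :
    HasMean P (fun ω => (R.evals K ω : ℝ)) (n + 3 * K) := by
  have hn0 : (n : ℝ) ≠ 0 := Nat.cast_ne_zero.2 hn.ne'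
  induction K with
  | zero => exact ⟨by simp [evals], by simp [evals]⟩
  | succ K ih =>
    have e : (fun ω => (R.evals (K + 1) ω : ℝ)) = fun ω => (R.evals K ω : ℝ)
        + (if R.refresh (K + 1) ω then (2 + n : ℝ) else 2) := by
      funext ω
      unfold evals
      rw [Finset.sum_range_succ]
      push_cast
      split_ifs <;> ring
    have h1 : HasMean P (fun ω => if R.refresh (K + 1) ω then (2 + n : ℝ) else 2) 3 := by
      refine ⟨integrable_ite_coin (R.measurable_refresh K) (integrable_const _)
        (integrable_const _), ?_⟩
      have hp := measureReal_coin (R.measurable_refresh K) (by positivity) (R.refresh_law K)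
      rw [integral_ite_coin (R.measurable_refresh K) (Z := fun _ => (2 + n : ℝ))
        (W := fun _ => (2 : ℝ)) (integrable_const _) (integrable_const _),
        setIntegral_const, setIntegral_const, hp.1, hp.2, smul_eq_mul, smul_eq_mul]
      field_simp
      ring
    rw [e]
    have := ih.add h1
    push_cast
    convert this using 1
    ring

/-- The stage with constant step size reaches the noise level. The mean gap at the anchor falls to
`(744 / 5 + 1) B`, and `301` exceeds twice that factor. -/
theorem Good.exists_le_of_constant_step {R : Run D P (fun _ => D.eta) D.μ x₀} (h : R.Good)
    (h0 : Integrable (fun ω => D.gapR (x₀ ω)) P) (hB : 0 < D.B) (b : Bool) :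
    ∃ k : ℕ, ∫ ω, D.gapR (R.output b k ω) ∂P ≤ 301 * D.B ∧
      (k : ℝ) ≤ (D.delta D.eta)⁻¹ * Real.posLog (2 * (∫ ω, D.gapR (x₀ ω) ∂P) / D.B) + 1 + n := by
  have hn := h.adm.cast_pos
  have hη := h.adm.eta_pos
  have hδ := h.adm.delta_pos hη
  have hδ1 := h.adm.delta_le hη le_rfl
  have hslow : ∀ k : ℕ, D.eta ≤ (1 + 1 / (2 * (n : ℝ))) * D.eta := fun k => by
    have : 0 < 1 / (2 * (n : ℝ)) * D.eta := by positivity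
    linarith
  obtain ⟨xs, hxs, hmin⟩ := h.adm.exists_argmin h.proper
  have hφ : 0 ≤ ∫ ω, D.gapR (x₀ ω) ∂P := integral_nonneg fun ω => D.gapR_nonneg _
  have hS := h.adm.noise_nonneg
  have hT : ∀ k, R.potential xs (k + 1) ≤ (1 - D.delta D.eta) * R.potential xs k
      + 744 / 5 * D.noise * D.delta D.eta ^ 2 := fun k =>
    (h.potential_contracts hxs hmin hslow h0 k).trans (le_of_eq (by unfold Problem.noise; ring))
  set l := Real.posLog (2 * (∫ ω, D.gapR (x₀ ω) ∂P) / D.B)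
  have hl : 0 ≤ l := Real.posLog_nonneg
  set m := ⌈(D.delta D.eta)⁻¹ * l⌉₊
  have hm1 : l ≤ D.delta D.eta * m := by
    have := mul_le_mul_of_nonneg_left (Nat.le_ceil ((D.delta D.eta)⁻¹ * l)) hδ.le
    rwa [mul_inv_cancel_left₀ hδ.ne'] at this
  have hm2 : (m : ℝ) ≤ (D.delta D.eta)⁻¹ * l + 1 := (Nat.ceil_lt_add_one (by positivity)).le
  have hanchor : ∫ ω, D.gapR (R.anchor (m + n) ω) ∂P < 301 * D.B / 2 := by
    have h1 := le_of_contraction hδ (by linarith) (by positivity) hT (m + n)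
    have h2 := h.potential_zero_le hxs hmin h0
    have h3 := pow_mul_le_of_posLog_le (by linarith : D.delta D.eta ≤ 1)
      (by positivity : 0 ≤ 2 * ∫ ω, D.gapR (x₀ ω) ∂P) hB (m := m + n) (hm1.trans (by
        push_cast
        exact mul_le_mul_of_nonneg_left (by linarith) hδ.le))
    have h4 : max (R.potential xs 0) 0 ≤ 2 * ∫ ω, D.gapR (x₀ ω) ∂P :=
      max_le h2 (by positivity)
    have h5 := mul_le_mul_of_nonneg_left h4
      (pow_nonneg (by linarith : 0 ≤ 1 - D.delta D.eta) (m + n))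
    have h6 := h.adm.noise_mul_delta_le_B
    have h7 := h.integral_gapR_anchor_le xs (m + n)
    linarith
  obtain ⟨k, hk, hle⟩ := h.exists_integral_gapR_output_le hslow h0 b (by positivity) hanchor
  refine ⟨k, hle, ?_⟩
  have : (k : ℝ) ≤ m + n := by exact_mod_cast hk
  linarith

/-- The stage with decreasing step sizes, started at the noise level. The initial potential is at
most `2 · 301 B ≤ 1806 δ noise`, which gives the constant of the decreasing recursion; the number
of steps comes from `2 · 1806 noise / (k + 2) < ε / 2`. -/
theorem Good.exists_le_of_decreasing_step {R : Run D P D.etaDecr D.μ x₀} (h : R.Good)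
    (h0 : Integrable (fun ω => D.gapR (x₀ ω)) P)
    (hinit : ∫ ω, D.gapR (x₀ ω) ∂P ≤ 301 * D.B) {ε : ℝ} (hε : 0 < ε) (b : Bool) :
    ∃ k : ℕ, ∫ ω, D.gapR (R.output b k ω) ∂P ≤ ε ∧
      (k : ℝ) ≤ 7224 * (D.noise / ε) + 1 + n := by
  have hn := h.adm.cast_pos
  have hη := h.adm.eta_pos
  have hδ := h.adm.delta_pos hη
  have hδ1 := h.adm.delta_le hη le_rfl
  have hslow := h.adm.etaDecr_slow
  obtain ⟨xs, hxs, hmin⟩ := h.adm.exists_argmin h.proper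
  have hS := h.adm.noise_nonneg
  have hT : ∀ k : ℕ, R.potential xs (k + 1)
      ≤ (1 - min (D.delta D.eta) (2 / (((k + 1 : ℕ) : ℝ) + 2))) * R.potential xs k
      + 744 / 5 * D.noise * min (D.delta D.eta) (2 / (((k + 1 : ℕ) : ℝ) + 2)) ^ 2 := fun k => by
    have := h.potential_contracts hxs hmin hslow h0 k
    rw [h.adm.delta_etaDecr] at this
    exact this.trans (le_of_eq (by unfold Problem.noise; ring))
  have h2 := h.potential_zero_le hxs hmin h0
  have h3 := h.adm.B_le
  set m := ⌈7224 * (D.noise / ε)⌉₊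
  have hm2 : (m : ℝ) ≤ 7224 * (D.noise / ε) + 1 := (Nat.ceil_lt_add_one (by positivity)).le
  have hm1 : 7224 * D.noise ≤ m * ε := by
    have := mul_le_mul_of_nonneg_right (Nat.le_ceil (7224 * (D.noise / ε))) hε.le
    rwa [mul_assoc, div_mul_cancel₀ _ hε.ne'] at this
  have hanchor : ∫ ω, D.gapR (R.anchor (m + n) ω) ∂P < ε / 2 := by
    have h1 := le_of_decreasing_contraction (M := 1806 * D.noise) hδ (by linarith)
      (by linarith) (by positivity) (by linarith) hT (m + n)
    have h4 : min (D.delta D.eta) (2 / (((m + n : ℕ) : ℝ) + 2)) ≤ 2 / (((m + n : ℕ) : ℝ) + 2) :=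
      min_le_right _ _
    have h5 := mul_le_mul_of_nonneg_left h4 (by positivity : 0 ≤ 1806 * D.noise)
    have h6 : 1806 * D.noise * (2 / (((m + n : ℕ) : ℝ) + 2)) < ε / 2 := by
      rw [mul_div_assoc', div_lt_iff₀ (by positivity)]
      push_cast
      nlinarith [mul_pos hε hn]
    exact ((h.integral_gapR_anchor_le xs (m + n)).trans (h1.trans h5)).trans_lt h6
  obtain ⟨k, hk, hle⟩ := h.exists_integral_gapR_output_le hslow h0 b hε hanchor
  refine ⟨k, hle, ?_⟩
  have : (k : ℝ) ≤ m + n := by exact_mod_cast hk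
  linarith

end Run

/-- The total cost of both stages in terms of the accuracy. -/
theorem Problem.Admissible.total_cost_le {n p : ℕ} {D : Problem n p} (hD : D.Admissible) {φ ε : ℝ}
    (hφ : 0 ≤ φ) (hε : 0 < ε) (hεB : ε ≤ 301 * D.B) {K₁ K₂ : ℝ}
    (h1 : K₁ ≤ (D.delta D.eta)⁻¹ * Real.posLog (2 * φ / D.B) + 1 + n)
    (h2 : K₂ ≤ 7224 * (D.noise / ε) + 1 + n) :
    n + 3 * K₁ + (n + 3 * K₂) ≤ 45000 * ((n + Real.sqrt (n * D.LQ / D.μ)) * Real.posLog (φ / ε)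
      + D.rhoQ * D.σ ^ 2 / (D.μ * ε)) := by
  have hn := hD.cast_pos
  have hn1 := hD.one_le_cast
  have hδ := hD.delta_pos hD.eta_pos
  have hS := hD.noise_nonneg
  have hB : 0 < D.B := by linarith
  have e : D.rhoQ * D.σ ^ 2 / (D.μ * ε) = D.noise / ε := by unfold Problem.noise; rw [div_div]
  -- the rate of the constant step is at most a multiple of `noise / ε`
  have h3 : (D.delta D.eta)⁻¹ ≤ 903 * (D.noise / ε) := by
    have := hD.B_le
    rw [inv_le_iff_one_le_mul₀ hδ, mul_div_assoc', div_mul_eq_mul_div, le_div_iff₀ hε]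
    linarith
  have h4 : (n : ℝ) ≤ (D.delta D.eta)⁻¹ / 3 := by
    have := hD.mul_delta_le hD.eta_pos le_rfl
    rw [le_div_iff₀ (by norm_num), ← one_div, le_div_iff₀ hδ]
    linarith
  -- passing from `B` to `ε` in the logarithm costs a factor `2 · 301 ≤ exp 7`
  have h5 : Real.posLog (2 * φ / D.B) ≤ 7 + Real.posLog (φ / ε) := by
    have h6 : 2 * φ / D.B ≤ 602 * (φ / ε) := by
      rw [mul_div_assoc', div_le_div_iff₀ hB hε]
      nlinarith
    have h7 : Real.posLog (2 * φ / D.B) ≤ Real.posLog (602 * (φ / ε)) :=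
      Real.monotoneOn_posLog (by simp; positivity) (by simp; positivity) h6
    have h8 : Real.posLog (602 : ℝ) ≤ 7 := by
      refine max_le (by norm_num) ((Real.log_le_iff_le_exp (by norm_num)).2 ?_)
      have h9 : (2.7 : ℝ) ^ 7 ≤ Real.exp 1 ^ 7 :=
        pow_le_pow_left₀ (by norm_num) (by linarith [Real.exp_one_gt_d9]) 7
      rw [← Real.exp_nat_mul] at h9
      norm_num at h9 ⊢
      linarith
    linarith [Real.posLog_mul (x := (602 : ℝ)) (y := φ / ε)]
  have hl : 0 ≤ Real.posLog (φ / ε) := Real.posLog_nonneg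
  have h6 := mul_le_mul_of_nonneg_left h5 (inv_pos.2 hδ).le
  have h7 := mul_le_mul_of_nonneg_right hD.inv_delta_le hl
  have h8 : 0 ≤ (n + Real.sqrt (n * D.LQ / D.μ)) * Real.posLog (φ / ε) := by positivity
  have h9 : 0 ≤ D.noise / ε := by positivity
  rw [e]
  nlinarith

end AccSVRG

end

theorem mainTheorem1 :
    ∃ c C : ℝ, 1 ≤ c ∧ 0 < C ∧
      ∀ (n p : ℕ) (D : AccSVRG.Problem n p), D.Admissible →
      ∀ (x₀ : AccSVRG.Vec p), D.ψ x₀ ≠ ⊤ →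
      ∀ (ε : ℝ), 0 < ε → ε ≤ c * D.B →
      ∀ (Ω : Type*) [MeasurableSpace Ω] (P : MeasureTheory.Measure Ω)
        [MeasureTheory.IsProbabilityMeasure P] (useAnchor : Bool)
        (R₁ : AccSVRG.Run D P (fun _ => D.eta) D.μ (fun _ => x₀)),
      ∃ K₁ : ℕ, IsLeast {k | R₁.expGap useAnchor k ≤ ENNReal.ofReal (c * D.B)} K₁ ∧
        ∀ (R₂ : AccSVRG.Run D P D.etaDecr D.μ (R₁.output useAnchor K₁)),
        ∃ K₂ : ℕ, R₂.expGap useAnchor K₂ ≤ ENNReal.ofReal ε ∧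
          ∫ ω, ((R₁.evals K₁ ω : ℝ) + (R₂.evals K₂ ω : ℝ)) ∂P
            ≤ C * (((n : ℝ) + Real.sqrt (n * D.LQ / D.μ))
                  * Real.posLog ((D.gap x₀).toReal / ε)
                + D.rhoQ * D.σ ^ 2 / (D.μ * ε)) := by
  refine ⟨301, 45000, by norm_num, by norm_num, ?_⟩
  intro n p D hD x₀ hx₀ ε hε hεB Ω _ P _ b R₁
  have hB : 0 < D.B := by linarith
  have hη := hD.eta_pos
  -- the regularizer has an affine minorant since the run provides a proximal point
  have hP : D.Proper := by
    obtain ⟨ω⟩ : Nonempty Ω := P.nonempty_of_neZero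
    exact hD.proper_of_isProx hη (R₁.x_succ 0 ω) hx₀
  have g₁ : R₁.Good := ⟨hD, hP, fun _ => hη, fun _ => le_rfl, memLp_const x₀, fun _ => hx₀⟩
  have i₁ : Integrable (fun _ : Ω => D.gapR x₀) P := integrable_const _
  have s₁ : ∀ k : ℕ, D.eta ≤ (1 + 1 / (2 * (n : ℝ))) * D.eta := fun k => by
    have := hD.cast_pos
    have : 0 < 1 / (2 * (n : ℝ)) * D.eta := by positivity
    linarith
  have hmem : ∀ k, R₁.expGap b k ≤ ENNReal.ofReal (301 * D.B)
      ↔ ∫ ω, D.gapR (R₁.output b k ω) ∂P ≤ 301 * D.B := fun k => by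
    rw [g₁.expGap_eq s₁ i₁, ENNReal.ofReal_le_ofReal_iff (by positivity)]
  obtain ⟨k, hk, hkle⟩ := g₁.exists_le_of_constant_step i₁ hB b
  have hex : ∃ k, R₁.expGap b k ≤ ENNReal.ofReal (301 * D.B) := ⟨k, (hmem k).2 hk⟩
  classical
  refine ⟨Nat.find hex, ⟨Nat.find_spec hex, fun j hj => Nat.find_min' hex hj⟩, ?_⟩
  have hK₁ : ((Nat.find hex : ℕ) : ℝ) ≤ k := by
    exact_mod_cast Nat.find_min' hex ((hmem k).2 hk)
  have hgap := (hmem _).1 (Nat.find_spec hex)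
  intro R₂
  have g₂ : R₂.Good := ⟨hD, hP, fun k => hD.etaDecr_pos _, fun k => D.etaDecr_le _,
    g₁.memLp_output b _, g₁.psi_output b _⟩
  have i₂ := g₁.integrable_gapR_output s₁ i₁ b (Nat.find hex)
  obtain ⟨K₂, hK₂, hK₂le⟩ := g₂.exists_le_of_decreasing_step i₂ hgap hε b
  refine ⟨K₂, ?_, ?_⟩
  · rw [g₂.expGap_eq hD.etaDecr_slow i₂]
    exact ENNReal.ofReal_le_ofReal hK₂
  · have hev := (R₁.hasMean_evals hD.n_pos (Nat.find hex)).add (R₂.hasMean_evals hD.n_pos K₂)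
    rw [hev.2]
    refine hD.total_cost_le (D.gapR_nonneg x₀) hε hεB (hK₁.trans (hkle.trans (le_of_eq ?_))) hK₂le
    simp
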